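/- Let $\mathcal G_0$ be the set of right continuous nondecreasing maps $g:[0,1[\to[0,1]$ (extended by $g(1):=1$), with the distance $\|g_1-g_2\|_{L^2}$ of $L^2=L^2([0,1],\mathrm{Leb})$. Fix $\beta>0$ and let $\mathbb Q_0$ be the Dirichlet process on $\mathcal G_0$, i.e. the Borel probability measure such that for all $0=t_0<t_1<\dots<t_N<t_{N+1}=1$ (with $x_0:=0$, $x_{N+1}:=1$) $$\mathbb Q_0(g_{t_1}\in dx_1,\dots,g_{t_N}\in dx_N)=\frac{\Gamma(\beta)}{\prod_{i=0}^N\Gamma(\beta(t_{i+1}-t_i))}\prod_{i=0}^N(x_{i+1}-x_i)^{\beta(t_{i+1}-t_i)-1}\,dx_1\cdots dx_N\quad\text{on } 0<x_1<\dots<x_N<1 .$$ Let $\mathfrak C^1(\mathcal G_0)$ be the set of all functions $u(g)=U(\int_0^1 f_1g\,dt,\dots,\int_0^1 f_mg\,dt)$ with $m\in\mathbb N$, $U\in C^1(\mathbb R^m)$, $f_i\in L^2$, and $\mathfrak Z^1(\mathcal G_0)$ the set of all functions $u(g)=U(\int_0^1\alpha_1(g_s)ds,\dots,\int_0^1\alpha_m(g_s)ds)$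 with $m\in\mathbb N$, $U\in C^1(\mathbb R^m)$, $\alpha_i\in C^1([0,1])$. The gradient $\mathbb Du(g)\in L^2$ is the element with $\lim_{t\downarrow0}\frac1t[u(g+tf)-u(g)]=\langle\mathbb Du(g),f\rangle_{L^2}$ for all $f\in L^2$ such that $g+tf\in\mathcal G_0$ for all small $t>0$. Put $\mathbb E(u,v)=\int_{\mathcal G_0}\langle\mathbb Du(g),\mathbb Dv(g)\rangle_{L^2}\,d\mathbb Q_0(g)$ for $u,v\in\mathfrak Z^1(\mathcal G_0)\cup\mathfrak C^1(\mathcal G_0)$. **Theorem.** For $u\in\mathfrak Z^1(\mathcal G_0)\cup\mathfrak C^1(\mathcal G_0)$ the gradient exists at every $g\in\mathcal G_0$; in the above representations it is $\mathbb Du(g)=\sum_i\partial_iU(\int\vec f g\,dt)\,f_i$ if $u\in\mathfrak C^1(\mathcal G_0)$, and $\mathbb Du(g)=\sum_i\partial_iU(\int\vec\alpha(g_s)ds)\,\alpha_i'(g(\cdot))$ if $u\in\mathfrak Z^1(\mathcal G_0)$. The form $(\mathbb E,\mathfrak Z^1(\mathcal G_0))$ on $L^2(\mathcal G_0,\mathbb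 Q_0)$ and the operator $\mathbb D:\mathfrak Z^1(\mathcal G_0)\to L^2(\mathcal G_0\times[0,1],\mathbb Q_0\otimes\mathrm{Leb})$ are well defined on $\mathbb Q_0$-classes and closable. Let $(\mathbb E,\mathrm{Dom}(\mathbb E))$ and $(\overline{\mathbb D},\mathrm{Dom}(\overline{\mathbb D}))$ be their closures; then $\mathrm{Dom}(\mathbb E)=\mathrm{Dom}(\overline{\mathbb D})$. For $u,w\in\mathrm{Dom}(\mathbb E)$ put $\Gamma(u,w)(g)=\langle\overline{\mathbb D}u(g),\overline{\mathbb D}w(g)\rangle_{L^2}$. Then: (i) $(\mathbb E,\mathfrak C^1(\mathcal G_0))$ is closable and its closure coincides with $(\mathbb E,\mathrm{Dom}(\mathbb E))$. Similarly, $(\mathbb D,\mathfrak C^1(\mathcal G_0))$ is closable and its closure coincides with $(\overline{\mathbb D},\mathrm{Dom}(\overline{\mathbb D}))$. (ii) All $u,w\in\mathfrak Z^1(\mathcal G_0)\cup\mathfrak C^1(\mathcal G_0)$ belong to $\mathrm{Dom}(\mathbb E)$, and $\Gamma(u,w)(g)=\langle\mathbb Du(g),\mathbb Dw(g)\rangle_{L^2}$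 for $\mathbb Q_0$-a.e. $g$; in particular the closed form satisfies $\mathbb E(u,w)=\int_{\mathcal G_0}\langle\mathbb Du(g),\mathbb Dw(g)\rangle_{L^2}\,d\mathbb Q_0(g)$. (iii) For each $f\in\mathcal G_0$ the function $u_f:g\mapsto\|f-g\|_{L^2}$ belongs to $\mathrm{Dom}(\mathbb E)$ and $\Gamma(u_f,u_f)\le1$ $\mathbb Q_0$-a.e. on $\mathcal G_0$. (iv) $(\mathbb E,\mathrm{Dom}(\mathbb E))$ is strongly local: $\mathbb E(u,v)=0$ whenever $u,v\in\mathrm{Dom}(\mathbb E)$ have compact support and $v$ is constant ($\mathbb Q_0$-a.e.) on a neighbourhood of the support of $u$, where the support of $u$ is that of the measure $|u|\,\mathbb Q_0$. -/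

import Mathlib

open MeasureTheory Filter Topology Set unitInterval
open scoped ENNReal

namespace Wasserstein

noncomputable section

/-- The space `𝒢₀` of right continuous nondecreasing maps `g : [0,1[ → [0,1]`, each of them
extended to `[0,1]` by `g 1 = 1`. -/
@[ext]
structure G0 where
  toFun : I → I
  mono : Monotone toFun
  right_cont : ∀ t : I, t < 1 → ContinuousWithinAt toFun (Ici t) t
  map_one : toFun 1 = 1

instance : CoeFun G0 (fun _ => I → I) := ⟨G0.toFun⟩

/-- The Hilbert space `L²([0,1], Leb)`. -/
abbrev H : Type := Lp ℝ 2 (volume : Measure I)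

theorem G0.memLp (g : G0) : MemLp (fun t : I => (g t : ℝ)) 2 volume := by
  refine MemLp.of_bound (C := 1) ?_ (Eventually.of_forall fun t => ?_)
  · exact (measurable_subtype_coe.comp g.mono.measurable).aestronglyMeasurable
  · rw [Real.norm_eq_abs, abs_of_nonneg (g t).2.1]
    exact (g t).2.2

/-- The inclusion of `𝒢₀` into `L²([0,1], Leb)`. -/
def G0.toL2 (g : G0) : H := g.memLp.toLp

theorem G0.toL2_injective : Function.Injective G0.toL2 := by
  intro g h hgh
  have hae : ∀ᵐ t : I, (g t : ℝ) = h t := (MemLp.toLp_eq_toLp_iff g.memLp h.memLp).1 hgh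
  ext1
  funext t
  rcases eq_or_lt_of_le t.2.2 with h1 | h1
  · have : t = 1 := Subtype.ext h1
    rw [this, g.map_one, h.map_one]
  have ht : t < 1 := h1
  have hfreq : ∃ᶠ s in 𝓝[>] t, g s = h s := by
    rw [frequently_iff]
    intro U hU
    obtain ⟨b, hb, hbU⟩ := (mem_nhdsGT_iff_exists_Ioo_subset' ht).1 hU
    have hpos : 0 < volume (Ioo t b) := by
      rw [unitInterval.volume_Ioo]
      simpa using (show t < b from hb)
    obtain ⟨s, hs, hs'⟩ : ∃ s ∈ Ioo t b, (g s : ℝ) = h s := by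
      by_contra hcon
      push Not at hcon
      exact hpos.ne' (measure_mono_null (fun s hs => hcon s hs) (ae_iff.1 hae))
    exact ⟨s, hbU hs, Subtype.ext hs'⟩
  have hg : Tendsto g.toFun (𝓝[>] t) (𝓝 (g t)) :=
    (g.right_cont t ht).mono_left (nhdsWithin_mono _ Ioi_subset_Ici_self)
  have hh : Tendsto h.toFun (𝓝[>] t) (𝓝 (h t)) :=
    (h.right_cont t ht).mono_left (nhdsWithin_mono _ Ioi_subset_Ici_self)
  exact tendsto_nhds_unique_of_frequently_eq hg hh hfreq

/-- `𝒢₀` carries the `L²`-distance `‖g₁ - g₂‖_{L²}`. -/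
instance : MetricSpace G0 := MetricSpace.induced G0.toL2 G0.toL2_injective inferInstance

instance : MeasurableSpace G0 := borel G0

instance : BorelSpace G0 := ⟨rfl⟩

/-! ### The Dirichlet process -/

/-- The points `0 = x₀, x₁, …, x_N, x_{N+1} = 1`. -/
def withEnds {N : ℕ} (x : Fin N → ℝ) : Fin (N + 2) → ℝ :=
  Fin.cons 0 (Fin.snoc (α := fun _ => ℝ) x 1)

open Classical in
/-- The density
`Γ(β) / ∏ᵢ Γ(β (tᵢ₊₁ - tᵢ)) * ∏ᵢ (xᵢ₊₁ - xᵢ) ^ (β (tᵢ₊₁ - tᵢ) - 1)`, `0 ≤ i ≤ N`, on the simplex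
`0 < x₁ < ⋯ < x_N < 1`; it vanishes off the simplex. -/
def dirichletDensity (β : ℝ) {N : ℕ} (t : Fin (N + 2) → I) (x : Fin N → ℝ) : ℝ :=
  if StrictMono (withEnds x) then
    Real.Gamma β / (∏ i : Fin (N + 1), Real.Gamma (β * ((t i.succ : ℝ) - t i.castSucc))) *
      ∏ i : Fin (N + 1), (withEnds x i.succ - withEnds x i.castSucc) ^
        (β * ((t i.succ : ℝ) - t i.castSucc) - 1)
  else 0

/-- `Q` is the Dirichlet process `ℚ₀^β` on `𝒢₀`: the probability measure under which, for all
`0 = t₀ < t₁ < ⋯ < t_N < t_{N+1} = 1`, the vector `(g_{t₁}, …, g_{t_N})` has the density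
`dirichletDensity β t` with respect to Lebesgue measure. -/
structure IsDirichletProcess (β : ℝ) (Q : Measure G0) : Prop where
  isProbabilityMeasure : IsProbabilityMeasure Q
  marginals : ∀ (N : ℕ) (t : Fin (N + 2) → I), StrictMono t → t 0 = 0 → t (Fin.last (N + 1)) = 1 →
    Q.map (fun g : G0 => fun i : Fin N => (g (t i.succ.castSucc) : ℝ)) =
      (volume : Measure (Fin N → ℝ)).withDensity
        (fun x => ENNReal.ofReal (dirichletDensity β t x))

/-! ### Cylinder functions -/

/-- The cylinder function `g ↦ U (∫ f₁ g dt, …, ∫ f_m g dt)`. -/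
def cylFun {m : ℕ} (U : (Fin m → ℝ) → ℝ) (f : Fin m → H) (g : G0) : ℝ :=
  U (fun i => ∫ t : I, f i t * (g t : ℝ))

/-- The cylinder function `g ↦ U (∫ α₁(g_s) ds, …, ∫ α_m(g_s) ds)`. -/
def zylFun {m : ℕ} (U : (Fin m → ℝ) → ℝ) (α : Fin m → ℝ → ℝ) (g : G0) : ℝ :=
  U (fun i => ∫ s : I, α i (g s))

/-- The class `ℭ¹(𝒢₀)`. -/
def C1 : Set (G0 → ℝ) :=
  {u | ∃ (m : ℕ) (U : (Fin m → ℝ) → ℝ) (f : Fin m → H), ContDiff ℝ 1 U ∧ u = cylFun U f}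

/-- The class `ℨ¹(𝒢₀)`. The functions `αᵢ ∈ C¹([0,1])` are the restrictions to `[0,1]` of
functions on `ℝ`; their values off `[0,1]` play no role. -/
def Z1 : Set (G0 → ℝ) :=
  {u | ∃ (m : ℕ) (U : (Fin m → ℝ) → ℝ) (α : Fin m → ℝ → ℝ), ContDiff ℝ 1 U ∧
    (∀ i, ContDiffOn ℝ 1 (α i) (Icc 0 1)) ∧ u = zylFun U α}

/-! ### The gradient -/

/-- `v ∈ L²([0,1], Leb)` is the gradient of `u` at `g`: for every direction `f` for which the flow
`t ↦ g + t f` stays within `𝒢₀` for small `t > 0`, the directional derivative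
`lim_{t ↓ 0} (u (g + t f) - u g) / t` exists and equals `⟪v, f⟫`. Here `γ t` is the element
`g + t f` of `𝒢₀`. -/
def HasGradAt (u : G0 → ℝ) (v : H) (g : G0) : Prop :=
  ∀ (f : H) (γ : ℝ → G0), (∀ᶠ t in 𝓝[>] (0 : ℝ), (γ t).toL2 = g.toL2 + t • f) →
    Tendsto (fun t : ℝ => (u (γ t) - u g) / t) (𝓝[>] 0) (𝓝 (inner ℝ v f))

open Classical in
/-- The gradient `𝔻u(g) ∈ L²([0,1], Leb)`, where it exists. -/
def grad (u : G0 → ℝ) (g : G0) : H :=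
  if h : ∃ v, HasGradAt u v g then h.choose else 0

/-- The operator `𝔻` with domain `𝓓`, as an operator from `L²(𝒢₀, Q)` to `L²(Q; L²([0,1], Leb))`;
the latter is `L²(𝒢₀ × [0,1], Q ⊗ Leb)`. Its graph consists of the classes of `(u, 𝔻u)`, `u ∈ 𝓓`. -/
def gradGraph (Q : Measure G0) (𝓓 : Set (G0 → ℝ)) : Set (Lp ℝ 2 Q × Lp H 2 Q) :=
  {p | ∃ u ∈ 𝓓, p.1 =ᵐ[Q] u ∧ p.2 =ᵐ[Q] grad u}

/-- The operator whose graph is `gradGraph Q 𝓓`. -/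
def gradOp (Q : Measure G0) (𝓓 : Set (G0 → ℝ)) : Lp ℝ 2 Q →ₗ.[ℝ] Lp H 2 Q :=
  (Submodule.span ℝ (gradGraph Q 𝓓)).toLinearPMap

/-- The closure `𝔻̄` of `(𝔻, ℨ¹(𝒢₀))`. -/
def gradBar (Q : Measure G0) : Lp ℝ 2 Q →ₗ.[ℝ] Lp H 2 Q := (gradOp Q Z1).closure

/-! ### The Dirichlet form -/

/-- The Wasserstein Dirichlet integral `𝔼(u,v) = ∫ ⟪𝔻u(g), 𝔻v(g)⟫_{L²} dQ(g)`. -/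
def energy (Q : Measure G0) (u v : G0 → ℝ) : ℝ :=
  ∫ g, inner ℝ (grad u g) (grad v g) ∂Q

/-- `(uₙ)` is `𝔼`-Cauchy. -/
def EnergyCauchy (Q : Measure G0) (u : ℕ → G0 → ℝ) : Prop :=
  ∀ ε > 0, ∃ N, ∀ m ≥ N, ∀ n ≥ N, energy Q (u m - u n) (u m - u n) < ε

/-- The form `(𝔼, 𝓓)` is closable in `L²(𝒢₀, Q)`. -/
def FormClosable (Q : Measure G0) (𝓓 : Set (G0 → ℝ)) : Prop :=
  ∀ u : ℕ → G0 → ℝ, (∀ n, u n ∈ 𝓓) → EnergyCauchy Q u →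
    Tendsto (fun n => eLpNorm (u n) 2 Q) atTop (𝓝 0) →
      Tendsto (fun n => energy Q (u n) (u n)) atTop (𝓝 0)

/-- `(uₙ)` is an `𝔼`-Cauchy sequence in `𝓓` which converges to `w` in `L²(𝒢₀, Q)`. -/
def FormApprox (Q : Measure G0) (𝓓 : Set (G0 → ℝ)) (u : ℕ → G0 → ℝ) (w : Lp ℝ 2 Q) : Prop :=
  (∀ n, u n ∈ 𝓓) ∧ EnergyCauchy Q u ∧
    Tendsto (fun n => eLpNorm (u n - (w : G0 → ℝ)) 2 Q) atTop (𝓝 0)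

/-- The domain of the closure of `(𝔼, 𝓓)`. -/
def closureDom (Q : Measure G0) (𝓓 : Set (G0 → ℝ)) : Set (Lp ℝ 2 Q) :=
  {w | ∃ u, FormApprox Q 𝓓 u w}

open Classical in
/-- The closure of `(𝔼, 𝓓)`: the limit of `𝔼(uₙ, vₙ)` along approximating sequences for `w` and
`z`; if `(𝔼, 𝓓)` is closable, the limit exists and does not depend on these sequences. -/
def closureForm (Q : Measure G0) (𝓓 : Set (G0 → ℝ)) (w z : Lp ℝ 2 Q) : ℝ :=
  if h : ∃ c : ℝ, ∃ u v, FormApprox Q 𝓓 u w ∧ FormApprox Q 𝓓 v z ∧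
      Tendsto (fun n => energy Q (u n) (v n)) atTop (𝓝 c)
  then h.choose else 0

/-- `Dom(𝔼)`: the domain of the closure of `(𝔼, ℨ¹(𝒢₀))`. -/
def domE (Q : Measure G0) : Set (Lp ℝ 2 Q) := closureDom Q Z1

/-- `𝔼` on `Dom(𝔼)`: the closure of `(𝔼, ℨ¹(𝒢₀))`. -/
def formE (Q : Measure G0) (w z : Lp ℝ 2 Q) : ℝ := closureForm Q Z1 w z

open Classical in
/-- The square field operator `Γ(w,z)(g) = ⟪𝔻̄w(g), 𝔻̄z(g)⟫_{L²}` for `w, z ∈ Dom(𝔻̄)`. -/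
def carre (Q : Measure G0) (w z : Lp ℝ 2 Q) (g : G0) : ℝ :=
  if h : w ∈ (gradBar Q).domain ∧ z ∈ (gradBar Q).domain then
    inner ℝ (gradBar Q ⟨w, h.1⟩ g) (gradBar Q ⟨z, h.2⟩ g)
  else 0

/-- A form `𝓔` with domain `𝓓` on `L²(𝒢₀, Q)` is strongly local: `𝓔(u,v) = 0` whenever `u` and `v`
have compact support and `v` is constant on a neighbourhood of the support of `u`. The support of
`u` is the support of the measure `|u| Q`. -/
def StronglyLocal (Q : Measure G0) (𝓓 : Set (Lp ℝ 2 Q)) (𝓔 : Lp ℝ 2 Q → Lp ℝ 2 Q → ℝ) : Prop :=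
  ∀ u ∈ 𝓓, ∀ v ∈ 𝓓,
    IsCompact (Q.withDensity fun g => ‖u g‖ₑ).support →
    IsCompact (Q.withDensity fun g => ‖v g‖ₑ).support →
    (∃ (O : Set G0) (c : ℝ), IsOpen O ∧ (Q.withDensity fun g => ‖u g‖ₑ).support ⊆ O ∧
      ∀ᵐ g ∂Q, g ∈ O → v g = c) →
    𝓔 u v = 0

end

end Wasserstein

open Wasserstein

namespace Wasserstein

noncomputable section

/-! ### Dominated convergence in `L²` -/

/-! Closability rests on an integration by parts estimate. A `C²` function `φ` with `φ 0 = φ 1 = 0`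
gives the maps `g ↦ τ ∘ g`, `τ x = x + s φ x`, which move `g` in the direction `φ ∘ g`. When `τ`
acts on each coordinate, a finite dimensional Dirichlet density, taken with the Jacobian, changes by
a factor `exp E` with `|E| ≤ (β + 2) δ`, where `δ = O(s)` controls `log τ'` and its Lipschitz
constant. The decisive point is that this bound does not depend on the number of coordinates
(`IsWarp.exists_ratio`). Approximation of paths by step functions therefore carries it over to `Q`,
and division by `s` gives `|∫ ⟪Du, φ ∘ g⟫ dQ| ≤ c ∫ |u| dQ` (`IsDirichletProcess.exists_ibp_bound`).
An exact divergence formula is not needed. Applied to products `u v`, the estimate shows that if `uₙ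
→ 0` and `Duₙ → W` in `L²`, then `∫ v ⟪W, φ ∘ g⟫ dQ = 0`. The sines and cosines of linear
functionals are rich enough as test functions `v` to make `⟪W(g), φ ∘ g⟫` vanish almost everywhere.
Almost every `g` is strictly increasing, so the functions `φ ∘ g` are total in `L²`, and `W = 0`
(`IsDirichletProcess.closable`).

The two classes of cylinder functions have the same closure because the basic functionals of one are
bounded almost everywhere limits, gradients included, of functions of the other. A potential `∫
α(g)` is approximated by averaging `g` over small cells (`approx_potFun`). A linear functional `∫ f
g` is approximated by functions of smoothed level-crossing times of `g`: evaluating `f` at the time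
when `g` crosses the level `g(t)` recovers `f(t)` if `g` is strictly increasing (`approx_linFun`).
Composition with `C¹` functions and a density argument in `L²` do the rest.

The energy is the squared `L²`-norm of the gradient, so the closed form and the closed operator are
both read off from the closure of one graph. For (iii), `‖f - g‖` is the limit of the smooth
functions `√(δ + ‖f - g‖²)`, whose gradients have norm at most `1`. For (iv), closability forces the
gradient to vanish almost everywhere on level sets, so the gradients of `u` and `v` are nowhere
nonzero together. -/

theorem tendsto_eLpNorm_two_of_dominated {X E ι : Type*} [MeasurableSpace X] {μ : Measure X}
    [NormedAddCommGroup E] {l : Filter ι} [l.IsCountablyGenerated] {F : ι → X → E} {b : X → ℝ}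
    (hb : MemLp b 2 μ) (hF : ∀ᶠ i in l, AEStronglyMeasurable (F i) μ)
    (hFb : ∀ᶠ i in l, ∀ᵐ x ∂μ, ‖F i x‖ ≤ b x)
    (h : ∀ᵐ x ∂μ, Tendsto (fun i => F i x) l (𝓝 0)) :
    Tendsto (fun i => eLpNorm (F i) 2 μ) l (𝓝 0) := by
  simp only [eLpNorm_eq_lintegral_rpow_enorm_toReal two_ne_zero ENNReal.ofNat_ne_top]
  have key : Tendsto (fun i => ∫⁻ x, ‖F i x‖ₑ ^ (2 : ℝ≥0∞).toReal ∂μ) l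
      (𝓝 (∫⁻ _x, 0 ∂μ)) := by
    refine tendsto_lintegral_filter_of_dominated_convergence'
      (fun x => ‖b x‖ₑ ^ (2 : ℝ≥0∞).toReal) ?_ ?_ ?_ ?_
    · filter_upwards [hF] with i hi
      exact hi.enorm.pow_const _
    · filter_upwards [hFb] with i hi
      filter_upwards [hi] with x hx
      gcongr
      rw [← ofReal_norm, ← ofReal_norm]
      exact ENNReal.ofReal_le_ofReal (hx.trans (Real.le_norm_self _))
    · exact (lintegral_rpow_enorm_lt_top_of_eLpNorm_lt_top two_ne_zero ENNReal.ofNat_ne_top hb.2).ne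
    · filter_upwards [h] with x hx
      have h1 : Tendsto (fun i => ‖F i x‖ₑ) l (𝓝 0) := by simpa using hx.enorm
      simpa using h1.ennrpow_const (2 : ℝ≥0∞).toReal
  rw [lintegral_zero] at key
  have := key.ennrpow_const (1 / (2 : ℝ≥0∞).toReal)
  simpa using this

theorem tendsto_eLpNorm_two_of_bounded {X E ι : Type*} [MeasurableSpace X] {μ : Measure X}
    [IsFiniteMeasure μ] [NormedAddCommGroup E] {l : Filter ι} [l.IsCountablyGenerated]
    {F : ι → X → E} {f : X → E} (C : ℝ)
    (hF : ∀ᶠ i in l, AEStronglyMeasurable (F i) μ) (hf : AEStronglyMeasurable f μ)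
    (hFC : ∀ᶠ i in l, ∀ᵐ x ∂μ, ‖F i x‖ ≤ C) (hfC : ∀ᵐ x ∂μ, ‖f x‖ ≤ C)
    (h : ∀ᵐ x ∂μ, Tendsto (fun i => F i x) l (𝓝 (f x))) :
    Tendsto (fun i => eLpNorm (F i - f) 2 μ) l (𝓝 0) := by
  refine tendsto_eLpNorm_two_of_dominated (memLp_const (2 * C))
    (hF.mono fun i hi => hi.sub hf) ?_ ?_
  · filter_upwards [hFC] with i hi
    filter_upwards [hi, hfC] with x hx hx'
    calc ‖(F i - f) x‖ ≤ ‖F i x‖ + ‖f x‖ := norm_sub_le _ _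
      _ ≤ 2 * C := by linarith
  · filter_upwards [h] with x hx
    simpa using hx.sub_const (f x)

/-! ### Representatives in `L²([0,1])` and the topology of `𝒢₀`. -/

open Classical in
/-- The class in `L²([0,1])` of a square integrable function (and `0` for other functions). -/
def toH (f : I → ℝ) : H := if h : MemLp f 2 (volume : Measure I) then h.toLp f else 0

theorem toH_ae {f : I → ℝ} (h : MemLp f 2 (volume : Measure I)) : toH f =ᵐ[volume] f := by
  rw [toH, dif_pos h]; exact h.coeFn_toLp

theorem toH_eq {f : I → ℝ} (h : MemLp f 2 (volume : Measure I)) {v : H} (hv : v =ᵐ[volume] f) :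
    toH f = v := Lp.ext ((toH_ae h).trans hv.symm)

theorem memLp_of_bounded {X E : Type*} [MeasurableSpace X] {μ : Measure X} [IsFiniteMeasure μ]
    [NormedAddCommGroup E] {f : X → E} (hf : AEStronglyMeasurable f μ) {C : ℝ}
    (hC : ∀ x, ‖f x‖ ≤ C) : MemLp f 2 μ :=
  MemLp.of_bound hf C (Eventually.of_forall hC)

theorem norm_toH_le {f : I → ℝ} {C : ℝ} (hC0 : 0 ≤ C) (hC : ∀ x, ‖f x‖ ≤ C) : ‖toH f‖ ≤ C := by
  rw [toH]
  split_ifs with h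
  · rw [Lp.norm_toLp]
    refine ENNReal.toReal_le_of_le_ofReal hC0 ?_
    have := eLpNorm_le_of_ae_bound (p := 2) (μ := (volume : Measure I)) (f := f)
      (Eventually.of_forall hC)
    simpa using this
  · simpa using hC0

theorem tendsto_toH {ι : Type*} {l : Filter ι} [l.IsCountablyGenerated] {F : ι → I → ℝ}
    {f : I → ℝ} {C : ℝ} (hF : ∀ i, AEStronglyMeasurable (F i) volume)
    (hf : AEStronglyMeasurable f volume)
    (hFC : ∀ i t, ‖F i t‖ ≤ C) (hfC : ∀ t, ‖f t‖ ≤ C)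
    (h : ∀ᵐ t, Tendsto (fun i => F i t) l (𝓝 (f t))) :
    Tendsto (fun i => toH (F i)) l (𝓝 (toH f)) := by
  have h1 : ∀ i, toH (F i) = (memLp_of_bounded (hF i) (hFC i)).toLp (F i) := fun i => by
    rw [toH, dif_pos]
  have h2 : toH f = (memLp_of_bounded hf hfC).toLp f := by rw [toH, dif_pos]
  simp only [h1, h2]
  rw [Lp.tendsto_Lp_iff_tendsto_eLpNorm'']
  exact tendsto_eLpNorm_two_of_bounded C (Eventually.of_forall hF) hf
    (Eventually.of_forall fun i => Eventually.of_forall (hFC i)) (Eventually.of_forall hfC) h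

theorem exists_subseq_ae_tendsto {X E : Type*} [MeasurableSpace X] {μ : Measure X}
    [NormedAddCommGroup E] {F : ℕ → Lp E 2 μ} {f : Lp E 2 μ} (h : Tendsto F atTop (𝓝 f)) :
    ∃ ns : ℕ → ℕ, StrictMono ns ∧ ∀ᵐ x ∂μ, Tendsto (fun i => F (ns i) x) atTop (𝓝 (f x)) := by
  have h1 := tendstoInMeasure_of_tendsto_Lp h
  exact h1.exists_seq_tendsto_ae

theorem G0.measurable_coe (g : G0) : Measurable (fun t : I => (g t : ℝ)) :=
  measurable_subtype_coe.comp g.mono.measurable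

theorem G0.toL2_ae (g : G0) : g.toL2 =ᵐ[volume] fun t : I => (g t : ℝ) := g.memLp.coeFn_toLp

theorem G0.toL2_eq (g : G0) : g.toL2 = toH (fun t : I => (g t : ℝ)) :=
  (toH_eq g.memLp g.toL2_ae).symm

theorem G0.abs_le (g : G0) (t : I) : ‖(g t : ℝ)‖ ≤ 1 := by
  rw [Real.norm_eq_abs, abs_of_nonneg (g t).2.1]; exact (g t).2.2

theorem G0.norm_toL2_le (g : G0) : ‖g.toL2‖ ≤ 1 := by
  rw [g.toL2_eq]; exact norm_toH_le zero_le_one g.abs_le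

theorem G0.isometry_toL2 : Isometry G0.toL2 := Isometry.of_dist_eq fun _ _ => rfl

theorem G0.continuous_toL2 : Continuous G0.toL2 := G0.isometry_toL2.continuous

instance : SecondCountableTopology H :=
  haveI : Fact ((2 : ℝ≥0∞) ≠ ⊤) := ⟨ENNReal.ofNat_ne_top⟩
  inferInstance

instance : SecondCountableTopology G0 :=
  G0.isometry_toL2.isEmbedding.secondCountableTopology

theorem G0.tendsto_of_ae {ι : Type*} {l : Filter ι} [l.IsCountablyGenerated] {F : ι → G0} {g : G0}
    (h : ∀ᵐ t : I, Tendsto (fun i => (F i t : ℝ)) l (𝓝 (g t))) : Tendsto F l (𝓝 g) := by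
  rw [G0.isometry_toL2.isEmbedding.tendsto_nhds_iff]
  simp only [Function.comp_def, G0.toL2_eq]
  exact tendsto_toH (C := 1) (fun i => (F i).measurable_coe.aestronglyMeasurable)
    g.measurable_coe.aestronglyMeasurable (fun i => (F i).abs_le) g.abs_le h

theorem G0.exists_subseq_ae {F : ℕ → G0} {g : G0} (h : Tendsto F atTop (𝓝 g)) :
    ∃ ns : ℕ → ℕ, StrictMono ns ∧
      ∀ᵐ t : I, Tendsto (fun i => (F (ns i) t : ℝ)) atTop (𝓝 (g t)) := by
  obtain ⟨ns, h1, h2⟩ := exists_subseq_ae_tendsto ((G0.continuous_toL2.tendsto g).comp h)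
  refine ⟨ns, h1, ?_⟩
  have h3 : ∀ᵐ t : I, ∀ n, (F n).toL2 t = (F n t : ℝ) := ae_all_iff.2 fun n => (F n).toL2_ae
  filter_upwards [h2, h3, g.toL2_ae] with t h2 h3 h4
  simpa [h3, h4] using h2

theorem G0.abs_comp_le {a : ℝ → ℝ} {C : ℝ} (hC : ∀ x ∈ Icc (0 : ℝ) 1, ‖a x‖ ≤ C) (g : G0) (t : I) :
    ‖a (g t)‖ ≤ C := hC _ (g t).2

theorem exists_bound_Icc {a : ℝ → ℝ} (ha : Continuous a) :
    ∃ C, 0 ≤ C ∧ ∀ x ∈ Icc (0 : ℝ) 1, ‖a x‖ ≤ C := by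
  obtain ⟨C, hC⟩ := (isCompact_Icc (a := (0 : ℝ)) (b := 1)).exists_bound_of_continuousOn ha.continuousOn
  exact ⟨C, (norm_nonneg _).trans (hC 0 (by simp)), hC⟩

theorem G0.aestronglyMeasurable_comp {a : ℝ → ℝ} (ha : Continuous a) (g : G0) :
    AEStronglyMeasurable (fun t : I => a (g t)) volume :=
  (ha.measurable.comp g.measurable_coe).aestronglyMeasurable

theorem G0.memLp_comp {a : ℝ → ℝ} (ha : Continuous a) (g : G0) :
    MemLp (fun t : I => a (g t)) 2 volume := by
  obtain ⟨C, -, hC⟩ := exists_bound_Icc ha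
  exact memLp_of_bounded (g.aestronglyMeasurable_comp ha) (g.abs_comp_le hC)

/-- The class of `a ∘ g` in `L²([0,1])`. -/
def G0.compH (a : ℝ → ℝ) (g : G0) : H := toH (fun t : I => a (g t))

theorem G0.compH_ae {a : ℝ → ℝ} (ha : Continuous a) (g : G0) :
    g.compH a =ᵐ[volume] fun t : I => a (g t) := toH_ae (g.memLp_comp ha)

/-- A sequence converging in `𝒢₀` has subsequences converging almost everywhere, and `a` is bounded
on `[0,1]`, so bounded convergence applies along a further subsequence of every subsequence. -/
theorem G0.continuous_compH {a : ℝ → ℝ} (ha : Continuous a) : Continuous (G0.compH a) := by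
  obtain ⟨C, -, hC⟩ := exists_bound_Icc ha
  rw [continuous_iff_seqContinuous]
  intro F g hF
  refine tendsto_of_subseq_tendsto fun ns hns => ?_
  obtain ⟨ms, hms, h⟩ := G0.exists_subseq_ae (hF.comp hns)
  refine ⟨ms, ?_⟩
  exact tendsto_toH (fun i => (F (ns (ms i))).aestronglyMeasurable_comp ha)
    (g.aestronglyMeasurable_comp ha) (fun i => (F (ns (ms i))).abs_comp_le hC) (g.abs_comp_le hC)
    (h.mono fun t ht => (ha.tendsto _).comp ht)

theorem inner_H (v w : H) : inner ℝ v w = ∫ t : I, v t * w t := by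
  rw [L2.inner_def]
  refine integral_congr_ae (Eventually.of_forall fun t => ?_)
  simp [mul_comm]

theorem integral_mul_eq_inner (f : H) (g : G0) : ∫ t : I, f t * (g t : ℝ) = inner ℝ f g.toL2 := by
  rw [inner_H]
  refine integral_congr_ae ?_
  filter_upwards [g.toL2_ae] with t ht
  rw [ht]

/-! ### Segments in `𝒢₀` and uniqueness of gradients -/

/-- The convex combination `(1 - c) h + c g`. -/
def G0.lerp (h g : G0) (c : I) : G0 where
  toFun t := ⟨(1 - (c : ℝ)) * h t + c * g t,
    add_nonneg (mul_nonneg (sub_nonneg.2 c.2.2) (h t).2.1) (mul_nonneg c.2.1 (g t).2.1), by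
      nlinarith [mul_le_mul_of_nonneg_left (h t).2.2 (sub_nonneg.2 c.2.2),
        mul_le_mul_of_nonneg_left (g t).2.2 c.2.1]⟩
  mono s t hst := by
    have h1 : (h s : ℝ) ≤ h t := h.mono hst
    have h2 : (g s : ℝ) ≤ g t := g.mono hst
    exact Subtype.mk_le_mk.2 (add_le_add (mul_le_mul_of_nonneg_left h1 (sub_nonneg.2 c.2.2))
      (mul_le_mul_of_nonneg_left h2 c.2.1))
  right_cont t ht := by
    rw [Topology.IsInducing.subtypeVal.continuousWithinAt_iff]
    exact ((continuous_subtype_val.continuousAt.comp_continuousWithinAt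
      (h.right_cont t ht)).const_mul _).add
      ((continuous_subtype_val.continuousAt.comp_continuousWithinAt (g.right_cont t ht)).const_mul _)
  map_one := Subtype.ext (by simp [h.map_one, g.map_one])

theorem G0.lerp_apply (h g : G0) (c t : I) :
    (h.lerp g c t : ℝ) = (1 - (c : ℝ)) * h t + c * g t := rfl

theorem G0.toL2_lerp (h g : G0) (c : I) :
    (h.lerp g c).toL2 = h.toL2 + (c : ℝ) • (g.toL2 - h.toL2) := by
  refine Lp.ext ?_
  filter_upwards [(h.lerp g c).toL2_ae, h.toL2_ae, g.toL2_ae,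
    Lp.coeFn_add h.toL2 ((c : ℝ) • (g.toL2 - h.toL2)), Lp.coeFn_smul (c : ℝ) (g.toL2 - h.toL2),
    Lp.coeFn_sub g.toL2 h.toL2] with t h1 h2 h3 h4 h5 h6
  rw [h1, h4, Pi.add_apply, h5, Pi.smul_apply, h6, Pi.sub_apply, h2, h3, G0.lerp_apply, smul_eq_mul]
  ring

theorem G0.lerp_zero (h g : G0) : h.lerp g 0 = h :=
  G0.toL2_injective (by simp [G0.toL2_lerp])

theorem G0.lerp_one (h g : G0) : h.lerp g 1 = g :=
  G0.toL2_injective (by simp [G0.toL2_lerp])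

theorem G0.continuous_lerp (h g : G0) : Continuous (h.lerp g) := by
  rw [G0.isometry_toL2.isEmbedding.continuous_iff]
  simp only [Function.comp_def, G0.toL2_lerp]
  fun_prop

/-- The function which is `0` on `[0, s[` and `1` on `[s, 1]`. -/
def G0.jump (s : I) : G0 where
  toFun t := if s ≤ t then 1 else 0
  mono a b hab := by
    dsimp only
    split_ifs with h1 h2
    · exact le_rfl
    · exact absurd (h1.trans hab) h2
    · exact zero_le_one
    · exact le_rfl
  right_cont t ht := by
    by_cases h : s ≤ t
    · refine (continuousWithinAt_const (b := (1 : I))).congr (fun y hy => ?_) ?_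
      · simp [h.trans (mem_Ici.1 hy)]
      · simp [h]
    · refine (continuousWithinAt_const (b := (0 : I))).congr_of_eventuallyEq ?_ (by simp [h])
      filter_upwards [mem_nhdsWithin_of_mem_nhds (Iio_mem_nhds (not_le.1 h))] with y hy
      simp [not_le.2 (mem_Iio.1 hy)]
  map_one := by simp [show s ≤ 1 from s.2.2]

theorem integrable_H (w : H) : Integrable w volume :=
  (Lp.memLp w).integrable (by norm_num)

/-- The positive and the negative part of `w` are densities of two finite measures which agree on
all intervals `[s,1]`, hence on all Borel sets. -/
theorem ae_eq_zero_of_setIntegral_Ici {w : I → ℝ} (hint : Integrable w)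
    (h : ∀ s : I, ∫ t in Ici s, w t = 0) : w =ᵐ[volume] 0 := by
  have key : (volume : Measure I).withDensity (fun t => ENNReal.ofReal (w t)) =
      (volume : Measure I).withDensity (fun t => ENNReal.ofReal (-w t)) := by
    have : IsFiniteMeasure ((volume : Measure I).withDensity (fun t => ENNReal.ofReal (w t))) :=
      isFiniteMeasure_withDensity_ofReal hint.2
    have : IsFiniteMeasure ((volume : Measure I).withDensity (fun t => ENNReal.ofReal (-w t))) :=
      isFiniteMeasure_withDensity_ofReal hint.neg.2
    refine Measure.ext_of_Ici _ _ fun s => ?_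
    rw [withDensity_apply _ measurableSet_Ici, withDensity_apply _ measurableSet_Ici]
    have h1 := integral_eq_lintegral_pos_part_sub_lintegral_neg_part (hint.integrableOn (s := Ici s))
    rw [h s, eq_comm, sub_eq_zero] at h1
    exact (ENNReal.toReal_eq_toReal_iff' (hint.integrableOn (s := Ici s)).lintegral_lt_top.ne
      (hint.neg.integrableOn (s := Ici s)).lintegral_lt_top.ne).1 h1
  have key := (withDensity_eq_iff hint.aemeasurable.ennreal_ofReal
    hint.neg.aemeasurable.ennreal_ofReal hint.lintegral_lt_top.ne).1 key
  filter_upwards [key] with t ht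
  rw [Pi.zero_apply]
  simp only [Pi.neg_apply] at ht
  rcases le_total (w t) 0 with h1 | h1
  · rw [ENNReal.ofReal_of_nonpos h1, eq_comm, ENNReal.ofReal_eq_zero] at ht
    linarith
  · rw [ENNReal.ofReal_of_nonpos (by linarith : -w t ≤ 0), ENNReal.ofReal_eq_zero] at ht
    linarith

theorem H_eq_zero_of_setIntegral_Ici {w : H} (h : ∀ s : I, ∫ t in Ici s, w t = 0) : w = 0 :=
  Lp.ext ((ae_eq_zero_of_setIntegral_Ici (integrable_H w) h).trans
    (Lp.coeFn_zero ℝ 2 (volume : Measure I)).symm)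

/-- Differences of elements of `𝒢₀` are total in `L²`: `G0.jump s` and `G0.jump 1` differ almost
everywhere by the indicator function of `[s,1]`. -/
theorem H_eq_zero_of_inner_G0 {w : H} (h : ∀ g₁ g₂ : G0, inner ℝ w (g₁.toL2 - g₂.toL2) = 0) :
    w = 0 := by
  refine H_eq_zero_of_setIntegral_Ici fun s => ?_
  have h1 := h (G0.jump s) (G0.jump 1)
  rw [inner_sub_right, ← integral_mul_eq_inner, ← integral_mul_eq_inner] at h1
  have h2 : ∫ t : I, w t * (G0.jump 1 t : ℝ) = 0 := by
    rw [integral_eq_zero_of_ae]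
    have : ∀ᵐ t : I, t ≠ 1 := by simp [ae_iff]
    filter_upwards [this] with t ht
    have : ¬ (1 : I) ≤ t := fun h => ht (le_antisymm t.2.2 h)
    simp [G0.jump, this]
  rw [h2, sub_zero] at h1
  rw [← h1, ← integral_indicator measurableSet_Ici]
  refine integral_congr_ae (Eventually.of_forall fun t => ?_)
  by_cases hst : s ≤ t <;> simp [G0.jump, hst]

theorem HasGradAt.inner_tendsto {u : G0 → ℝ} {v : H} {g : G0} (hu : HasGradAt u v g) (h : G0) :
    Tendsto (fun t : ℝ => (u (g.lerp h (projIcc 0 1 zero_le_one t)) - u g) / t) (𝓝[>] 0)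
      (𝓝 (inner ℝ v (h.toL2 - g.toL2))) := by
  refine hu _ _ ?_
  filter_upwards [Ioo_mem_nhdsGT (zero_lt_one (α := ℝ))] with t ht
  rw [G0.toL2_lerp, projIcc_of_mem _ ⟨ht.1.le, ht.2.le⟩]

/-- By convexity of `𝒢₀` each `h - g` with `h` in `𝒢₀` is an admissible direction at `g`.
Differences of two such directions are already total in `L²`. -/
theorem HasGradAt.unique {u : G0 → ℝ} {v w : H} {g : G0} (hv : HasGradAt u v g)
    (hw : HasGradAt u w g) : v = w := by
  have key : ∀ h : G0, inner ℝ (v - w) (h.toL2 - g.toL2) = 0 := fun h => by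
    rw [inner_sub_left, tendsto_nhds_unique (hv.inner_tendsto h) (hw.inner_tendsto h), sub_self]
  refine sub_eq_zero.1 (H_eq_zero_of_inner_G0 fun g₁ g₂ => ?_)
  have := congrArg₂ (· - ·) (key g₁) (key g₂)
  simpa [← inner_sub_right] using this

theorem HasGradAt.grad_eq {u : G0 → ℝ} {v : H} {g : G0} (hv : HasGradAt u v g) : grad u g = v := by
  have h : ∃ v, HasGradAt u v g := ⟨v, hv⟩
  rw [grad, dif_pos h]
  exact h.choose_spec.unique hv

/-! ### The chain rule -/

theorem HasGradAt.comp {ι : Type*} [Fintype ι] [DecidableEq ι] {U : (ι → ℝ) → ℝ}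
    {U' : (ι → ℝ) →L[ℝ] ℝ} {u : ι → G0 → ℝ} {v : ι → H} {g : G0} (hu : ∀ i, HasGradAt (u i) (v i) g)
    (hU : HasFDerivAt U U' (fun i => u i g)) :
    HasGradAt (fun g => U (fun i => u i g)) (∑ i, U' (Pi.single i 1) • v i) g := by
  intro f γ hγ
  have h1 : Tendsto (fun t : ℝ => t⁻¹ • ((fun i => u i (γ t)) - fun i => u i g)) (𝓝[>] 0)
      (𝓝 (fun i => inner ℝ (v i) f)) := by
    rw [tendsto_pi_nhds]
    intro i
    refine (hu i f γ hγ).congr fun t => ?_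
    simp [div_eq_inv_mul]
  have h0 : Tendsto (fun t : ℝ => (fun i => u i (γ t)) - fun i => u i g) (𝓝[>] 0) (𝓝 0) := by
    have h2 : Tendsto (fun t : ℝ => t) (𝓝[>] 0) (𝓝 0) :=
      tendsto_id.mono_left nhdsWithin_le_nhds
    have h3 := h2.smul h1
    rw [zero_smul] at h3
    refine h3.congr' ?_
    filter_upwards [self_mem_nhdsWithin] with t ht
    rw [smul_smul, mul_inv_cancel₀ (ne_of_gt ht), one_smul]
  have h4 := hU.hasFDerivWithinAt (s := univ) |>.lim h0 (Eventually.of_forall fun _ => mem_univ _) h1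
  have h5 : U' (fun i => inner ℝ (v i) f) = inner ℝ (∑ i, U' (Pi.single i 1) • v i) f := by
    rw [sum_inner]
    refine (U'.toLinearMap.pi_apply_eq_sum_univ (fun i => inner ℝ (v i) f)).trans ?_
    refine Finset.sum_congr rfl fun i _ => ?_
    rw [real_inner_smul_left, smul_eq_mul, mul_comm]
    congr 1
    refine congrArg U' (funext fun j => ?_)
    simp [Pi.single_apply, eq_comm]
  rw [← h5]
  refine h4.congr fun t => ?_
  simp [div_eq_inv_mul]

/-- `u` has the gradient `V` everywhere; both are bounded and continuous. -/
structure Reg (u : G0 → ℝ) (V : G0 → H) : Prop where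
  hasGradAt : ∀ g, HasGradAt u (V g) g
  cont : Continuous u
  cont_grad : Continuous V
  bdd : ∃ C, 0 ≤ C ∧ ∀ g, ‖u g‖ ≤ C ∧ ‖V g‖ ≤ C

theorem Reg.grad_eq {u : G0 → ℝ} {V : G0 → H} (h : Reg u V) : grad u = V :=
  funext fun g => (h.hasGradAt g).grad_eq

/-- The gradient of `U ∘ (u₁, …, u_m)`. -/
def chainGrad {ι : Type*} [Fintype ι] [DecidableEq ι] (U : (ι → ℝ) → ℝ) (y : ι → ℝ) (v : ι → H) :
    H := ∑ i, fderiv ℝ U y (Pi.single i 1) • v i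

theorem continuous_chainGrad {ι : Type*} [Fintype ι] [DecidableEq ι] {U : (ι → ℝ) → ℝ}
    (hU : ContDiff ℝ 1 U) : Continuous fun p : (ι → ℝ) × (ι → H) => chainGrad U p.1 p.2 := by
  have := hU.continuous_fderiv one_ne_zero
  unfold chainGrad
  fun_prop

theorem exists_chain_bound {ι : Type*} [Fintype ι] [DecidableEq ι] {U : (ι → ℝ) → ℝ}
    (hU : ContDiff ℝ 1 U) (C : ℝ) : ∃ K, 0 ≤ K ∧ ∀ (y : ι → ℝ) (v : ι → H), (∀ i, ‖y i‖ ≤ C) →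
      (∀ i, ‖v i‖ ≤ C) → ‖U y‖ ≤ K ∧ ‖chainGrad U y v‖ ≤ K := by
  have hc : IsCompact (Icc (fun _ : ι => -C) (fun _ => C)) := isCompact_Icc
  obtain ⟨K₁, hK₁⟩ := hc.exists_bound_of_continuousOn hU.continuous.continuousOn
  obtain ⟨K₂, hK₂⟩ := hc.exists_bound_of_continuousOn
    (hU.continuous_fderiv one_ne_zero).continuousOn
  refine ⟨|K₁| + ∑ _i : ι, |K₂| * |C|, by positivity, fun y v hy hv => ?_⟩
  have hmem : y ∈ Icc (fun _ : ι => -C) (fun _ => C) :=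
    ⟨fun i => (abs_le.1 (hy i)).1, fun i => (abs_le.1 (hy i)).2⟩
  constructor
  · have h1 := (hK₁ y hmem).trans (le_abs_self _)
    have : 0 ≤ ∑ _i : ι, |K₂| * |C| := by positivity
    linarith
  · have h2 : ‖chainGrad U y v‖ ≤ ∑ _i : ι, |K₂| * |C| := by
      refine norm_sum_le_of_le _ fun i _ => ?_
      rw [norm_smul]
      refine mul_le_mul ?_ ((hv i).trans (le_abs_self _)) (norm_nonneg _) (abs_nonneg _)
      refine ((fderiv ℝ U y).le_opNorm _).trans ?_
      have : ‖(Pi.single i 1 : ι → ℝ)‖ = 1 := by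
        rw [Pi.norm_single]; simp
      rw [this, mul_one]
      exact (hK₂ y hmem).trans (le_abs_self _)
    have := abs_nonneg K₁
    linarith

theorem exists_common_bound {ι : Type*} [Finite ι] {p : ι → ℝ → Prop}
    (hp : ∀ i C D, C ≤ D → p i C → p i D) (h : ∀ i, ∃ C, p i C) : ∃ C, 0 ≤ C ∧ ∀ i, p i C := by
  choose C hC using h
  obtain ⟨D, hD⟩ := (Set.finite_range C).bddAbove
  exact ⟨max D 0, le_max_right _ _,
    fun i => hp i _ _ ((hD ⟨i, rfl⟩).trans (le_max_left _ _)) (hC i)⟩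

theorem Reg.comp {ι : Type*} [Fintype ι] [DecidableEq ι] {U : (ι → ℝ) → ℝ} (hU : ContDiff ℝ 1 U)
    {u : ι → G0 → ℝ} {V : ι → G0 → H} (h : ∀ i, Reg (u i) (V i)) :
    Reg (fun g => U (fun i => u i g)) (fun g => chainGrad U (fun i => u i g) (fun i => V i g)) where
  hasGradAt g := HasGradAt.comp (fun i => (h i).hasGradAt g)
    ((hU.differentiable one_ne_zero) _).hasFDerivAt
  cont := hU.continuous.comp (continuous_pi fun i => (h i).cont)
  cont_grad := (continuous_chainGrad hU).comp
    ((continuous_pi fun i => (h i).cont).prodMk (continuous_pi fun i => (h i).cont_grad))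
  bdd := by
    obtain ⟨C, -, hC⟩ := exists_common_bound (p := fun i C => ∀ g, ‖u i g‖ ≤ C ∧ ‖V i g‖ ≤ C)
      (fun i C D hCD h g => ⟨(h g).1.trans hCD, (h g).2.trans hCD⟩)
      (fun i => (h i).bdd.imp fun C hC => hC.2)
    obtain ⟨K, hK0, hK⟩ := exists_chain_bound hU C
    exact ⟨K, hK0, fun g => hK _ _ (fun i => (hC i g).1) (fun i => (hC i g).2)⟩

theorem Reg.congr {u u' : G0 → ℝ} {V V' : G0 → H} (h : Reg u V) (hu : u = u') (hV : V = V') :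
    Reg u' V' := by rwa [← hu, ← hV]

theorem chainGrad_unit {U : ℝ → ℝ} (hU : ContDiff ℝ 1 U) (y : Unit → ℝ) (v : Unit → H) :
    chainGrad (fun y => U (y ())) y v = deriv U (y ()) • v () := by
  have h : HasFDerivAt (fun y : Unit → ℝ => U (y ()))
      ((ContinuousLinearMap.toSpanSingleton ℝ (deriv U (y ()))).comp
        (ContinuousLinearMap.proj (R := ℝ) (φ := fun _ : Unit => ℝ) ())) y :=
    (((hU.differentiable one_ne_zero) (y ())).hasDerivAt.hasFDerivAt).comp y (hasFDerivAt_apply () y)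
  simp [chainGrad, h.fderiv]

theorem Reg.comp_one {U : ℝ → ℝ} (hU : ContDiff ℝ 1 U) {u : G0 → ℝ} {V : G0 → H} (h : Reg u V) :
    Reg (fun g => U (u g)) (fun g => deriv U (u g) • V g) := by
  refine (Reg.comp (ι := Unit) (U := fun y => U (y ())) (hU.comp (contDiff_apply ℝ ℝ ()))
    (fun _ => h)).congr rfl ?_
  funext g
  exact chainGrad_unit hU _ _

theorem Reg.add {u v : G0 → ℝ} {V W : G0 → H} (hu : Reg u V) (hv : Reg v W) :
    Reg (u + v) (V + W) where
  hasGradAt g f γ hγ := by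
    have := (hu.hasGradAt g f γ hγ).add (hv.hasGradAt g f γ hγ)
    rw [Pi.add_apply V W, inner_add_left]
    refine this.congr fun t => ?_
    simp only [Pi.add_apply]; ring
  cont := hu.cont.add hv.cont
  cont_grad := hu.cont_grad.add hv.cont_grad
  bdd := by
    obtain ⟨C, h0, hC⟩ := hu.bdd
    obtain ⟨D, h1, hD⟩ := hv.bdd
    exact ⟨C + D, by positivity, fun g => ⟨norm_add_le_of_le (hC g).1 (hD g).1,
      norm_add_le_of_le (hC g).2 (hD g).2⟩⟩

theorem Reg.smul {u : G0 → ℝ} {V : G0 → H} (hu : Reg u V) (c : ℝ) : Reg (c • u) (c • V) where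
  hasGradAt g f γ hγ := by
    have := (hu.hasGradAt g f γ hγ).const_mul c
    rw [Pi.smul_apply c V, real_inner_smul_left]
    refine this.congr fun t => ?_
    simp only [Pi.smul_apply, smul_eq_mul]; ring
  cont := hu.cont.const_smul c
  cont_grad := hu.cont_grad.const_smul c
  bdd := by
    obtain ⟨C, h0, hC⟩ := hu.bdd
    refine ⟨‖c‖ * C, by positivity, fun g => ?_⟩
    simp only [Pi.smul_apply, norm_smul]
    exact ⟨mul_le_mul_of_nonneg_left (hC g).1 (norm_nonneg _),
      mul_le_mul_of_nonneg_left (hC g).2 (norm_nonneg _)⟩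

theorem Reg.sub {u v : G0 → ℝ} {V W : G0 → H} (hu : Reg u V) (hv : Reg v W) :
    Reg (u - v) (V - W) :=
  (hu.add (hv.smul (-1))).congr (by ext; simp [sub_eq_add_neg]) (by ext1; simp [sub_eq_add_neg])

theorem Reg.mul {u v : G0 → ℝ} {V W : G0 → H} (hu : Reg u V) (hv : Reg v W) :
    Reg (u * v) (u • W + v • V) where
  hasGradAt g f γ hγ := by
    have h1 := hu.hasGradAt g f γ hγ
    have h2 := hv.hasGradAt g f γ hγ
    have h3 : Tendsto (fun t => u (γ t)) (𝓝[>] 0) (𝓝 (u g)) := by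
      have h4 : Tendsto (fun t : ℝ => t) (𝓝[>] 0) (𝓝 0) := tendsto_id.mono_left nhdsWithin_le_nhds
      have h5 := (h4.mul h1).add_const (u g)
      rw [zero_mul, zero_add] at h5
      refine h5.congr' ?_
      filter_upwards [self_mem_nhdsWithin] with t ht
      rw [mul_div_cancel₀ _ (ne_of_gt ht)]; ring
    have h6 := (h3.mul h2).add (h1.const_mul (v g))
    rw [Pi.add_apply, Pi.smul_apply', Pi.smul_apply', inner_add_left, real_inner_smul_left,
      real_inner_smul_left]
    refine h6.congr fun t => ?_
    simp only [Pi.mul_apply]; ring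
  cont := hu.cont.mul hv.cont
  cont_grad := (hu.cont.smul hv.cont_grad).add (hv.cont.smul hu.cont_grad)
  bdd := by
    obtain ⟨C, h0, hC⟩ := hu.bdd
    obtain ⟨D, h1, hD⟩ := hv.bdd
    refine ⟨C * D + D * C, by positivity, fun g => ⟨?_, ?_⟩⟩
    · rw [Pi.mul_apply, norm_mul]
      have := mul_le_mul (hC g).1 (hD g).1 (norm_nonneg _) h0
      nlinarith [mul_nonneg h1 h0]
    · refine norm_add_le_of_le ?_ ?_
      · rw [Pi.smul_apply', norm_smul]
        exact mul_le_mul (hC g).1 (hD g).2 (norm_nonneg _) h0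
      · rw [Pi.smul_apply', norm_smul]
        exact mul_le_mul (hD g).1 (hC g).2 (norm_nonneg _) h1

/-- `HasGradAt` controls only right derivatives along a segment, but for a continuous function with
continuous right derivative the fundamental theorem still holds. The formula turns convergence of
gradients into convergence of functions. -/
theorem Reg.integral_lerp {u : G0 → ℝ} {V : G0 → H} (hu : Reg u V) (h g : G0) :
    u g - u h = ∫ s in (0 : ℝ)..1,
      inner ℝ (V (h.lerp g (projIcc 0 1 zero_le_one s))) (g.toL2 - h.toL2) := by
  have hcl : Continuous fun s : ℝ => h.lerp g (projIcc 0 1 zero_le_one s) :=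
    (h.continuous_lerp g).comp continuous_projIcc
  have hcV : Continuous fun s : ℝ => V (h.lerp g (projIcc 0 1 zero_le_one s)) :=
    hu.cont_grad.comp hcl
  rw [intervalIntegral.integral_eq_sub_of_hasDeriv_right_of_le
    (f := fun s => u (h.lerp g (projIcc 0 1 zero_le_one s))) zero_le_one
    (hu.cont.comp hcl).continuousOn (fun s hs => ?_)
    ((hcV.inner (𝕜 := ℝ) (g := fun _ => g.toL2 - h.toL2)
      continuous_const).intervalIntegrable 0 1)]
  · simp [G0.lerp_one, G0.lerp_zero]
  · rw [hasDerivWithinAt_iff_tendsto_slope' (by simp)]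
    have h1 := hu.hasGradAt (h.lerp g (projIcc 0 1 zero_le_one s)) (g.toL2 - h.toL2)
      (fun t => h.lerp g (projIcc 0 1 zero_le_one (s + t))) (by
        filter_upwards [Ioo_mem_nhdsGT (sub_pos.2 hs.2)] with t ht
        have h1 : s ∈ Icc (0 : ℝ) 1 := ⟨hs.1.le, hs.2.le⟩
        have h2 : s + t ∈ Icc (0 : ℝ) 1 := ⟨by linarith [ht.1, hs.1], by linarith [ht.2]⟩
        rw [G0.toL2_lerp, G0.toL2_lerp, projIcc_of_mem _ h1, projIcc_of_mem _ h2, add_assoc,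
          ← add_smul])
    have h2 : Tendsto (fun y => y - s) (𝓝[>] s) (𝓝[>] 0) := by
      refine tendsto_nhdsWithin_iff.2 ⟨?_, ?_⟩
      · have : Tendsto (fun y => y - s) (𝓝 s) (𝓝 (s - s)) := tendsto_id.sub_const s
        rw [sub_self] at this
        exact this.mono_left nhdsWithin_le_nhds
      · filter_upwards [self_mem_nhdsWithin] with y hy
        exact sub_pos.2 (mem_Ioi.1 hy)
    refine (h1.comp h2).congr fun y => ?_
    simp [slope_def_field]

theorem Reg.abs_sub_le {u : G0 → ℝ} {V : G0 → H} (hu : Reg u V) {C : ℝ} (hC : ∀ g, ‖V g‖ ≤ C)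
    (h g : G0) : ‖u g - u h‖ ≤ C * ‖g.toL2 - h.toL2‖ := by
  rw [hu.integral_lerp h g]
  refine (intervalIntegral.norm_integral_le_of_norm_le_const
    (C := C * ‖g.toL2 - h.toL2‖) fun s _ => ?_).trans (by simp)
  exact (norm_inner_le_norm _ _).trans (mul_le_mul_of_nonneg_right (hC _) (norm_nonneg _))

/-! ### The basic functionals -/

/-- The functional `g ↦ ∫ f g dt`. -/
def linFun (f : H) (g : G0) : ℝ := ∫ t : I, f t * (g t : ℝ)

theorem linFun_eq (f : H) (g : G0) : linFun f g = inner ℝ f g.toL2 := integral_mul_eq_inner f g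

theorem norm_linFun_le (f : H) (g : G0) : ‖linFun f g‖ ≤ ‖f‖ := by
  rw [linFun_eq]
  refine (norm_inner_le_norm _ _).trans ?_
  exact mul_le_of_le_one_right (norm_nonneg _) g.norm_toL2_le

theorem reg_linFun (f : H) : Reg (linFun f) (fun _ => f) where
  hasGradAt g f' γ hγ := by
    refine tendsto_const_nhds.congr' ?_
    filter_upwards [hγ, self_mem_nhdsWithin] with t ht ht0
    rw [linFun_eq, linFun_eq, ← inner_sub_right, ht, add_sub_cancel_left, real_inner_smul_right,
      mul_div_cancel_left₀ _ (ne_of_gt ht0)]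
  cont := by
    simp only [funext (linFun_eq f)]
    exact continuous_const.inner G0.continuous_toL2
  cont_grad := continuous_const
  bdd := ⟨‖f‖, norm_nonneg _, fun g => ⟨norm_linFun_le f g, le_rfl⟩⟩

/-- The functional `g ↦ ∫ α(g_s) ds`. -/
def potFun (α : ℝ → ℝ) (g : G0) : ℝ := ∫ t : I, α (g t)

/-- The difference quotients are taken at `g + t f` pointwise, for every `t > 0`, even where this
leaves `[0,1]`. A bound for `α'` on the whole line dominates them by `C |f|`;
`exists_contDiff_extension` supplies such a representative of `α`. -/
theorem reg_potFun {α : ℝ → ℝ} (hα : ContDiff ℝ 1 α) {C : ℝ} (hC : ∀ x, ‖deriv α x‖ ≤ C) :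
    Reg (potFun α) (G0.compH (deriv α)) where
  hasGradAt g f γ hγ := by
    have hd : Continuous (deriv α) := hα.continuous_deriv_one
    rw [inner_H]
    have key : Tendsto (fun t : ℝ => ∫ r : I, (α (g r + t * f r) - α (g r)) / t) (𝓝[>] 0)
        (𝓝 (∫ r : I, deriv α (g r) * f r)) := by
      have hfm : AEStronglyMeasurable f (volume : Measure I) := (integrable_H f).1
      refine tendsto_integral_filter_of_dominated_convergence (fun r => C * ‖f r‖) ?_ ?_
        ((integrable_H f).norm.const_mul C) ?_
      · refine Eventually.of_forall fun t => ?_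
        have h1 : AEStronglyMeasurable (fun r : I => α (g r + t * f r)) volume :=
          hα.continuous.comp_aestronglyMeasurable
            (g.measurable_coe.aestronglyMeasurable.add (hfm.const_mul t))
        simp only [div_eq_mul_inv]
        exact (h1.sub (g.aestronglyMeasurable_comp hα.continuous)).mul_const _
      · filter_upwards [self_mem_nhdsWithin] with t ht
        refine Eventually.of_forall fun r => ?_
        have h1 : ‖α (g r + t * f r) - α (g r)‖ ≤ C * ‖(g r + t * f r) - g r‖ :=
          (convex_univ (𝕜 := ℝ) (E := ℝ)).norm_image_sub_le_of_norm_deriv_le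
            (fun x _ => (hα.differentiable one_ne_zero) x) (fun x _ => hC x) (mem_univ _) (mem_univ _)
        have ht' : 0 < ‖t‖ := norm_pos_iff.2 (ne_of_gt ht)
        rw [add_sub_cancel_left, norm_mul] at h1
        rw [norm_div, div_le_iff₀ ht']
        linarith
      · refine Eventually.of_forall fun r => ?_
        have h1 : HasDerivAt (fun t : ℝ => α (g r + t * f r)) (deriv α (g r) * f r) 0 := by
          have h2 : HasDerivAt α (deriv α (g r)) ((g r : ℝ) + 0 * f r) := by
            rw [zero_mul, add_zero]
            exact ((hα.differentiable one_ne_zero) _).hasDerivAt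
          have h3 : HasDerivAt (fun t : ℝ => (g r : ℝ) + t * f r) (f r) 0 := by
            simpa using ((hasDerivAt_id (0 : ℝ)).mul_const (f r)).const_add (g r : ℝ)
          exact h2.comp 0 h3
        have h4 := h1.hasDerivWithinAt (s := Ioi 0)
        rw [hasDerivWithinAt_iff_tendsto_slope' (by simp)] at h4
        refine h4.congr fun t => ?_
        simp [slope_def_field]
    have h5 : ∫ r : I, g.compH (deriv α) r * f r = ∫ r : I, deriv α (g r) * f r := by
      refine integral_congr_ae ?_
      filter_upwards [g.compH_ae hd] with r hr
      rw [hr]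
    rw [h5]
    refine key.congr' ?_
    filter_upwards [hγ] with t ht
    have h6 : ∀ g' : G0, Integrable (fun r : I => α (g' r)) volume := fun g' =>
      (g'.memLp_comp hα.continuous).integrable (by norm_num)
    rw [potFun, potFun, ← integral_sub (h6 _) (h6 _), ← integral_div]
    refine integral_congr_ae ?_
    filter_upwards [(γ t).toL2_ae, g.toL2_ae, Lp.coeFn_add g.toL2 (t • f), Lp.coeFn_smul t f]
      with r h1 h2 h3 h4
    rw [← h1, ht, h3, Pi.add_apply, h2, h4, Pi.smul_apply, smul_eq_mul]
  cont := by
    have h1 : ∀ g, potFun α g = inner ℝ (G0.compH (fun _ => 1) g) (G0.compH α g) := fun g => by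
      rw [inner_H]
      refine integral_congr_ae ?_
      filter_upwards [g.compH_ae continuous_const (a := fun _ => 1), g.compH_ae hα.continuous]
        with t h1 h2
      rw [h1, h2, one_mul]
    simp only [funext h1]
    exact (G0.continuous_compH continuous_const).inner (G0.continuous_compH hα.continuous)
  cont_grad := G0.continuous_compH hα.continuous_deriv_one
  bdd := by
    obtain ⟨D, hD0, hD⟩ := exists_bound_Icc hα.continuous
    have hC0 : 0 ≤ C := (norm_nonneg _).trans (hC 0)
    refine ⟨D + C, by positivity, fun g => ⟨?_, ?_⟩⟩
    · refine (norm_integral_le_of_norm_le_const (Eventually.of_forall (g.abs_comp_le hD))).trans ?_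
      simpa using hC0
    · exact (norm_toH_le hC0 fun t => hC _).trans (by linarith)

/-- The derivative is extended by its constant boundary values and then integrated, so that the
extension keeps a bounded derivative on the line. -/
theorem exists_contDiff_extension {α : ℝ → ℝ} (hα : ContDiffOn ℝ 1 α (Icc 0 1)) :
    ∃ a : ℝ → ℝ, ContDiff ℝ 1 a ∧ (∀ x ∈ Icc (0 : ℝ) 1, a x = α x) ∧
      (∀ x ∈ Icc (0 : ℝ) 1, deriv a x = derivWithin α (Icc 0 1) x) ∧ ∃ C, ∀ x, ‖deriv a x‖ ≤ C := by
  have hu : UniqueDiffOn ℝ (Icc (0 : ℝ) 1) := uniqueDiffOn_Icc_zero_one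
  have hc : ContinuousOn (derivWithin α (Icc 0 1)) (Icc 0 1) := hα.continuousOn_derivWithin hu le_rfl
  set b : ℝ → ℝ := IccExtend zero_le_one ((Icc (0 : ℝ) 1).domRestrict (derivWithin α (Icc 0 1))) with hb
  have hbc : Continuous b := (continuousOn_iff_continuous_domRestrict.1 hc).Icc_extend'
  have hbe : ∀ x ∈ Icc (0 : ℝ) 1, b x = derivWithin α (Icc 0 1) x := fun x hx => by
    rw [hb, IccExtend_of_mem _ _ hx]; rfl
  have hd : ∀ x, HasDerivAt (fun x => α 0 + ∫ y in (0 : ℝ)..x, b y) (b x) x := fun x =>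
    (intervalIntegral.integral_hasDerivAt_right (hbc.intervalIntegrable _ _)
      (hbc.stronglyMeasurableAtFilter _ _) hbc.continuousAt).const_add _
  have hd' : deriv (fun x => α 0 + ∫ y in (0 : ℝ)..x, b y) = b := funext fun x => (hd x).deriv
  refine ⟨fun x => α 0 + ∫ y in (0 : ℝ)..x, b y, ?_, ?_, ?_, ?_⟩
  · rw [contDiff_one_iff_deriv, hd']
    exact ⟨fun x => (hd x).differentiableAt, hbc⟩
  · intro x hx
    have h1 : ∫ y in (0 : ℝ)..x, b y = α x - α 0 := by
      refine intervalIntegral.integral_eq_sub_of_hasDeriv_right_of_le hx.1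
        (hα.continuousOn.mono (Icc_subset_Icc_right hx.2)) (fun y hy => ?_)
        (hbc.intervalIntegrable _ _)
      have hy' : y ∈ Ioo (0 : ℝ) 1 := ⟨hy.1, hy.2.trans_le hx.2⟩
      rw [hbe y ⟨hy'.1.le, hy'.2.le⟩]
      exact (((hα.differentiableOn one_ne_zero) y ⟨hy'.1.le, hy'.2.le⟩).hasDerivWithinAt.hasDerivAt
        (Icc_mem_nhds hy'.1 hy'.2)).hasDerivWithinAt
    simp [h1]
  · intro x hx
    rw [hd', hbe x hx]
  · rw [hd']
    obtain ⟨C, -, hC⟩ := exists_bound_Icc hbc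
    refine ⟨C, fun x => ?_⟩
    have h1 : b x = b (projIcc 0 1 zero_le_one x) := by
      rw [hb, IccExtend_apply, IccExtend_of_mem _ _ (projIcc 0 1 zero_le_one x).2]
      simp [coe_projIcc]
    rw [h1]
    exact hC _ (projIcc 0 1 zero_le_one x).2

theorem reg_cylFun {m : ℕ} {U : (Fin m → ℝ) → ℝ} (hU : ContDiff ℝ 1 U) (f : Fin m → H) :
    Reg (cylFun U f) (fun g => chainGrad U (fun i => linFun (f i) g) f) :=
  Reg.comp hU fun i => reg_linFun (f i)

/-- A function in `ℨ¹(𝒢₀)` has a representation by functions `αᵢ` which are `C¹` on `ℝ`. -/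
theorem exists_reg_zylFun {m : ℕ} {U : (Fin m → ℝ) → ℝ} (hU : ContDiff ℝ 1 U) {α : Fin m → ℝ → ℝ}
    (hα : ∀ i, ContDiffOn ℝ 1 (α i) (Icc 0 1)) : ∃ a : Fin m → ℝ → ℝ,
      (∀ i, ContDiff ℝ 1 (a i)) ∧ (∀ i, ∃ C, ∀ x, ‖deriv (a i) x‖ ≤ C) ∧ zylFun U α = zylFun U a ∧
      (∀ i, ∀ x ∈ Icc (0 : ℝ) 1, a i x = α i x) ∧
      (∀ i, ∀ x ∈ Icc (0 : ℝ) 1, deriv (a i) x = derivWithin (α i) (Icc 0 1) x) ∧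
      Reg (zylFun U a)
        (fun g => chainGrad U (fun i => potFun (a i) g) (fun i => g.compH (deriv (a i)))) := by
  choose a h1 h2 h3 h4 using fun i => exists_contDiff_extension (hα i)
  refine ⟨a, h1, h4, ?_, h2, h3, ?_⟩
  · funext g
    simp only [zylFun]
    congr 1
    funext i
    refine integral_congr_ae (Eventually.of_forall fun t => ?_)
    exact (h2 i _ (g t).2).symm
  · choose C hC using h4
    exact Reg.comp hU fun i => reg_potFun (h1 i) (hC i)

theorem hasGradAt_zylFun {m : ℕ} {U : (Fin m → ℝ) → ℝ} (hU : ContDiff ℝ 1 U) {α : Fin m → ℝ → ℝ}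
    (hα : ∀ i, ContDiffOn ℝ 1 (α i) (Icc 0 1)) (g : G0) :
    HasGradAt (zylFun U α) (grad (zylFun U α) g) g ∧
      grad (zylFun U α) g =ᵐ[volume] fun s : I =>
        ∑ i, fderiv ℝ U (fun j => ∫ r : I, α j (g r)) (Pi.single i 1) *
          derivWithin (α i) (Icc 0 1) (g s) := by
  obtain ⟨a, h1, h2, h3, h4, h5, h6⟩ := exists_reg_zylFun hU hα
  rw [h3, h6.grad_eq]
  refine ⟨h6.hasGradAt g, ?_⟩
  have h7 : (fun j => ∫ r : I, α j (g r)) = fun i => potFun (a i) g := funext fun j =>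
    integral_congr_ae (Eventually.of_forall fun t => (h4 j _ (g t).2).symm)
  rw [h7]
  have h8 := Lp.coeFn_finsetSum Finset.univ (fun i =>
    fderiv ℝ U (fun i => potFun (a i) g) (Pi.single i 1) • g.compH (deriv (a i)))
  have h9 : ∀ᵐ s : I, ∀ i, (fderiv ℝ U (fun i => potFun (a i) g) (Pi.single i 1) •
      g.compH (deriv (a i)) : H) s = fderiv ℝ U (fun i => potFun (a i) g) (Pi.single i 1) *
        derivWithin (α i) (Icc 0 1) (g s) := by
    refine ae_all_iff.2 fun i => ?_
    filter_upwards [Lp.coeFn_smul (fderiv ℝ U (fun i => potFun (a i) g) (Pi.single i 1))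
      (g.compH (deriv (a i))), g.compH_ae (h1 i).continuous_deriv_one] with s hs hs'
    rw [hs, Pi.smul_apply, hs', smul_eq_mul, h5 i _ (g s).2]
  filter_upwards [h8, h9] with s hs hs'
  rw [chainGrad, hs, Finset.sum_apply]
  exact Finset.sum_congr rfl fun i _ => hs' i

theorem hasGradAt_cylFun {m : ℕ} {U : (Fin m → ℝ) → ℝ} (hU : ContDiff ℝ 1 U) (f : Fin m → H)
    (g : G0) : HasGradAt (cylFun U f) (grad (cylFun U f) g) g ∧
      grad (cylFun U f) g =
        ∑ i, fderiv ℝ U (fun j => ∫ r : I, f j r * (g r : ℝ)) (Pi.single i 1) • f i := by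
  rw [(reg_cylFun hU f).grad_eq]
  exact ⟨(reg_cylFun hU f).hasGradAt g, rfl⟩

/-! ### Quasi-invariance of the Dirichlet distribution -/

/-- `τ` is a diffeomorphism of `[0,1]` with derivative `τ'`, where `log τ'` is bounded by `δ` and
Lipschitz continuous with constant `δ`. -/
structure IsWarp (δ : ℝ) (τ τ' : ℝ → ℝ) : Prop where
  hasDerivAt : ∀ x, HasDerivAt τ (τ' x) x
  map_zero : τ 0 = 0
  map_one : τ 1 = 1
  pos : ∀ x ∈ Icc (0 : ℝ) 1, 0 < τ' x
  abs_log_le : ∀ x ∈ Icc (0 : ℝ) 1, |Real.log (τ' x)| ≤ δ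
  abs_log_sub_le : ∀ x ∈ Icc (0 : ℝ) 1, ∀ y ∈ Icc (0 : ℝ) 1,
    |Real.log (τ' x) - Real.log (τ' y)| ≤ δ * |x - y|

namespace IsWarp

variable {δ : ℝ} {τ τ' : ℝ → ℝ}

theorem continuous (h : IsWarp δ τ τ') : Continuous τ :=
  continuous_iff_continuousAt.2 fun x => (h.hasDerivAt x).continuousAt

theorem nonneg (h : IsWarp δ τ τ') : 0 ≤ δ := (abs_nonneg _).trans (h.abs_log_le 0 (by simp))

theorem exists_slope (h : IsWarp δ τ τ') {x y : ℝ} (hxy : x < y) :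
    ∃ ξ ∈ Ioo x y, τ y - τ x = τ' ξ * (y - x) := by
  obtain ⟨ξ, hξ, h1⟩ := exists_hasDerivAt_eq_slope τ τ' hxy h.continuous.continuousOn
    (fun z _ => h.hasDerivAt z)
  exact ⟨ξ, hξ, by rw [h1, div_mul_cancel₀ _ (sub_pos.2 hxy).ne']⟩

theorem strictMonoOn (h : IsWarp δ τ τ') : StrictMonoOn τ (Icc 0 1) := by
  intro x hx y hy hxy
  obtain ⟨ξ, hξ, h1⟩ := h.exists_slope hxy
  have := mul_pos (h.pos ξ ⟨hx.1.trans hξ.1.le, hξ.2.le.trans hy.2⟩) (sub_pos.2 hxy)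
  linarith

theorem mapsTo (h : IsWarp δ τ τ') : MapsTo τ (Icc 0 1) (Icc 0 1) := fun x hx =>
  ⟨h.map_zero ▸ h.strictMonoOn.monotoneOn (by simp) hx hx.1,
    h.map_one ▸ h.strictMonoOn.monotoneOn hx (by simp) hx.2⟩

theorem surjOn (h : IsWarp δ τ τ') : SurjOn τ (Icc 0 1) (Icc 0 1) := by
  have := intermediate_value_Icc (zero_le_one (α := ℝ)) h.continuous.continuousOn
  rwa [h.map_zero, h.map_one] at this

end IsWarp

theorem sum_succ_sub_castSucc {N : ℕ} (X : Fin (N + 1) → ℝ) :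
    ∑ i : Fin N, (X i.succ - X i.castSucc) = X (Fin.last N) - X 0 := by
  have h1 := Fin.sum_univ_succ X
  have h2 := Fin.sum_univ_castSucc X
  rw [Finset.sum_sub_distrib]
  linarith

/-- By the mean value theorem the ratio is `∏ τ'(ξᵢ)^(aᵢ - 1) ∏ τ'(Xᵢ)`, with `N + 1` intermediate
points and `N` inner points. The factors `τ'(ξᵢ)^aᵢ` contribute at most `(∑ aᵢ) δ` to the logarithm.
Each inner point is paired with the intermediate point of the interval on its right; by the
Lipschitz bound these differences add up to at most `δ` times the total length, which is at most
`1`. The unpaired `τ'(ξ₀)` costs one more `δ`. Nothing depends on `N`. -/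
theorem IsWarp.exists_ratio {δ : ℝ} {τ τ' : ℝ → ℝ} (h : IsWarp δ τ τ') {N : ℕ}
    {X : Fin (N + 2) → ℝ} (hX : StrictMono X) (h0 : X 0 = 0) (h1 : X (Fin.last _) = 1)
    {a : Fin (N + 1) → ℝ} (ha : ∀ i, 0 ≤ a i) : ∃ E : ℝ, |E| ≤ (∑ i, a i + 2) * δ ∧
      (∏ i : Fin (N + 1), (τ (X i.succ) - τ (X i.castSucc)) ^ (a i - 1)) *
          ∏ i : Fin N, τ' (X i.succ.castSucc) =
        Real.exp E * ∏ i : Fin (N + 1), (X i.succ - X i.castSucc) ^ (a i - 1) := by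
  have hXI : ∀ i, X i ∈ Icc (0 : ℝ) 1 := fun i =>
    ⟨h0 ▸ hX.monotone (Fin.zero_le i), h1 ▸ hX.monotone (Fin.le_last i)⟩
  choose ξ hξ hs using fun i : Fin (N + 1) => h.exists_slope (hX (Fin.castSucc_lt_succ (i := i)))
  have hξI : ∀ i, ξ i ∈ Icc (0 : ℝ) 1 := fun i =>
    ⟨(hXI _).1.trans (hξ i).1.le, (hξ i).2.le.trans (hXI _).2⟩
  refine ⟨∑ i, (a i - 1) * Real.log (τ' (ξ i)) + ∑ i : Fin N, Real.log (τ' (X i.succ.castSucc)),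
    ?_, ?_⟩
  · have e1 : ∑ i, (a i - 1) * Real.log (τ' (ξ i)) +
        ∑ i : Fin N, Real.log (τ' (X i.succ.castSucc)) =
        ∑ i, a i * Real.log (τ' (ξ i)) - Real.log (τ' (ξ 0)) +
        ∑ i : Fin N, (Real.log (τ' (X i.succ.castSucc)) - Real.log (τ' (ξ i.succ))) := by
      have := Fin.sum_univ_succ fun i => Real.log (τ' (ξ i))
      simp only [sub_mul, one_mul, Finset.sum_sub_distrib]
      linarith
    have b1 : |∑ i, a i * Real.log (τ' (ξ i))| ≤ (∑ i, a i) * δ := by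
      rw [Finset.sum_mul]
      refine (Finset.abs_sum_le_sum_abs _ _).trans (Finset.sum_le_sum fun i _ => ?_)
      rw [abs_mul, abs_of_nonneg (ha i)]
      exact mul_le_mul_of_nonneg_left (h.abs_log_le _ (hξI i)) (ha i)
    have b2 : |∑ i : Fin N, (Real.log (τ' (X i.succ.castSucc)) - Real.log (τ' (ξ i.succ)))| ≤ δ := by
      have b3 : ∀ i : Fin N, |Real.log (τ' (X i.succ.castSucc)) - Real.log (τ' (ξ i.succ))| ≤
          δ * (X i.succ.succ - X i.succ.castSucc) := fun i => by
        refine (h.abs_log_sub_le _ (hXI _) _ (hξI _)).trans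
          (mul_le_mul_of_nonneg_left ?_ h.nonneg)
        have := hξ i.succ
        rw [abs_sub_comm, abs_of_pos (sub_pos.2 this.1)]
        linarith [this.2]
      refine (Finset.abs_sum_le_sum_abs _ _).trans ((Finset.sum_le_sum fun i _ => b3 i).trans ?_)
      rw [← Finset.mul_sum]
      refine mul_le_of_le_one_right h.nonneg ?_
      have b4 := sum_succ_sub_castSucc X
      rw [Fin.sum_univ_succ, h0, h1] at b4
      have b5 : 0 ≤ X (Fin.succ 0) - X (Fin.castSucc 0) :=
        sub_nonneg.2 (hX (Fin.castSucc_lt_succ (i := (0 : Fin (N + 1))))).le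
      linarith
    have b6 := h.abs_log_le _ (hξI 0)
    rw [e1]
    rw [abs_le] at *
    constructor <;> linarith
  · rw [Real.exp_add, Real.exp_sum, Real.exp_sum]
    have e2 : ∀ i : Fin N, Real.exp (Real.log (τ' (X i.succ.castSucc))) = τ' (X i.succ.castSucc) :=
      fun i => Real.exp_log (h.pos _ (hXI _))
    have e3 : ∀ i : Fin (N + 1), (τ (X i.succ) - τ (X i.castSucc)) ^ (a i - 1) =
        Real.exp ((a i - 1) * Real.log (τ' (ξ i))) * (X i.succ - X i.castSucc) ^ (a i - 1) :=
      fun i => by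
        rw [hs i, Real.mul_rpow (h.pos _ (hξI i)).le
          (sub_nonneg.2 (hX (Fin.castSucc_lt_succ (i := i))).le),
          Real.rpow_def_of_pos (h.pos _ (hξI i)), mul_comm (Real.log _)]
    simp only [e2, e3, Finset.prod_mul_distrib]
    ring

/-! ### The open simplex and the transformed Dirichlet density. -/

theorem withEnds_zero {N : ℕ} (x : Fin N → ℝ) : withEnds x 0 = 0 := rfl

theorem withEnds_last {N : ℕ} (x : Fin N → ℝ) : withEnds x (Fin.last _) = 1 := by
  rw [withEnds, ← Fin.succ_last, Fin.cons_succ, Fin.snoc_last]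

theorem withEnds_mid {N : ℕ} (x : Fin N → ℝ) (i : Fin N) : withEnds x i.succ.castSucc = x i := by
  rw [withEnds, ← Fin.succ_castSucc, Fin.cons_succ, Fin.snoc_castSucc]

theorem forall_fin_withEnds {N : ℕ} {p : Fin (N + 2) → Prop} (h0 : p 0) (h1 : p (Fin.last _))
    (h : ∀ i : Fin N, p i.succ.castSucc) (i : Fin (N + 2)) : p i := by
  refine Fin.cases h0 (fun j => ?_) i
  refine Fin.lastCases ?_ (fun k => ?_) j
  · rw [Fin.succ_last]; exact h1
  · rw [Fin.succ_castSucc]; exact h k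

theorem continuous_withEnds {N : ℕ} (i : Fin (N + 2)) :
    Continuous fun x : Fin N → ℝ => withEnds x i := by
  refine forall_fin_withEnds (p := fun i => Continuous fun x : Fin N → ℝ => withEnds x i)
    ?_ ?_ (fun i => ?_) i
  · simp only [withEnds_zero]; exact continuous_const
  · simp only [withEnds_last]; exact continuous_const
  · simp only [withEnds_mid]; exact continuous_apply i

theorem withEnds_comp {N : ℕ} {τ : ℝ → ℝ} (h0 : τ 0 = 0) (h1 : τ 1 = 1) (x : Fin N → ℝ)
    (i : Fin (N + 2)) : withEnds (fun j => τ (x j)) i = τ (withEnds x i) := by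
  refine forall_fin_withEnds
    (p := fun i => withEnds (fun j => τ (x j)) i = τ (withEnds x i)) ?_ ?_ (fun i => ?_) i
  · rw [withEnds_zero, withEnds_zero, h0]
  · rw [withEnds_last, withEnds_last, h1]
  · rw [withEnds_mid, withEnds_mid]

/-- The open simplex `0 < x₁ < ⋯ < x_N < 1`. -/
def openSimplex (N : ℕ) : Set (Fin N → ℝ) := {x | StrictMono (withEnds x)}

theorem measurableSet_openSimplex (N : ℕ) : MeasurableSet (openSimplex N) := by
  have : openSimplex N = ⋂ i : Fin (N + 1), {x | withEnds x i.castSucc < withEnds x i.succ} := by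
    ext x
    simp [openSimplex, Fin.strictMono_iff_lt_succ]
  rw [this]
  exact MeasurableSet.iInter fun i =>
    measurableSet_lt (continuous_withEnds _).measurable (continuous_withEnds _).measurable

theorem mem_Icc_of_mem_openSimplex {N : ℕ} {x : Fin N → ℝ} (hx : x ∈ openSimplex N)
    (i : Fin (N + 2)) : withEnds x i ∈ Icc (0 : ℝ) 1 :=
  ⟨by simpa [withEnds_zero] using StrictMono.monotone hx (Fin.zero_le i),
    by simpa [withEnds_last] using StrictMono.monotone hx (Fin.le_last i)⟩

theorem coord_mem_Icc {N : ℕ} {x : Fin N → ℝ} (hx : x ∈ openSimplex N)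
    (i : Fin N) : x i ∈ Icc (0 : ℝ) 1 := by
  simpa only [withEnds_mid] using mem_Icc_of_mem_openSimplex hx i.succ.castSucc

theorem measurable_dirichletDensity (β : ℝ) {N : ℕ} (t : Fin (N + 2) → I) :
    Measurable (dirichletDensity β t) := by
  unfold dirichletDensity
  refine Measurable.ite (measurableSet_openSimplex N) ?_ measurable_const
  refine measurable_const.mul (Finset.measurable_fun_prod _ fun i _ => ?_)
  exact ((continuous_withEnds _).measurable.sub (continuous_withEnds _).measurable).pow_const _

theorem dirichletDensity_of_notMem (β : ℝ) {N : ℕ} (t : Fin (N + 2) → I) {x : Fin N → ℝ}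
    (hx : x ∉ openSimplex N) : dirichletDensity β t x = 0 := if_neg hx

theorem IsWarp.comp_mem_openSimplex {δ : ℝ} {τ τ' : ℝ → ℝ} (h : IsWarp δ τ τ') {N : ℕ}
    {x : Fin N → ℝ} (hx : x ∈ openSimplex N) : (fun i => τ (x i)) ∈ openSimplex N := by
  intro i j hij
  rw [withEnds_comp h.map_zero h.map_one, withEnds_comp h.map_zero h.map_one]
  exact h.strictMonoOn (mem_Icc_of_mem_openSimplex hx i) (mem_Icc_of_mem_openSimplex hx j) (hx hij)

theorem IsWarp.openSimplex_subset_image {δ : ℝ} {τ τ' : ℝ → ℝ} (h : IsWarp δ τ τ') {N : ℕ} :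
    openSimplex N ⊆ (fun (x : Fin N → ℝ) i => τ (x i)) '' openSimplex N := by
  intro y hy
  choose x hx hxy using fun i => h.surjOn (coord_mem_Icc hy i)
  have hyx : (fun i => τ (x i)) = y := funext hxy
  refine ⟨x, fun i j hij => ?_, hyx⟩
  have hxI : ∀ i, withEnds x i ∈ Icc (0 : ℝ) 1 := forall_fin_withEnds
    (by simp [withEnds_zero]) (by simp [withEnds_last]) (fun i => by rw [withEnds_mid]; exact hx i)
  have h1 := hy hij
  rw [← hyx, withEnds_comp h.map_zero h.map_one, withEnds_comp h.map_zero h.map_one] at h1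
  exact (h.strictMonoOn.lt_iff_lt (hxI i) (hxI j)).1 h1

/-- Here `aᵢ = β (tᵢ₊₁ - tᵢ)`, and these exponents sum to `β` for every partition; this is what
makes the bound uniform. -/
theorem IsWarp.density_ratio {δ : ℝ} {τ τ' : ℝ → ℝ} (h : IsWarp δ τ τ') {β : ℝ} (hβ : 0 < β)
    {N : ℕ} {t : Fin (N + 2) → I} (ht : StrictMono t) (ht0 : t 0 = 0) (ht1 : t (Fin.last _) = 1)
    {x : Fin N → ℝ} (hx : x ∈ openSimplex N) : ∃ E : ℝ, |E| ≤ (β + 2) * δ ∧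
      (∏ i, τ' (x i)) * dirichletDensity β t (fun i => τ (x i)) =
        Real.exp E * dirichletDensity β t x := by
  have htp : ∀ i : Fin (N + 1), 0 ≤ β * ((t i.succ : ℝ) - t i.castSucc) := fun i =>
    mul_nonneg hβ.le (sub_nonneg.2 (ht (Fin.castSucc_lt_succ (i := i))).le)
  obtain ⟨E, hE, h1⟩ := h.exists_ratio hx (withEnds_zero x) (withEnds_last x) htp
  have h2 : ∑ i : Fin (N + 1), β * ((t i.succ : ℝ) - t i.castSucc) = β := by
    rw [← Finset.mul_sum, sum_succ_sub_castSucc fun i => (t i : ℝ), ht0, ht1]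
    simp
  rw [h2] at hE
  refine ⟨E, hE, ?_⟩
  rw [dirichletDensity, if_pos (show StrictMono _ from h.comp_mem_openSimplex hx), dirichletDensity,
    if_pos (show StrictMono _ from hx)]
  simp only [withEnds_comp h.map_zero h.map_one]
  simp only [withEnds_mid] at h1
  linear_combination (Real.Gamma β / (∏ i : Fin (N + 1),
    Real.Gamma (β * ((t i.succ : ℝ) - t i.castSucc)))) * h1

theorem dirichletDensity_nonneg {β : ℝ} (hβ : 0 < β) {N : ℕ} {t : Fin (N + 2) → I}
    (ht : StrictMono t) (x : Fin N → ℝ) : 0 ≤ dirichletDensity β t x := by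
  by_cases hx : x ∈ openSimplex N
  · rw [dirichletDensity, if_pos (show StrictMono _ from hx)]
    refine mul_nonneg (div_nonneg (Real.Gamma_pos_of_pos hβ).le
      (Finset.prod_nonneg fun i _ => (Real.Gamma_pos_of_pos (mul_pos hβ ?_)).le))
      (Finset.prod_nonneg fun i _ => Real.rpow_nonneg ?_ _)
    · exact sub_pos.2 (ht (Fin.castSucc_lt_succ (i := i)))
    · exact (sub_pos.2 (hx (Fin.castSucc_lt_succ (i := i)))).le
  · rw [dirichletDensity_of_notMem _ _ hx]

section

variable {δ : ℝ} {τ τ' : ℝ → ℝ} {β : ℝ} {N : ℕ} {t : Fin (N + 2) → I}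

theorem IsWarp.lintegral_image (h : IsWarp δ τ τ') (G : (Fin N → ℝ) → ℝ≥0∞) :
    ∫⁻ y in (fun (x : Fin N → ℝ) i => τ (x i)) '' openSimplex N, G y =
      ∫⁻ x in openSimplex N, ENNReal.ofReal (∏ i, τ' (x i)) * G (fun i => τ (x i)) := by
  rw [lintegral_image_eq_lintegral_abs_det_fderiv_mul (volume : Measure (Fin N → ℝ))
    (measurableSet_openSimplex N)
    (f' := fun x => ContinuousLinearMap.pi fun i =>
      (ContinuousLinearMap.toSpanSingleton ℝ (τ' (x i))).comp (ContinuousLinearMap.proj i))]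
  · refine setLIntegral_congr_fun (measurableSet_openSimplex N) fun x hx => ?_
    have : (ContinuousLinearMap.pi fun i => (ContinuousLinearMap.toSpanSingleton ℝ (τ' (x i))).comp
        (ContinuousLinearMap.proj (R := ℝ) (φ := fun _ : Fin N => ℝ) i)).det = ∏ i, τ' (x i) := by
      rw [ContinuousLinearMap.det_pi]
      refine Finset.prod_congr rfl fun i _ => ?_
      rw [ContinuousLinearMap.det, LinearMap.det_ring]
      simp
    simp only [this]
    rw [abs_of_nonneg (Finset.prod_nonneg fun i _ => (h.pos _ (coord_mem_Icc hx i)).le)]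
  · intro x _
    refine HasFDerivAt.hasFDerivWithinAt (hasFDerivAt_pi.2 fun i => ?_)
    exact (h.hasDerivAt (x i)).hasFDerivAt.comp x (hasFDerivAt_apply i x)
  · intro x hx y hy hxy
    funext i
    exact h.strictMonoOn.injOn (coord_mem_Icc hx i) (coord_mem_Icc hy i) (congrFun hxy i)

/-- The Dirichlet distribution, with parameters given by the partition `t`. -/
def dirichletMeasure (β : ℝ) {N : ℕ} (t : Fin (N + 2) → I) : Measure (Fin N → ℝ) :=
  (volume : Measure (Fin N → ℝ)).withDensity (fun x => ENNReal.ofReal (dirichletDensity β t x))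

theorem lintegral_dirichletMeasure {F : (Fin N → ℝ) → ℝ≥0∞} (hF : Measurable F) :
    ∫⁻ x, F x ∂(dirichletMeasure β t) =
      ∫⁻ x in openSimplex N, ENNReal.ofReal (dirichletDensity β t x) * F x := by
  rw [dirichletMeasure, lintegral_withDensity_eq_lintegral_mul _
    (measurable_dirichletDensity β t).ennreal_ofReal hF, ← lintegral_indicator
    (measurableSet_openSimplex N)]
  refine lintegral_congr fun x => ?_
  by_cases hx : x ∈ openSimplex N
  · simp [hx]
  · simp [hx, dirichletDensity_of_notMem _ _ hx]

/-- The lower bound on `E` is used together with the fact that `τ` maps the simplex into itself. -/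
theorem IsWarp.lintegral_comp_le (h : IsWarp δ τ τ') (hβ : 0 < β) (ht : StrictMono t)
    (ht0 : t 0 = 0) (ht1 : t (Fin.last _) = 1) {F : (Fin N → ℝ) → ℝ≥0∞} (hF : Measurable F) :
    ∫⁻ x, F (fun i => τ (x i)) ∂(dirichletMeasure β t) ≤
      ENNReal.ofReal (Real.exp ((β + 2) * δ)) * ∫⁻ x, F x ∂(dirichletMeasure β t) := by
  have hT : Measurable fun (x : Fin N → ℝ) i => τ (x i) :=
    measurable_pi_iff.2 fun i => h.continuous.measurable.comp (measurable_pi_apply i)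
  have hsub : (fun (x : Fin N → ℝ) i => τ (x i)) '' openSimplex N ⊆ openSimplex N :=
    image_subset_iff.2 fun x hx => h.comp_mem_openSimplex hx
  have hFT : Measurable fun x : Fin N → ℝ => F (fun i => τ (x i)) := hF.comp hT
  rw [lintegral_dirichletMeasure hFT, lintegral_dirichletMeasure hF]
  calc ∫⁻ x in openSimplex N, ENNReal.ofReal (dirichletDensity β t x) * F (fun i => τ (x i))
      ≤ ∫⁻ x in openSimplex N, ENNReal.ofReal (Real.exp ((β + 2) * δ)) *
          (ENNReal.ofReal (∏ i, τ' (x i)) *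
            (ENNReal.ofReal (dirichletDensity β t (fun i => τ (x i))) *
              F (fun i => τ (x i)))) := by
        refine setLIntegral_mono' (measurableSet_openSimplex N) fun x hx => ?_
        have hP : 0 ≤ ∏ i, τ' (x i) :=
          Finset.prod_nonneg fun i _ => (h.pos _ (coord_mem_Icc hx i)).le
        rw [← mul_assoc, ← mul_assoc, mul_assoc (ENNReal.ofReal _) (ENNReal.ofReal _),
          ← ENNReal.ofReal_mul hP, ← ENNReal.ofReal_mul (Real.exp_pos _).le]
        gcongr
        obtain ⟨E, hE, h1⟩ := h.density_ratio hβ ht ht0 ht1 hx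
        rw [h1, ← mul_assoc, ← Real.exp_add]
        refine le_mul_of_one_le_left (dirichletDensity_nonneg hβ ht x) (Real.one_le_exp ?_)
        linarith [(abs_le.1 hE).1]
    _ = ENNReal.ofReal (Real.exp ((β + 2) * δ)) *
        ∫⁻ y in (fun (x : Fin N → ℝ) i => τ (x i)) '' openSimplex N,
          ENNReal.ofReal (dirichletDensity β t y) * F y := by
        rw [h.lintegral_image fun y => ENNReal.ofReal (dirichletDensity β t y) * F y,
          lintegral_const_mul' _ _ ENNReal.ofReal_ne_top]
    _ ≤ _ := by gcongr

/-- For the reverse estimate the simplex must be covered by its image, which is where surjectivity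
of `τ` on `[0,1]` enters. -/
theorem IsWarp.le_lintegral_comp (h : IsWarp δ τ τ') (hβ : 0 < β) (ht : StrictMono t)
    (ht0 : t 0 = 0) (ht1 : t (Fin.last _) = 1) {F : (Fin N → ℝ) → ℝ≥0∞} (hF : Measurable F) :
    ∫⁻ x, F x ∂(dirichletMeasure β t) ≤
      ENNReal.ofReal (Real.exp ((β + 2) * δ)) *
        ∫⁻ x, F (fun i => τ (x i)) ∂(dirichletMeasure β t) := by
  have hT : Measurable fun (x : Fin N → ℝ) i => τ (x i) :=
    measurable_pi_iff.2 fun i => h.continuous.measurable.comp (measurable_pi_apply i)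
  have hFT : Measurable fun x : Fin N → ℝ => F (fun i => τ (x i)) := hF.comp hT
  rw [lintegral_dirichletMeasure hFT, lintegral_dirichletMeasure hF]
  calc ∫⁻ x in openSimplex N, ENNReal.ofReal (dirichletDensity β t x) * F x
      ≤ ∫⁻ y in (fun (x : Fin N → ℝ) i => τ (x i)) '' openSimplex N,
          ENNReal.ofReal (dirichletDensity β t y) * F y :=
        lintegral_mono_set h.openSimplex_subset_image
    _ = ∫⁻ x in openSimplex N, ENNReal.ofReal (∏ i, τ' (x i)) *
          (ENNReal.ofReal (dirichletDensity β t (fun i => τ (x i))) * F (fun i => τ (x i))) :=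
        h.lintegral_image fun y => ENNReal.ofReal (dirichletDensity β t y) * F y
    _ ≤ ∫⁻ x in openSimplex N, ENNReal.ofReal (Real.exp ((β + 2) * δ)) *
          (ENNReal.ofReal (dirichletDensity β t x) * F (fun i => τ (x i))) := by
        refine setLIntegral_mono' (measurableSet_openSimplex N) fun x hx => ?_
        have hP : 0 ≤ ∏ i, τ' (x i) :=
          Finset.prod_nonneg fun i _ => (h.pos _ (coord_mem_Icc hx i)).le
        rw [← mul_assoc, ← mul_assoc, ← ENNReal.ofReal_mul hP,
          ← ENNReal.ofReal_mul (Real.exp_pos _).le]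
        refine mul_le_mul' (ENNReal.ofReal_le_ofReal ?_) le_rfl
        obtain ⟨E, hE, h1⟩ := h.density_ratio hβ ht ht0 ht1 hx
        rw [h1]
        refine mul_le_mul_of_nonneg_right (Real.exp_le_exp.2 ?_) (dirichletDensity_nonneg hβ ht x)
        exact (abs_le.1 hE).2
    _ = _ := lintegral_const_mul' _ _ ENNReal.ofReal_ne_top

end

/-! ### Evaluations and step functions -/

/-- Evaluation at `t` is upper semicontinuous in the `L²`-distance. If `g t < c`, then `g < c` on
some interval to the right of `t` by right continuity, whereas functions with values at least `c` at
`t` stay above `c` on it, and so do their almost everywhere limits. -/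
theorem G0.measurable_eval (t : I) : Measurable fun g : G0 => (g t : ℝ) := by
  rcases eq_or_ne t 1 with rfl | ht1
  · simp only [G0.map_one]; exact measurable_const
  have ht : t < 1 := lt_of_le_of_ne t.2.2 ht1
  refine measurable_of_Ici fun c => IsClosed.measurableSet ?_
  refine IsSeqClosed.isClosed fun F g hF hFg => ?_
  obtain ⟨ns, -, hns⟩ := G0.exists_subseq_ae hFg
  by_contra hc
  have hgt : (g t : ℝ) < c := not_le.1 hc
  have hg : Tendsto (fun r => (g r : ℝ)) (𝓝[>] t) (𝓝 (g t)) :=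
    (continuous_subtype_val.tendsto _).comp
      ((g.right_cont t ht).mono_left (nhdsWithin_mono _ Ioi_subset_Ici_self))
  obtain ⟨b, hb, hbU⟩ :=
    (mem_nhdsGT_iff_exists_Ioo_subset' ht).1 (hg.eventually_lt_const hgt)
  have hpos : 0 < volume (Ioo t b) := by
    rw [unitInterval.volume_Ioo]
    simpa using (show t < b from hb)
  refine hpos.ne' (measure_mono_null (fun r hr => ?_) (ae_iff.1 hns))
  intro hlim
  have h1 : c ≤ (g r : ℝ) := ge_of_tendsto' hlim fun i => (hF (ns i)).trans
    ((F (ns i)).mono hr.1.le)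
  exact absurd (hbU hr) (not_lt.2 h1)

/-- The uniform partition of `[0,1]` with `N + 1` intervals. -/
def grid (N : ℕ) (i : Fin (N + 2)) : I :=
  ⟨(i : ℝ) / (N + 1), by positivity, by
    rw [div_le_one (by positivity)]
    exact_mod_cast Nat.lt_succ_iff.1 i.2⟩

theorem grid_strictMono (N : ℕ) : StrictMono (grid N) := fun i j hij => by
  have : ((i : ℕ) : ℝ) < (j : ℕ) := by exact_mod_cast hij
  exact Subtype.mk_lt_mk.2 (by gcongr)

theorem grid_zero (N : ℕ) : grid N 0 = 0 := Subtype.ext (by simp [grid])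

theorem grid_last (N : ℕ) : grid N (Fin.last _) = 1 := Subtype.ext (by
  have : (N : ℝ) + 1 ≠ 0 := by positivity
  simp [grid, this])

/-- The values of `g` at the inner points of the uniform partition. -/
def gridEval (N : ℕ) (g : G0) (i : Fin N) : ℝ := g (grid N i.succ.castSucc)

theorem measurable_gridEval (N : ℕ) : Measurable (gridEval N) :=
  measurable_pi_iff.2 fun _ => G0.measurable_eval _

theorem withEnds_gridEval_le {N : ℕ} (g : G0) (i : Fin (N + 2)) :
    withEnds (gridEval N g) i ≤ g (grid N i) := by
  refine forall_fin_withEnds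
    (p := fun i => withEnds (gridEval N g) i ≤ g (grid N i)) ?_ ?_ (fun i => ?_) i
  · rw [withEnds_zero]; exact (g _).2.1
  · rw [withEnds_last, grid_last, g.map_one]; exact le_rfl
  · rw [withEnds_mid]; exact le_rfl

/-- The index `0` is excluded because the prescribed left end value is `0`, while `g 0` may be
positive. -/
theorem withEnds_gridEval_eq {N : ℕ} (g : G0) {i : Fin (N + 2)} (hi : i ≠ 0) :
    withEnds (gridEval N g) i = g (grid N i) := by
  revert hi
  refine forall_fin_withEnds
    (p := fun i => i ≠ 0 → withEnds (gridEval N g) i = g (grid N i)) ?_ ?_ (fun i => ?_) i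
  · exact fun h => absurd rfl h
  · intro; rw [withEnds_last, grid_last, g.map_one]; rfl
  · intro; rw [withEnds_mid]; rfl

/-- The step function on the uniform partition with values `xᵢ`. -/
def stepFun (N : ℕ) (x : Fin N → ℝ) : G0 where
  -- The supremum is monotone in `t` for every `x`, ordered or not, and continuous in `x`; the
  -- projection keeps the values in `[0,1]`.
  toFun t := Finset.univ.sup fun i =>
    if grid N i ≤ t then projIcc 0 1 zero_le_one (withEnds x i) else ⊥
  mono s t hst := by
    refine Finset.sup_mono_fun fun i _ => ?_
    split_ifs with h1 h2
    · exact le_rfl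
    · exact absurd (h1.trans hst) h2
    · exact bot_le
    · exact le_rfl
  right_cont t _ := by
    refine ContinuousWithinAt.finset_sup_apply fun i _ => ?_
    by_cases h : grid N i ≤ t
    · refine (continuousWithinAt_const (b := projIcc 0 1 zero_le_one (withEnds x i))).congr
        (fun y hy => ?_) ?_
      · simp [h.trans (mem_Ici.1 hy)]
      · simp [h]
    · refine (continuousWithinAt_const (b := (⊥ : I))).congr_of_eventuallyEq ?_ (by simp [h])
      filter_upwards [mem_nhdsWithin_of_mem_nhds (Iio_mem_nhds (not_le.1 h))] with y hy
      simp [not_le.2 (mem_Iio.1 hy)]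
  map_one := by
    refine le_antisymm le_one' ?_
    refine le_trans ?_ (Finset.le_sup (Finset.mem_univ (Fin.last (N + 1))))
    rw [withEnds_last, if_pos le_one']
    simp

theorem stepFun_apply (N : ℕ) (x : Fin N → ℝ) (t : I) : stepFun N x t = Finset.univ.sup fun i =>
    if grid N i ≤ t then projIcc 0 1 zero_le_one (withEnds x i) else ⊥ := rfl

theorem continuous_stepFun (N : ℕ) : Continuous (stepFun N) := by
  refine continuous_iff_continuousAt.2 fun x => G0.tendsto_of_ae (Eventually.of_forall fun t => ?_)
  have : Continuous fun x : Fin N → ℝ => stepFun N x t := by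
    simp only [stepFun_apply]
    refine Continuous.finset_sup_apply fun i _ => ?_
    split_ifs
    · exact continuous_projIcc.comp (continuous_withEnds i)
    · exact continuous_const
  exact (continuous_subtype_val.comp this).tendsto x

theorem stepFun_gridEval_le (N : ℕ) (g : G0) (t : I) : stepFun N (gridEval N g) t ≤ g t := by
  rw [stepFun_apply]
  refine Finset.sup_le fun i _ => ?_
  split_ifs with h
  · refine le_trans ?_ (g.mono h)
    refine (monotone_projIcc _ (withEnds_gridEval_le g i)).trans ?_
    rw [projIcc_val]
  · exact bot_le

theorem le_stepFun_gridEval {N : ℕ} (g : G0) {t : I} {i : Fin (N + 2)} (hi : i ≠ 0)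
    (ht : grid N i ≤ t) : g (grid N i) ≤ stepFun N (gridEval N g) t := by
  rw [stepFun_apply]
  refine le_trans ?_ (Finset.le_sup (Finset.mem_univ i))
  rw [if_pos ht, withEnds_gridEval_eq g hi, projIcc_val]

/-- The step function at `t` lies between the value of `g` at the last grid point before `t` and `g
t`. These come together at every continuity point `t > 0` of `g`, that is, off a countable set. -/
theorem tendsto_stepFun (g : G0) :
    Tendsto (fun N => stepFun N (gridEval N g)) atTop (𝓝 g) := by
  refine G0.tendsto_of_ae ?_
  have hc : ({t : I | ¬ContinuousAt g.toFun t} ∪ {0}).Countable :=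
    g.mono.countable_not_continuousAt.union (countable_singleton 0)
  filter_upwards [(hc.ae_notMem volume)] with t ht
  simp only [mem_union, mem_ofPred_eq, mem_singleton_iff, not_or, not_not] at ht
  have ht0 : (0 : ℝ) < t := lt_of_le_of_ne t.2.1 fun h => ht.2 (Subtype.ext h.symm)
  refine tendsto_order.2 ⟨fun a ha => ?_, fun a ha => Eventually.of_forall fun N => ?_⟩
  · have h1 : ∀ᶠ s in 𝓝 t, a < (g s : ℝ) :=
      ((continuous_subtype_val.continuousAt.comp ht.1).tendsto).eventually_const_lt ha
    have h2 : Tendsto (fun N : ℕ => (⌊((N : ℝ) + 1) * t⌋₊ : ℝ) / (N + 1)) atTop (𝓝 t) := by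
      have h3 := (tendsto_nat_floor_mul_div_atTop (R := ℝ) t.2.1).comp
        (tendsto_natCast_atTop_atTop.comp (tendsto_add_atTop_nat 1))
      refine h3.congr fun N => ?_
      simp [mul_comm]
    have hfl : ∀ N : ℕ, ⌊((N : ℝ) + 1) * t⌋₊ < N + 2 := fun N => by
      have : ⌊((N : ℝ) + 1) * t⌋₊ ≤ ⌊(N : ℝ) + 1⌋₊ :=
        Nat.floor_le_floor (mul_le_of_le_one_right (by positivity) t.2.2)
      have h4 : ⌊(N : ℝ) + 1⌋₊ = N + 1 := by
        rw [← Nat.cast_succ, Nat.floor_natCast]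
      omega
    have h5 : Tendsto (fun N : ℕ => grid N ⟨_, hfl N⟩) atTop (𝓝 t) := by
      rw [tendsto_subtype_rng]; exact h2
    filter_upwards [h5.eventually h1, h2.eventually_const_lt ht0] with N hN hN0
    refine hN.trans_le (Subtype.coe_le_coe.2 (le_stepFun_gridEval g ?_ ?_))
    · intro h
      have := congrArg Fin.val h
      simp only [Fin.val_zero] at this
      rw [this] at hN0
      simp at hN0
    · refine Subtype.coe_le_coe.1 ?_
      simp only [grid]
      rw [div_le_iff₀ (by positivity), mul_comm (t : ℝ)]
      exact Nat.floor_le (mul_nonneg (by positivity) t.2.1)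
  · exact lt_of_le_of_lt (stepFun_gridEval_le N g t) ha

/-! ### Change of variables under the Dirichlet process -/

open Classical in
/-- The function `τ ∘ g` (for increasing continuous `τ : [0,1] → [0,1]` with `τ 1 = 1`). -/
def G0.push (τ : ℝ → ℝ) (g : G0) : G0 :=
  if h : Continuous τ ∧ MonotoneOn τ (Icc 0 1) ∧ MapsTo τ (Icc 0 1) (Icc 0 1) ∧ τ 1 = 1 then
    { toFun := fun t => ⟨τ (g t), h.2.2.1 (g t).2⟩
      mono := fun s t hst => Subtype.mk_le_mk.2 (h.2.1 (g s).2 (g t).2 (g.mono hst))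
      right_cont := fun t ht => by
        rw [Topology.IsInducing.subtypeVal.continuousWithinAt_iff]
        exact (h.1.comp continuous_subtype_val).continuousAt.comp_continuousWithinAt
          (g.right_cont t ht)
      map_one := Subtype.ext (by simp [g.map_one, h.2.2.2]) }
  else g

theorem IsWarp.push_apply {δ : ℝ} {τ τ' : ℝ → ℝ} (h : IsWarp δ τ τ') (g : G0) (t : I) :
    (g.push τ t : ℝ) = τ (g t) := by
  rw [G0.push, dif_pos ⟨h.continuous, h.strictMonoOn.monotoneOn, h.mapsTo, h.map_one⟩]

theorem IsWarp.toL2_push {δ : ℝ} {τ τ' : ℝ → ℝ} (h : IsWarp δ τ τ') (g : G0) :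
    (g.push τ).toL2 = g.compH τ := by
  rw [G0.toL2_eq, G0.compH]
  simp only [h.push_apply]

theorem IsWarp.continuous_push {δ : ℝ} {τ τ' : ℝ → ℝ} (h : IsWarp δ τ τ') :
    Continuous (G0.push τ) := by
  rw [G0.isometry_toL2.isEmbedding.continuous_iff]
  simp only [Function.comp_def, h.toL2_push]
  exact G0.continuous_compH h.continuous

namespace IsDirichletProcess

variable {β : ℝ} {Q : Measure G0}

theorem lintegral_gridEval (hQ : IsDirichletProcess β Q) (N : ℕ) {F : (Fin N → ℝ) → ℝ≥0∞}
    (hF : Measurable F) :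
    ∫⁻ g, F (gridEval N g) ∂Q = ∫⁻ x, F x ∂(dirichletMeasure β (grid N)) := by
  have h := hQ.marginals N (grid N) (grid_strictMono N) (grid_zero N) (grid_last N)
  rw [dirichletMeasure, ← h, ← lintegral_map hF (measurable_gridEval N)]
  rfl

theorem tendsto_lintegral_step (hQ : IsDirichletProcess β Q) {u : G0 → ℝ≥0∞} (hu : Continuous u)
    {C : ℝ≥0∞} (hC : C ≠ ⊤) (huC : ∀ g, u g ≤ C) {T : G0 → G0} (hT : Measurable T) :
    Tendsto (fun N => ∫⁻ g, u (stepFun N (gridEval N (T g))) ∂Q) atTop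
      (𝓝 (∫⁻ g, u (T g) ∂Q)) := by
  have := hQ.isProbabilityMeasure
  refine tendsto_lintegral_of_dominated_convergence (fun _ => C) (fun N => ?_)
    (fun N => Eventually.of_forall fun g => huC _) (by simpa using hC)
    (Eventually.of_forall fun g => (hu.tendsto _).comp (tendsto_stepFun _))
  exact hu.measurable.comp ((continuous_stepFun N).measurable.comp
    ((measurable_gridEval N).comp hT))

/-- For functions of the grid values this is the finite dimensional estimate, since the grid values
of `τ ∘ g` are the images under `τ` of those of `g`. The constant is the same for all grids, so the
bounds survive the limit of step function approximations. -/
theorem lintegral_push (hQ : IsDirichletProcess β Q) (hβ : 0 < β) {δ : ℝ} {τ τ' : ℝ → ℝ}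
    (h : IsWarp δ τ τ') {u : G0 → ℝ≥0∞} (hu : Continuous u) {C : ℝ≥0∞} (hC : C ≠ ⊤)
    (huC : ∀ g, u g ≤ C) :
    ∫⁻ g, u (g.push τ) ∂Q ≤ ENNReal.ofReal (Real.exp ((β + 2) * δ)) * ∫⁻ g, u g ∂Q ∧
      ∫⁻ g, u g ∂Q ≤ ENNReal.ofReal (Real.exp ((β + 2) * δ)) * ∫⁻ g, u (g.push τ) ∂Q := by
  have h1 := hQ.tendsto_lintegral_step hu hC huC measurable_id
  have h2 := hQ.tendsto_lintegral_step hu hC huC h.continuous_push.measurable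
  have hm : ∀ N, Measurable fun x => u (stepFun N x) := fun N =>
    (hu.comp (continuous_stepFun N)).measurable
  have hT : ∀ N, Measurable fun (x : Fin N → ℝ) i => τ (x i) := fun N =>
    measurable_pi_iff.2 fun i => h.continuous.measurable.comp (measurable_pi_apply i)
  have e1 : ∀ N, ∫⁻ g, u (stepFun N (gridEval N (id g))) ∂Q =
      ∫⁻ x, u (stepFun N x) ∂(dirichletMeasure β (grid N)) := fun N =>
    hQ.lintegral_gridEval N (hm N)
  have e2 : ∀ N, ∫⁻ g, u (stepFun N (gridEval N (g.push τ))) ∂Q =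
      ∫⁻ x, u (stepFun N (fun i => τ (x i))) ∂(dirichletMeasure β (grid N)) := fun N => by
    rw [← hQ.lintegral_gridEval N (F := fun x => u (stepFun N (fun i => τ (x i))))
      ((hm N).comp (hT N))]
    refine lintegral_congr fun g => ?_
    congr 2
    funext i
    exact h.push_apply g _
  simp only [e1] at h1
  simp only [e2] at h2
  constructor
  · refine le_of_tendsto_of_tendsto' h2 (ENNReal.Tendsto.const_mul h1 (Or.inr ENNReal.ofReal_ne_top))
      fun N => ?_
    exact h.lintegral_comp_le hβ (grid_strictMono N) (grid_zero N) (grid_last N) (hm N)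
  · refine le_of_tendsto_of_tendsto' h1 (ENNReal.Tendsto.const_mul h2 (Or.inr ENNReal.ofReal_ne_top))
      fun N => ?_
    exact h.le_lintegral_comp hβ (grid_strictMono N) (grid_zero N) (grid_last N) (hm N)

theorem integral_push_nonneg (hQ : IsDirichletProcess β Q) (hβ : 0 < β) {δ : ℝ} {τ τ' : ℝ → ℝ}
    (h : IsWarp δ τ τ') {u : G0 → ℝ} (hu : Continuous u) {C : ℝ} (huC : ∀ g, u g ≤ C)
    (hu0 : ∀ g, 0 ≤ u g) :
    |∫ g, u (g.push τ) ∂Q - ∫ g, u g ∂Q| ≤ (Real.exp ((β + 2) * δ) - 1) * ∫ g, u g ∂Q := by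
  have := hQ.isProbabilityMeasure
  obtain ⟨h1, h2⟩ := hQ.lintegral_push hβ h (u := fun g => ENNReal.ofReal (u g))
    (ENNReal.continuous_ofReal.comp hu) (C := ENNReal.ofReal C) ENNReal.ofReal_ne_top
    (fun g => ENNReal.ofReal_le_ofReal (huC g))
  have hC : ∀ g, ‖u g‖ ≤ C := fun g => by rw [Real.norm_of_nonneg (hu0 g)]; exact huC g
  have i1 : Integrable u Q := Integrable.of_bound hu.aestronglyMeasurable C
    (Eventually.of_forall hC)
  have i2 : Integrable (fun g => u (G0.push τ g)) Q := Integrable.of_bound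
    (hu.comp h.continuous_push).aestronglyMeasurable C (Eventually.of_forall fun g => hC _)
  rw [← ofReal_integral_eq_lintegral_ofReal i1 (Eventually.of_forall hu0),
    ← ofReal_integral_eq_lintegral_ofReal i2 (Eventually.of_forall fun g => hu0 _),
    ← ENNReal.ofReal_mul (Real.exp_pos _).le] at h1 h2
  have p1 : 0 ≤ ∫ g, u g ∂Q := integral_nonneg hu0
  have p2 : 0 ≤ ∫ g, u (g.push τ) ∂Q := integral_nonneg fun g => hu0 _
  have hK : 1 ≤ Real.exp ((β + 2) * δ) := Real.one_le_exp (mul_nonneg (by linarith) h.nonneg)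
  rw [ENNReal.ofReal_le_ofReal_iff (mul_nonneg (by linarith) p1)] at h1
  rw [ENNReal.ofReal_le_ofReal_iff (mul_nonneg (by linarith) p2)] at h2
  set K := Real.exp ((β + 2) * δ)
  rw [abs_le]
  constructor
  -- With `A` the integral after and `B` the integral before the transformation: if `A ≤ B`, then `B
  -- - A ≤ (K - 1) A ≤ (K - 1) B`.
  · rcases le_total (∫ g, u g ∂Q) (∫ g, u (g.push τ) ∂Q) with h3 | h3
    · nlinarith
    · nlinarith
  · nlinarith

theorem integral_push (hQ : IsDirichletProcess β Q) (hβ : 0 < β) {δ : ℝ} {τ τ' : ℝ → ℝ}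
    (h : IsWarp δ τ τ') {u : G0 → ℝ} (hu : Continuous u) {C : ℝ} (huC : ∀ g, ‖u g‖ ≤ C) :
    |∫ g, u (g.push τ) ∂Q - ∫ g, u g ∂Q| ≤ (Real.exp ((β + 2) * δ) - 1) * ∫ g, ‖u g‖ ∂Q := by
  have := hQ.isProbabilityMeasure
  have c1 : Continuous fun g => max (u g) 0 := hu.max continuous_const
  have c2 : Continuous fun g => max (-u g) 0 := hu.neg.max continuous_const
  have hC0 : 0 ≤ C := (norm_nonneg _).trans (huC (G0.jump 0))
  have b1 : ∀ g, max (u g) 0 ≤ C := fun g => max_le ((le_abs_self _).trans (huC g)) hC0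
  have b2 : ∀ g, max (-u g) 0 ≤ C := fun g => max_le ((neg_le_abs _).trans (huC g)) hC0
  have i : ∀ {v : G0 → ℝ}, Continuous v → (∀ g, v g ≤ C) → (∀ g, 0 ≤ v g) → Integrable v Q :=
    fun hv h1 h2 => Integrable.of_bound hv.aestronglyMeasurable C (Eventually.of_forall fun g => by
      rw [Real.norm_of_nonneg (h2 g)]; exact h1 g)
  have n1 : ∀ g, 0 ≤ max (u g) 0 := fun g => le_max_right _ _
  have n2 : ∀ g, 0 ≤ max (-u g) 0 := fun g => le_max_right _ _
  have a1 := hQ.integral_push_nonneg hβ h c1 b1 n1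
  have a2 := hQ.integral_push_nonneg hβ h c2 b2 n2
  have e : ∀ x : ℝ, x = max x 0 - max (-x) 0 := fun x => by
    rcases le_total 0 x with hx | hx
    · rw [max_eq_left hx, max_eq_right (by linarith)]; ring
    · rw [max_eq_right hx, max_eq_left (by linarith)]; ring
  have e' : ∀ x : ℝ, ‖x‖ = max x 0 + max (-x) 0 := fun x => by
    rcases le_total 0 x with hx | hx
    · rw [max_eq_left hx, max_eq_right (by linarith), Real.norm_of_nonneg hx]; ring
    · rw [max_eq_right hx, max_eq_left (by linarith), Real.norm_of_nonpos hx]; ring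
  have s1 : ∫ g, u g ∂Q = ∫ g, max (u g) 0 ∂Q - ∫ g, max (-u g) 0 ∂Q := by
    rw [← integral_sub (i c1 b1 n1) (i c2 b2 n2)]
    exact integral_congr_ae (Eventually.of_forall fun g => e _)
  have s2 : ∫ g, ‖u g‖ ∂Q = ∫ g, max (u g) 0 ∂Q + ∫ g, max (-u g) 0 ∂Q := by
    rw [← integral_add (i c1 b1 n1) (i c2 b2 n2)]
    exact integral_congr_ae (Eventually.of_forall fun g => e' _)
  have d1 : Continuous fun g : G0 => max (u (g.push τ)) 0 := c1.comp h.continuous_push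
  have d2 : Continuous fun g : G0 => max (-u (g.push τ)) 0 := c2.comp h.continuous_push
  have s3 : ∫ g, u (g.push τ) ∂Q =
      ∫ g, max (u (g.push τ)) 0 ∂Q - ∫ g, max (-u (g.push τ)) 0 ∂Q := by
    rw [← integral_sub (i d1 (fun g => b1 _) (fun g => n1 _))
      (i d2 (fun g => b2 _) (fun g => n2 _))]
    exact integral_congr_ae (Eventually.of_forall fun g => e _)
  rw [s1, s2, s3, mul_add]
  calc _ = |(∫ g, max (u (g.push τ)) 0 ∂Q - ∫ g, max (u g) 0 ∂Q) -
        (∫ g, max (-u (g.push τ)) 0 ∂Q - ∫ g, max (-u g) 0 ∂Q)| := by congr 1; ring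
    _ ≤ _ := (abs_sub _ _).trans (add_le_add a1 a2)

end IsDirichletProcess

/-! ### The integration by parts estimate -/

theorem abs_log_sub_log_le {a b : ℝ} (ha : 1 / 2 ≤ a) (hb : 1 / 2 ≤ b) :
    |Real.log a - Real.log b| ≤ 2 * |a - b| := by
  have key : ∀ {a b : ℝ}, 1 / 2 ≤ a → 1 / 2 ≤ b → Real.log a - Real.log b ≤ 2 * |a - b| := by
    intro a b ha hb
    rw [← Real.log_div (by linarith) (by linarith)]
    refine (Real.log_le_sub_one_of_pos (by positivity)).trans ?_
    have : a / b - 1 = (a - b) / b := by field_simp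
    rw [this, div_le_iff₀ (by linarith)]
    nlinarith [le_abs_self (a - b), abs_nonneg (a - b)]
  rw [abs_le]
  have h1 := key ha hb
  have h2 := key hb ha
  rw [abs_sub_comm] at h2
  constructor <;> linarith

/-- The condition `s M ≤ 1/2` keeps `τ' ≥ 1/2` on `[0,1]`, where `log` is Lipschitz with constant
`2`; hence the factor `2`. The constant `M` dominates both `|φ'|` and `|φ''|` there. -/
theorem exists_isWarp {φ : ℝ → ℝ} (hφ : ContDiff ℝ 2 φ) (h0 : φ 0 = 0) (h1 : φ 1 = 0) :
    ∃ M : ℝ, 0 < M ∧ ∀ s : ℝ, 0 ≤ s → s * M ≤ 1 / 2 →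
      IsWarp (2 * M * s) (fun x => x + s * φ x) (fun x => 1 + s * deriv φ x) := by
  have hd : Continuous (deriv φ) := hφ.continuous_deriv (by norm_num)
  have hd1 : ContDiff ℝ 1 (deriv φ) := by
    have : ContDiff ℝ (1 + 1) φ := by norm_num; exact hφ
    exact this.deriv'
  obtain ⟨M₁, hM₁, hb₁⟩ := exists_bound_Icc hd
  obtain ⟨M₂, hM₂, hb₂⟩ := exists_bound_Icc hd1.continuous_deriv_one
  refine ⟨M₁ + M₂ + 1, by positivity, fun s hs hsM => ?_⟩
  have hb : ∀ x ∈ Icc (0 : ℝ) 1, |s * deriv φ x| ≤ s * (M₁ + M₂ + 1) := fun x hx => by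
    rw [abs_mul, abs_of_nonneg hs]
    have := hb₁ x hx
    rw [Real.norm_eq_abs] at this
    exact mul_le_mul_of_nonneg_left (by linarith) hs
  have hhalf : ∀ x ∈ Icc (0 : ℝ) 1, 1 / 2 ≤ 1 + s * deriv φ x := fun x hx => by
    have := (abs_le.1 (hb x hx)).1
    linarith
  refine ⟨fun x => ?_, by simp [h0], by simp [h1], fun x hx => by linarith [hhalf x hx],
    fun x hx => ?_, fun x hx y hy => ?_⟩
  · exact (hasDerivAt_id x).add (((hφ.differentiable (by norm_num)) x).hasDerivAt.const_mul s)
  · have := abs_log_sub_log_le (hhalf x hx) (b := 1) (by norm_num)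
    rw [Real.log_one, sub_zero, add_sub_cancel_left] at this
    linarith [hb x hx]
  · refine (abs_log_sub_log_le (hhalf x hx) (hhalf y hy)).trans ?_
    have h2 : |deriv φ x - deriv φ y| ≤ M₂ * |x - y| :=
      (convex_Icc (0 : ℝ) 1).norm_image_sub_le_of_norm_deriv_le
        (fun z _ => (hd1.differentiable one_ne_zero) z) hb₂ hy hx
    have h3 : 1 + s * deriv φ x - (1 + s * deriv φ y) = s * (deriv φ x - deriv φ y) := by ring
    rw [h3, abs_mul, abs_of_nonneg hs]
    have h4 : M₂ * |x - y| ≤ (M₁ + M₂ + 1) * |x - y| :=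
      mul_le_mul_of_nonneg_right (by linarith) (abs_nonneg _)
    nlinarith [mul_le_mul_of_nonneg_left (h2.trans h4) hs]

theorem tendsto_exp_sub_one_div (c : ℝ) :
    Tendsto (fun s : ℝ => (Real.exp (c * s) - 1) / s) (𝓝[>] 0) (𝓝 c) := by
  have h1 : HasDerivAt (fun s : ℝ => Real.exp (c * s)) c 0 := by
    simpa using ((hasDerivAt_id (0 : ℝ)).const_mul c).exp
  have h4 := h1.hasDerivWithinAt (s := Ioi 0)
  rw [hasDerivWithinAt_iff_tendsto_slope' (by simp)] at h4
  refine h4.congr fun t => ?_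
  simp [slope_def_field]

/-- This is quasi-invariance differentiated at `s = 0`. In `L²` the path `τ ∘ g` is exactly `g + s
(φ ∘ g)`, an admissible flow, so the difference quotients of `u` converge to `⟪V g, φ ∘ g⟫`, while
`(exp (c s) - 1) / s` converges to `c`. The `L¹`-norm of `u` on the right, with `c` independent of
`u`, takes the place of a divergence formula. -/
theorem IsDirichletProcess.exists_ibp_bound {β : ℝ} {Q : Measure G0} (hQ : IsDirichletProcess β Q)
    (hβ : 0 < β) {φ : ℝ → ℝ} (hφ : ContDiff ℝ 2 φ) (h0 : φ 0 = 0) (h1 : φ 1 = 0) :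
    ∃ c : ℝ, 0 ≤ c ∧ ∀ (u : G0 → ℝ) (V : G0 → H), Reg u V →
      |∫ g, inner ℝ (V g) (g.compH φ) ∂Q| ≤ c * ∫ g, ‖u g‖ ∂Q := by
  have := hQ.isProbabilityMeasure
  obtain ⟨M, hM, hW⟩ := exists_isWarp hφ h0 h1
  obtain ⟨K, hK0, hK⟩ := exists_bound_Icc hφ.continuous
  refine ⟨(β + 2) * (2 * M), by positivity, fun u V hu => ?_⟩
  obtain ⟨C, hC0, hC⟩ := hu.bdd
  have hev : ∀ᶠ s : ℝ in 𝓝[>] 0, 0 < s ∧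
      IsWarp (2 * M * s) (fun x => x + s * φ x) (fun x => 1 + s * deriv φ x) := by
    filter_upwards [Ioo_mem_nhdsGT (show (0 : ℝ) < 1 / (2 * M) by positivity)] with s hs
    refine ⟨hs.1, hW s hs.1.le ?_⟩
    have := hs.2
    rw [lt_div_iff₀ (by positivity)] at this
    linarith
  have hL2 : ∀ s : ℝ, IsWarp (2 * M * s) (fun x => x + s * φ x) (fun x => 1 + s * deriv φ x) →
      ∀ g : G0, (g.push fun x => x + s * φ x).toL2 = g.toL2 + s • g.compH φ := fun s hs g => by
    rw [hs.toL2_push, G0.compH]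
    refine toH_eq (g.memLp_comp hs.continuous) ?_
    filter_upwards [g.toL2_ae, g.compH_ae hφ.continuous, Lp.coeFn_add g.toL2 (s • g.compH φ),
      Lp.coeFn_smul s (g.compH φ)] with t e1 e2 e3 e4
    rw [e3, Pi.add_apply, e4, Pi.smul_apply, e1, e2, smul_eq_mul]
  have key : Tendsto (fun s : ℝ => ∫ g, (u (g.push fun x => x + s * φ x) - u g) / s ∂Q) (𝓝[>] 0)
      (𝓝 (∫ g, inner ℝ (V g) (g.compH φ) ∂Q)) := by
    refine tendsto_integral_filter_of_dominated_convergence (fun _ => C * K) ?_ ?_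
      (integrable_const _) (Eventually.of_forall fun g => ?_)
    · filter_upwards [hev] with s hs
      exact (((hu.cont.comp hs.2.continuous_push).sub hu.cont).div_const s).aestronglyMeasurable
    · filter_upwards [hev] with s hs
      refine Eventually.of_forall fun g => ?_
      rw [norm_div, Real.norm_of_nonneg hs.1.le, div_le_iff₀ hs.1]
      refine (hu.abs_sub_le (fun g => (hC g).2) g _).trans ?_
      rw [hL2 s hs.2, add_sub_cancel_left, norm_smul, Real.norm_of_nonneg hs.1.le]
      have : ‖g.compH φ‖ ≤ K := norm_toH_le hK0 (g.abs_comp_le hK)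
      calc C * (s * ‖g.compH φ‖) ≤ C * (s * K) := by gcongr; exact hs.1.le
        _ = C * K * s := by ring
    · refine hu.hasGradAt g _ _ ?_
      filter_upwards [hev] with s hs
      exact hL2 s hs.2 g
  have hlim := (tendsto_exp_sub_one_div ((β + 2) * (2 * M))).mul_const (∫ g, ‖u g‖ ∂Q)
  refine le_of_tendsto_of_tendsto key.abs hlim ?_
  filter_upwards [hev] with s hs
  have hi : ∀ {v : G0 → G0}, Continuous v → Integrable (fun g => u (v g)) Q := fun hv =>
    Integrable.of_bound (hu.cont.comp hv).aestronglyMeasurable C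
      (Eventually.of_forall fun g => (hC _).1)
  rw [integral_div, integral_sub (hi hs.2.continuous_push) (hi continuous_id'), abs_div,
    abs_of_pos hs.1, div_mul_eq_mul_div]
  refine div_le_div_of_nonneg_right ?_ hs.1.le
  have := hQ.integral_push hβ hs.2 hu.cont (fun g => (hC g).1)
  rwa [← mul_assoc] at this

/-! ### Typical paths are strictly increasing -/

/-- A mesh smaller than half of `t - s` leaves two consecutive grid points of `[s,t]`. They have the
indices `k + 1` and `k + 2`, so the artificial value at the left end is not involved. -/
theorem strictMono_of_gridEval {g : G0} (h : ∀ N, gridEval N g ∈ openSimplex N) :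
    StrictMono g.toFun := by
  intro s t hst
  have hst' : (s : ℝ) < t := hst
  obtain ⟨N, hN⟩ := exists_nat_one_div_lt (show (0 : ℝ) < ((t : ℝ) - s) / 2 by linarith)
  have hN0 : (0 : ℝ) < (N : ℝ) + 1 := by positivity
  set k := ⌊((N : ℝ) + 1) * s⌋₊ with hk
  have h1 : (k : ℝ) ≤ ((N : ℝ) + 1) * s := Nat.floor_le (mul_nonneg hN0.le s.2.1)
  have h2 : ((N : ℝ) + 1) * s < k + 1 := Nat.lt_floor_add_one _
  rw [div_lt_div_iff₀ hN0 two_pos] at hN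
  have h3 : (k : ℝ) + 2 < ((N : ℝ) + 1) * t := by linarith
  have h4 : (k : ℝ) + 2 < N + 1 := h3.trans_le (mul_le_of_le_one_right hN0.le t.2.2)
  have h5 : k + 2 < N + 1 := by exact_mod_cast h4
  let i : Fin (N + 2) := ⟨k + 1, by omega⟩
  let j : Fin (N + 2) := ⟨k + 2, by omega⟩
  have hij : i < j := Fin.mk_lt_mk.2 (by omega)
  have hi : i ≠ 0 := Fin.ne_of_val_ne (by simp [i])
  have hj : j ≠ 0 := Fin.ne_of_val_ne (by simp [j])
  have h6 := h N hij
  rw [withEnds_gridEval_eq g hi, withEnds_gridEval_eq g hj] at h6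
  have h7 : s ≤ grid N i := Subtype.coe_le_coe.1 (by
    simp only [grid, i]
    rw [le_div_iff₀ hN0]
    push_cast
    linarith)
  have h8 : grid N j ≤ t := Subtype.coe_le_coe.1 (by
    simp only [grid, j]
    rw [div_le_iff₀ hN0]
    push_cast
    linarith)
  exact (g.mono h7).trans_lt ((Subtype.coe_lt_coe.1 h6).trans_le (g.mono h8))

theorem IsDirichletProcess.ae_strictMono {β : ℝ} {Q : Measure G0} (hQ : IsDirichletProcess β Q) :
    ∀ᵐ g ∂Q, StrictMono g.toFun := by
  have h : ∀ᵐ g ∂Q, ∀ N, gridEval N g ∈ openSimplex N := by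
    refine ae_all_iff.2 fun N => ?_
    have hm := (measurableSet_openSimplex N).compl
    have h1 := hQ.lintegral_gridEval N (F := (openSimplex N)ᶜ.indicator 1)
      (measurable_one.indicator hm)
    rw [lintegral_dirichletMeasure (measurable_one.indicator hm)] at h1
    have h2 : ∫⁻ x in openSimplex N, ENNReal.ofReal (dirichletDensity β (grid N) x) *
        (openSimplex N)ᶜ.indicator (1 : (Fin N → ℝ) → ℝ≥0∞) x = 0 := by
      rw [setLIntegral_congr_fun (g := fun _ => 0) (measurableSet_openSimplex N)
        (fun x hx => by simp [hx])]
      simp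
    have hm' : Measurable fun g => (openSimplex N)ᶜ.indicator (1 : (Fin N → ℝ) → ℝ≥0∞)
        (gridEval N g) := (measurable_one.indicator hm).comp (measurable_gridEval N)
    rw [h2, lintegral_eq_zero_iff hm'] at h1
    filter_upwards [h1] with g hg
    by_contra hcon
    simp [hcon] at hg
  exact h.mono fun g => strictMono_of_gridEval

/-! ### Totality of the test directions -/

theorem integrable_H_mul_comp (w : H) (g : G0) {ψ : ℝ → ℝ} (hψ : Continuous ψ) :
    Integrable (fun t : I => w t * ψ (g t)) volume := by
  obtain ⟨C, -, hC⟩ := exists_bound_Icc hψ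
  exact (integrable_H w).mul_bdd (c := C) (g.aestronglyMeasurable_comp hψ)
    (Eventually.of_forall fun t => g.abs_comp_le hC t)

theorem inner_compH (w : H) (g : G0) {ψ : ℝ → ℝ} (hψ : Continuous ψ) :
    inner ℝ w (g.compH ψ) = ∫ t : I, w t * ψ (g t) := by
  rw [inner_H]
  refine integral_congr_ae ?_
  filter_upwards [g.compH_ae hψ] with t ht
  rw [ht]

/-- The functions `x ↦ x ^ (k + 1) * (1 - x)`. -/
def testFun (k : ℕ) (x : ℝ) : ℝ := x ^ (k + 1) * (1 - x)

theorem contDiff_testFun (k : ℕ) : ContDiff ℝ 2 (testFun k) := by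
  unfold testFun; fun_prop

theorem integral_polynomial_eq_zero {w : H} {g : G0}
    (h : ∀ k, inner ℝ w (g.compH (testFun k)) = 0) (p : Polynomial ℝ) :
    ∫ t : I, w t * ((g t : ℝ) * (1 - g t) * p.eval (g t : ℝ)) = 0 := by
  induction p using Polynomial.induction_on' with
  | add p q hp hq =>
    have i1 := integrable_H_mul_comp w g (ψ := fun x => x * (1 - x) * p.eval x) (by fun_prop)
    have i2 := integrable_H_mul_comp w g (ψ := fun x => x * (1 - x) * q.eval x) (by fun_prop)
    rw [← add_zero (0 : ℝ)]
    nth_rewrite 1 [← hp]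
    rw [← hq, ← integral_add i1 i2]
    refine integral_congr_ae (Eventually.of_forall fun t => ?_)
    simp only [Polynomial.eval_add]
    ring
  | monomial k a =>
    have h1 := h k
    rw [inner_compH w g (contDiff_testFun k).continuous] at h1
    rw [← mul_zero a, ← h1, ← integral_const_mul]
    refine integral_congr_ae (Eventually.of_forall fun t => ?_)
    simp only [Polynomial.eval_monomial, testFun]
    ring

theorem integral_continuous_eq_zero {w : H} {g : G0}
    (h : ∀ k, inner ℝ w (g.compH (testFun k)) = 0) {ψ : ℝ → ℝ} (hψ : Continuous ψ) :
    ∫ t : I, w t * ((g t : ℝ) * (1 - g t) * ψ (g t)) = 0 := by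
  refine abs_eq_zero.1 (le_antisymm (le_of_forall_pos_le_add fun ε hε => ?_) (abs_nonneg _))
  set A := ∫ t : I, ‖w t‖ with hA
  have hA0 : 0 ≤ A := integral_nonneg fun t => norm_nonneg _
  obtain ⟨p, hp⟩ := exists_polynomial_near_of_continuousOn 0 1 ψ hψ.continuousOn (ε / (A + 1))
    (by positivity)
  have i1 := integrable_H_mul_comp w g (ψ := fun x => x * (1 - x) * p.eval x) (by fun_prop)
  have i2 := integrable_H_mul_comp w g (ψ := fun x => x * (1 - x) * ψ x) (by fun_prop)
  have h1 := integral_polynomial_eq_zero h p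
  rw [← sub_zero (∫ t : I, w t * ((g t : ℝ) * (1 - g t) * ψ (g t))), zero_add, ← h1, ← integral_sub i2 i1,
    ← Real.norm_eq_abs]
  have h2 : ‖∫ t : I, (w t * ((g t : ℝ) * (1 - g t) * ψ (g t)) -
      w t * ((g t : ℝ) * (1 - g t) * p.eval (g t : ℝ)))‖ ≤ ∫ t : I, ‖w t‖ * (ε / (A + 1)) := by
    refine norm_integral_le_of_norm_le ((integrable_H w).norm.mul_const _)
      (Eventually.of_forall fun t => ?_)
    have e : w t * ((g t : ℝ) * (1 - g t) * ψ (g t)) - w t * ((g t : ℝ) * (1 - g t) * p.eval (g t : ℝ))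
        = w t * (((g t : ℝ) * (1 - g t)) * (ψ (g t) - p.eval (g t : ℝ))) := by ring
    rw [e, norm_mul]
    refine mul_le_mul_of_nonneg_left ?_ (norm_nonneg _)
    rw [norm_mul, ← one_mul (ε / (A + 1))]
    refine mul_le_mul ?_ ?_ (norm_nonneg _) zero_le_one
    · have h3 := (g t).2.1
      have h4 := (g t).2.2
      rw [Real.norm_of_nonneg (mul_nonneg h3 (by linarith))]
      nlinarith
    · rw [Real.norm_eq_abs, abs_sub_comm]
      exact (hp _ (g t).2).le
  refine h2.trans ?_
  rw [integral_mul_const, ← hA, mul_div_assoc', div_le_iff₀ (by positivity)]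
  nlinarith

/-- By Weierstrass approximation, `w` is orthogonal to `g (1 - g) ψ(g)` for every continuous `ψ`.
Choose ramps `ψ` converging to the indicator function of `[g s, ∞[`; since `g` is strictly
increasing, composition with `g` yields the indicator function of `[s,1]`. The weight `g (1 - g)`
can vanish only at the endpoints of `[0,1]`. -/
theorem H_eq_zero_of_testFun {w : H} {g : G0} (hg : StrictMono g.toFun)
    (h : ∀ k, inner ℝ w (g.compH (testFun k)) = 0) : w = 0 := by
  have hint : Integrable (fun t : I => w t * ((g t : ℝ) * (1 - g t))) volume :=
    integrable_H_mul_comp w g (ψ := fun x => x * (1 - x)) (by fun_prop)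
  have key : (fun t : I => w t * ((g t : ℝ) * (1 - g t))) =ᵐ[volume] 0 := by
    refine ae_eq_zero_of_setIntegral_Ici hint fun s => ?_
    let ψ : ℕ → ℝ → ℝ := fun n x => max 0 (min 1 (1 + n * (x - g s)))
    have hψ : ∀ n, Continuous (ψ n) := fun n => by fun_prop
    have hlim : Tendsto (fun n => ∫ t : I, w t * ((g t : ℝ) * (1 - g t) * ψ n (g t))) atTop
        (𝓝 (∫ t : I, (Ici s).indicator (fun t : I => w t * ((g t : ℝ) * (1 - g t))) t)) := by
      refine tendsto_integral_of_dominated_convergence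
        (fun t => ‖w t * ((g t : ℝ) * (1 - g t))‖)
        (fun n => (integrable_H_mul_comp w g (ψ := fun x => x * (1 - x) * ψ n x)
          (by fun_prop)).1) hint.norm
        (fun n => Eventually.of_forall fun t => ?_) (Eventually.of_forall fun t => ?_)
      · rw [← mul_assoc, norm_mul]
        refine mul_le_of_le_one_right (norm_nonneg _) ?_
        rw [Real.norm_of_nonneg (le_max_left _ _)]
        exact max_le zero_le_one (min_le_left _ _)
      · by_cases hts : s ≤ t
        · rw [indicator_of_mem (mem_Ici.2 hts)]
          refine tendsto_const_nhds.congr fun n => ?_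
          have h1 : (g s : ℝ) ≤ g t := g.mono hts
          have : ψ n (g t) = 1 := by
            simp only [ψ]
            rw [min_eq_left, max_eq_right zero_le_one]
            have : (0 : ℝ) ≤ n * ((g t : ℝ) - g s) := mul_nonneg n.cast_nonneg (by linarith)
            linarith
          rw [this, mul_one]
        · rw [indicator_of_notMem (by simpa using hts)]
          have h1 : (g t : ℝ) < g s := hg (not_le.1 hts)
          obtain ⟨N, hN⟩ := exists_nat_gt (1 / ((g s : ℝ) - g t))
          refine tendsto_const_nhds.congr' ?_
          filter_upwards [eventually_ge_atTop N] with n hn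
          have h2 : (N : ℝ) ≤ n := by exact_mod_cast hn
          rw [div_lt_iff₀ (by linarith)] at hN
          have : ψ n (g t) = 0 := by
            simp only [ψ]
            refine max_eq_left ((min_le_right _ _).trans ?_)
            nlinarith
          rw [this, mul_zero, mul_zero]
    simp only [integral_continuous_eq_zero h (hψ _)] at hlim
    rw [← integral_indicator measurableSet_Ici]
    exact (tendsto_nhds_unique hlim tendsto_const_nhds)
  refine Lp.ext ?_
  have h01 : ∀ᵐ t : I, t ∉ ({0, 1} : Set I) := ((countable_singleton 1).insert 0).ae_notMem _
  filter_upwards [key, h01, Lp.coeFn_zero ℝ 2 (volume : Measure I)] with t ht h1 h0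
  simp only [mem_insert_iff, mem_singleton_iff, not_or] at h1
  rw [h0, Pi.zero_apply]
  have p0 : (0 : ℝ) < g t :=
    lt_of_le_of_lt (g 0).2.1 (hg (lt_of_le_of_ne t.2.1 fun h => h1.1 h.symm : (0 : I) < t))
  have p1 : (g t : ℝ) < 1 :=
    lt_of_lt_of_le (hg (lt_of_le_of_ne t.2.2 h1.2 : t < 1)) (g 1).2.2
  simp only [Pi.zero_apply, mul_eq_zero] at ht
  rcases ht with ht | ht | ht
  · exact ht
  · linarith
  · linarith

/-! ### Functions on `𝒢₀` are determined by trigonometric functionals -/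

/-- The measures with densities `w⁺` and `w⁻`, pushed to the Hilbert space `L²`, have the same
characteristic function, so they coincide there. -/
theorem ae_eq_zero_of_trig {Q : Measure G0} [IsFiniteMeasure Q] {w : G0 → ℝ} (hw : Integrable w Q)
    (hc : ∀ f : H, ∫ g, Real.cos (linFun f g) * w g ∂Q = 0)
    (hs : ∀ f : H, ∫ g, Real.sin (linFun f g) * w g ∂Q = 0) : w =ᵐ[Q] 0 := by
  let _ : MeasurableSpace H := borel H
  have : BorelSpace H := ⟨rfl⟩
  have hm : Measurable G0.toL2 := G0.continuous_toL2.measurable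
  have f1 : IsFiniteMeasure (Q.withDensity fun g => ENNReal.ofReal (w g)) :=
    isFiniteMeasure_withDensity_ofReal hw.2
  have f2 : IsFiniteMeasure (Q.withDensity fun g => ENNReal.ofReal (-w g)) :=
    isFiniteMeasure_withDensity_ofReal hw.neg.2
  have hchar : ∀ {v : G0 → ℝ}, Integrable v Q → ∀ f : H,
      charFun ((Q.withDensity fun g => ENNReal.ofReal (v g)).map G0.toL2) f =
        ∫ g, ((max (v g) 0 : ℝ) : ℂ) * Complex.exp (linFun f g * Complex.I) ∂Q := by
    intro v hv f
    have hcont : Continuous fun x : H => Complex.exp ((inner ℝ x f : ℝ) * Complex.I) := by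
      fun_prop
    rw [charFun_apply, integral_map hm.aemeasurable hcont.aestronglyMeasurable,
      integral_withDensity_eq_integral_toReal_smul₀ hv.1.aemeasurable.ennreal_ofReal
        (Eventually.of_forall fun _ => ENNReal.ofReal_lt_top)]
    refine integral_congr_ae (Eventually.of_forall fun g => ?_)
    simp only [linFun_eq, real_inner_comm, ENNReal.toReal_ofReal', Complex.real_smul]
  have hint : ∀ {v : G0 → ℝ}, Integrable v Q → ∀ f : H,
      Integrable (fun g => ((max (v g) 0 : ℝ) : ℂ) * Complex.exp (linFun f g * Complex.I)) Q := by
    intro v hv f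
    refine hv.pos_part.ofReal.mul_bdd (c := 1) ?_ (Eventually.of_forall fun g => ?_)
    · have := (reg_linFun f).cont
      exact (by fun_prop : Continuous fun g => Complex.exp (linFun f g * Complex.I)).aestronglyMeasurable
    · rw [Complex.norm_exp_ofReal_mul_I]
  have key : (Q.withDensity fun g => ENNReal.ofReal (w g)).map G0.toL2 =
      (Q.withDensity fun g => ENNReal.ofReal (-w g)).map G0.toL2 := by
    refine Measure.ext_of_charFun (funext fun f => ?_)
    rw [hchar hw f, hchar (v := fun g => -w g) hw.neg f, ← sub_eq_zero,
      ← integral_sub (hint hw f) (hint (v := fun g => -w g) hw.neg f)]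
    have hcf := (reg_linFun f).cont
    have ic : Integrable (fun g => Real.cos (linFun f g) * w g) Q :=
      hw.bdd_mul (c := 1) (Real.continuous_cos.comp hcf).aestronglyMeasurable
        (Eventually.of_forall fun g => Real.abs_cos_le_one _)
    have is : Integrable (fun g => Real.sin (linFun f g) * w g) Q :=
      hw.bdd_mul (c := 1) (Real.continuous_sin.comp hcf).aestronglyMeasurable
        (Eventually.of_forall fun g => Real.abs_sin_le_one _)
    have e : ∀ g, ((max (w g) 0 : ℝ) : ℂ) * Complex.exp (linFun f g * Complex.I) -
        ((max (-w g) 0 : ℝ) : ℂ) * Complex.exp (linFun f g * Complex.I) =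
        ((Real.cos (linFun f g) * w g : ℝ) : ℂ) +
          ((Real.sin (linFun f g) * w g : ℝ) : ℂ) * Complex.I := fun g => by
      have e1 : max (w g) 0 - max (-w g) 0 = w g := by
        rcases le_total 0 (w g) with hx | hx
        · rw [max_eq_left hx, max_eq_right (by linarith)]; ring
        · rw [max_eq_right hx, max_eq_left (by linarith)]; ring
      rw [← sub_mul, ← Complex.ofReal_sub, e1, Complex.exp_mul_I]
      push_cast
      ring
    rw [integral_congr_ae (Eventually.of_forall e),
      integral_add ic.ofReal (is.ofReal.mul_const _), integral_mul_const, integral_complex_ofReal,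
      integral_complex_ofReal, hc f, hs f]
    simp
  have hQ : (Q.withDensity fun g => ENNReal.ofReal (w g)) =
      Q.withDensity fun g => ENNReal.ofReal (-w g) := by
    refine Measure.ext fun A hA => ?_
    -- Equality of the image measures suffices because `𝒢₀` has the topology induced from `L²`: its
    -- Borel sets are the preimages of Borel sets.
    have h1 : borel G0 = (borel H).comap G0.toL2 := by
      rw [G0.isometry_toL2.isEmbedding.eq_induced]
      exact borel_comap
    have hA' : MeasurableSet[(borel H).comap G0.toL2] A := h1 ▸ hA
    obtain ⟨B, hB, rfl⟩ := hA'
    rw [← Measure.map_apply hm hB, key, Measure.map_apply hm hB]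
  have h2 := (withDensity_eq_iff hw.aemeasurable.ennreal_ofReal
    hw.neg.aemeasurable.ennreal_ofReal hw.lintegral_lt_top.ne).1 hQ
  filter_upwards [h2] with g ht
  simp only [Pi.neg_apply] at ht
  rw [Pi.zero_apply]
  rcases le_total (w g) 0 with h1 | h1
  · rw [ENNReal.ofReal_of_nonpos h1, eq_comm, ENNReal.ofReal_eq_zero] at ht
    linarith
  · rw [ENNReal.ofReal_of_nonpos (by linarith : -w g ≤ 0), ENNReal.ofReal_eq_zero] at ht
    linarith

/-! ### Closability -/

theorem Reg.memLp {u : G0 → ℝ} {V : G0 → H} (h : Reg u V) (Q : Measure G0) [IsFiniteMeasure Q] :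
    MemLp u 2 Q := by
  obtain ⟨C, -, hC⟩ := h.bdd
  exact memLp_of_bounded h.cont.aestronglyMeasurable fun g => (hC g).1

theorem Reg.memLp_grad {u : G0 → ℝ} {V : G0 → H} (h : Reg u V) (Q : Measure G0)
    [IsFiniteMeasure Q] : MemLp V 2 Q := by
  obtain ⟨C, -, hC⟩ := h.bdd
  exact memLp_of_bounded h.cont_grad.aestronglyMeasurable fun g => (hC g).2

theorem integral_norm_le_eLpNorm_two {X : Type*} [MeasurableSpace X] {Q : Measure X}
    [IsProbabilityMeasure Q] {u : X → ℝ} (hu : MemLp u 2 Q) :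
    ∫ g, ‖u g‖ ∂Q ≤ (eLpNorm u 2 Q).toReal := by
  rw [integral_norm_eq_lintegral_enorm hu.1, ← eLpNorm_one_eq_lintegral_enorm]
  exact ENNReal.toReal_mono hu.2.ne (eLpNorm_le_eLpNorm_of_exponent_le (by norm_num) hu.1)

/-- The integration by parts estimate is applied to `u v`; the term `u ⟪Dv, φ ∘ g⟫` of the product
rule is moved to the other side. The constant depends on `v` and `k`, but not on `u`. -/
theorem IsDirichletProcess.exists_weighted_bound {β : ℝ} {Q : Measure G0}
    (hQ : IsDirichletProcess β Q) (hβ : 0 < β) (k : ℕ) {v : G0 → ℝ} {Y : G0 → H} (hv : Reg v Y) :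
    ∃ c : ℝ, ∀ (u : G0 → ℝ) (V : G0 → H), Reg u V →
      |∫ g, inner ℝ (v g • g.compH (testFun k)) (V g) ∂Q| ≤ c * ∫ g, ‖u g‖ ∂Q := by
  have := hQ.isProbabilityMeasure
  obtain ⟨c, hc0, hc⟩ := hQ.exists_ibp_bound hβ (contDiff_testFun k) (by simp [testFun])
    (by simp [testFun])
  obtain ⟨C, hC0, hC⟩ := hv.bdd
  obtain ⟨K, hK0, hK⟩ := exists_bound_Icc (contDiff_testFun k).continuous
  have hφ : Continuous (G0.compH (testFun k)) :=
    G0.continuous_compH (contDiff_testFun k).continuous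
  have hφK : ∀ g : G0, ‖g.compH (testFun k)‖ ≤ K := fun g => norm_toH_le hK0 (g.abs_comp_le hK)
  refine ⟨c * C + C * K, fun u V hu => ?_⟩
  obtain ⟨D, hD0, hD⟩ := hu.bdd
  have iu : Integrable u Q := (hu.memLp Q).integrable (by norm_num)
  have h1 := hc _ _ (hu.mul hv)
  have bound : ∀ {F : G0 → ℝ} {b : ℝ}, Continuous F → (∀ g, ‖F g‖ ≤ b) → Integrable F Q :=
    fun hF hb => Integrable.of_bound hF.aestronglyMeasurable _ (Eventually.of_forall hb)
  have i1 : Integrable (fun g => u g * inner ℝ (Y g) (g.compH (testFun k))) Q := by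
    refine bound (b := D * (C * K)) (hu.cont.mul (hv.cont_grad.inner hφ)) fun g => ?_
    rw [norm_mul]
    refine mul_le_mul (hD g).1 ((norm_inner_le_norm _ _).trans ?_) (norm_nonneg _) hD0
    exact mul_le_mul (hC g).2 (hφK g) (norm_nonneg _) hC0
  have i2 : Integrable (fun g => inner ℝ (v g • g.compH (testFun k)) (V g)) Q := by
    refine bound (b := (C * K) * D) ((hv.cont.smul hφ).inner hu.cont_grad) fun g => ?_
    refine (norm_inner_le_norm _ _).trans ?_
    rw [norm_smul]
    exact mul_le_mul (mul_le_mul (hC g).1 (hφK g) (norm_nonneg _) hC0) (hD g).2 (norm_nonneg _)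
      (by positivity)
  have e : ∀ g, inner ℝ ((u • Y + v • V) g) (g.compH (testFun k)) =
      u g * inner ℝ (Y g) (g.compH (testFun k)) +
        inner ℝ (v g • g.compH (testFun k)) (V g) := fun g => by
    rw [Pi.add_apply, Pi.smul_apply', Pi.smul_apply', inner_add_left, real_inner_smul_left,
      real_inner_smul_left, real_inner_smul_left, real_inner_comm (V g)]
  rw [integral_congr_ae (Eventually.of_forall e), integral_add i1 i2] at h1
  have h2 : |∫ g, u g * inner ℝ (Y g) (g.compH (testFun k)) ∂Q| ≤ C * K * ∫ g, ‖u g‖ ∂Q := by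
    rw [← integral_const_mul, ← Real.norm_eq_abs]
    refine norm_integral_le_of_norm_le (iu.norm.const_mul _) (Eventually.of_forall fun g => ?_)
    rw [norm_mul, mul_comm]
    refine mul_le_mul_of_nonneg_right ((norm_inner_le_norm _ _).trans ?_) (norm_nonneg _)
    exact mul_le_mul (hC g).2 (hφK g) (norm_nonneg _) hC0
  have h3 : ∫ g, ‖(u * v) g‖ ∂Q ≤ C * ∫ g, ‖u g‖ ∂Q := by
    rw [← integral_const_mul]
    refine integral_mono_of_nonneg (Eventually.of_forall fun g => norm_nonneg _)
      (iu.norm.const_mul _) (Eventually.of_forall fun g => ?_)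
    simp only [Pi.mul_apply]
    rw [norm_mul, mul_comm]
    exact mul_le_mul_of_nonneg_right (hC g).1 (norm_nonneg _)
  have h4 := mul_le_mul_of_nonneg_left h3 hc0
  rw [abs_le] at *
  constructor <;> linarith

/-- Pairing `Duₙ` with the bounded field `v (φ ∘ g)` is continuous in `L²` and tends to `0` by the
weighted bound, so `W` is orthogonal to all such fields. Varying `v` over trigonometric functionals
localises this to almost every `g`. The test functions are countably many, which permits one common
null set. -/
theorem IsDirichletProcess.closable {β : ℝ} {Q : Measure G0} (hQ : IsDirichletProcess β Q)
    (hβ : 0 < β) {u : ℕ → G0 → ℝ} {V : ℕ → G0 → H} (hu : ∀ n, Reg (u n) (V n))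
    (h0 : Tendsto (fun n => eLpNorm (u n) 2 Q) atTop (𝓝 0)) {P : ℕ → Lp H 2 Q}
    (hP : ∀ n, P n =ᵐ[Q] V n) {W : Lp H 2 Q} (hW : Tendsto P atTop (𝓝 W)) : W = 0 := by
  have := hQ.isProbabilityMeasure
  have h1 : Tendsto (fun n => ∫ g, ‖u n g‖ ∂Q) atTop (𝓝 0) := by
    refine squeeze_zero (fun n => integral_nonneg fun g => norm_nonneg _)
      (fun n => integral_norm_le_eLpNorm_two ((hu n).memLp Q)) ?_
    simpa [Function.comp_def] using (ENNReal.tendsto_toReal ENNReal.zero_ne_top).comp h0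
  have hφ : ∀ k, Continuous (G0.compH (testFun k)) := fun k =>
    G0.continuous_compH (contDiff_testFun k).continuous
  have hφK : ∀ k, ∃ K, 0 ≤ K ∧ ∀ g : G0, ‖g.compH (testFun k)‖ ≤ K := fun k => by
    obtain ⟨K, hK0, hK⟩ := exists_bound_Icc (contDiff_testFun k).continuous
    exact ⟨K, hK0, fun g => norm_toH_le hK0 (g.abs_comp_le hK)⟩
  have key : ∀ (k : ℕ) (v : G0 → ℝ) (Y : G0 → H), Reg v Y →
      ∫ g, v g * inner ℝ (W g) (g.compH (testFun k)) ∂Q = 0 := by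
    intro k v Y hv
    obtain ⟨c, hc⟩ := hQ.exists_weighted_bound hβ k hv
    obtain ⟨C, hC0, hC⟩ := hv.bdd
    obtain ⟨K, hK0, hK⟩ := hφK k
    have hm : MemLp (fun g => v g • g.compH (testFun k)) 2 Q := by
      refine memLp_of_bounded (C := C * K) (hv.cont.smul (hφ k)).aestronglyMeasurable fun g => ?_
      rw [norm_smul]
      exact mul_le_mul (hC g).1 (hK g) (norm_nonneg _) hC0
    have h2 : Tendsto (fun n => inner ℝ (hm.toLp _) (P n)) atTop (𝓝 (inner ℝ (hm.toLp _) W)) :=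
      tendsto_const_nhds.inner hW
    have h3 : Tendsto (fun n => inner ℝ (hm.toLp _) (P n)) atTop (𝓝 0) := by
      have h4 := h1.const_mul c
      rw [mul_zero] at h4
      refine squeeze_zero_norm (fun n => ?_) h4
      rw [L2.inner_def, Real.norm_eq_abs]
      refine le_trans (le_of_eq ?_) (hc _ _ (hu n))
      congr 1
      refine integral_congr_ae ?_
      filter_upwards [hm.coeFn_toLp, hP n] with g e1 e2
      rw [e1, e2]
    rw [← tendsto_nhds_unique h2 h3, L2.inner_def]
    refine integral_congr_ae ?_
    filter_upwards [hm.coeFn_toLp] with g e1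
    rw [e1, real_inner_smul_left, real_inner_comm]
  have hz : ∀ k, (fun g => inner ℝ (W g) (g.compH (testFun k))) =ᵐ[Q] 0 := fun k => by
    obtain ⟨K, hK0, hK⟩ := hφK k
    have iW : Integrable W Q := (Lp.memLp W).integrable (by norm_num)
    refine ae_eq_zero_of_trig ?_ (fun f => ?_) (fun f => ?_)
    · refine (iW.norm.mul_const K).mono (iW.1.inner (hφ k).aestronglyMeasurable)
        (Eventually.of_forall fun g => ?_)
      rw [norm_mul, norm_norm, Real.norm_of_nonneg hK0]
      exact (norm_inner_le_norm _ _).trans (mul_le_mul_of_nonneg_left (hK g) (norm_nonneg _))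
    · exact key k _ _ ((reg_linFun f).comp_one Real.contDiff_cos)
    · exact key k _ _ ((reg_linFun f).comp_one Real.contDiff_sin)
  refine Lp.ext ?_
  filter_upwards [ae_all_iff.2 hz, hQ.ae_strictMono, Lp.coeFn_zero H 2 Q] with g h2 h3 h4
  rw [h4, Pi.zero_apply]
  exact H_eq_zero_of_testFun h3 h2

/-! ### Classes of functions closed under composition -/

/-- A class of functions with bounded continuous gradients, closed under `C¹` compositions. -/
structure GradClass (𝓓 : Set (G0 → ℝ)) : Prop where
  reg : ∀ u ∈ 𝓓, Reg u (grad u)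
  comp : ∀ {ι : Type} [Fintype ι] {U : (ι → ℝ) → ℝ}, ContDiff ℝ 1 U →
    ∀ {u : ι → G0 → ℝ}, (∀ i, u i ∈ 𝓓) → (fun g => U (fun i => u i g)) ∈ 𝓓

/-- Used to flatten a family of families of arguments into one, so that a `C¹` function of cylinder
functions is again a cylinder function. -/
theorem contDiff_sigma_comp {ι : Type} [Fintype ι] {m : ι → ℕ} {n : ℕ}
    (e : (Σ i, Fin (m i)) → Fin n) {U : (ι → ℝ) → ℝ} (hU : ContDiff ℝ 1 U)
    {U' : ∀ i, (Fin (m i) → ℝ) → ℝ} (hU' : ∀ i, ContDiff ℝ 1 (U' i)) :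
    ContDiff ℝ 1 fun y : Fin n → ℝ => U (fun i => U' i (fun j => y (e ⟨i, j⟩))) :=
  hU.comp (contDiff_pi.2 fun i => (hU' i).comp (contDiff_pi.2 fun _ => contDiff_apply ℝ ℝ _))

theorem gradClass_C1 : GradClass C1 where
  reg := by
    rintro u ⟨m, U, f, hU, rfl⟩
    have := reg_cylFun hU f
    rwa [← this.grad_eq] at this
  comp {ι} _ U hU u hu := by
    choose m U' f hU' hu' using hu
    let e := Fintype.equivFin (Σ i, Fin (m i))
    refine ⟨_, _, fun k => f (e.symm k).1 (e.symm k).2, contDiff_sigma_comp e hU hU', ?_⟩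
    funext g
    simp only [hu', cylFun]
    congr 1; funext i; congr 1; funext j
    rw [e.symm_apply_apply]

theorem gradClass_Z1 : GradClass Z1 where
  reg := by
    rintro u ⟨m, U, α, hU, hα, rfl⟩
    obtain ⟨a, -, -, h3, -, -, h6⟩ := exists_reg_zylFun hU hα
    rw [h3]
    rwa [← h6.grad_eq] at h6
  comp {ι} _ U hU u hu := by
    choose m U' α hU' hα hu' using hu
    let e := Fintype.equivFin (Σ i, Fin (m i))
    refine ⟨_, _, fun k => α (e.symm k).1 (e.symm k).2, contDiff_sigma_comp e hU hU',
      fun k => hα _ _, ?_⟩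
    funext g
    simp only [hu', zylFun]
    congr 1; funext i; congr 1; funext j
    rw [e.symm_apply_apply]

namespace GradClass

variable {𝓓 : Set (G0 → ℝ)}

theorem comp_one (h : GradClass 𝓓) {U : ℝ → ℝ} (hU : ContDiff ℝ 1 U) {u : G0 → ℝ} (hu : u ∈ 𝓓) :
    (fun g => U (u g)) ∈ 𝓓 :=
  h.comp (ι := Unit) (U := fun y => U (y ())) (hU.comp (contDiff_apply ℝ ℝ ())) (fun _ => hu)

theorem add_mem (h : GradClass 𝓓) {u v : G0 → ℝ} (hu : u ∈ 𝓓) (hv : v ∈ 𝓓) : u + v ∈ 𝓓 :=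
  h.comp (ι := Bool) (U := fun y => y true + y false)
    ((contDiff_apply ℝ ℝ true).add (contDiff_apply ℝ ℝ false))
    (u := fun b => if b then u else v) (fun b => by cases b <;> simpa)

theorem smul_mem (h : GradClass 𝓓) (c : ℝ) {u : G0 → ℝ} (hu : u ∈ 𝓓) : c • u ∈ 𝓓 :=
  h.comp_one (U := fun y => c * y) (by fun_prop) hu

theorem zero_mem (h : GradClass 𝓓) : (0 : G0 → ℝ) ∈ 𝓓 :=
  h.comp (ι := Empty) (U := fun _ => 0) contDiff_const (u := fun i => i.elim) (fun i => i.elim)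

theorem sub_mem (h : GradClass 𝓓) {u v : G0 → ℝ} (hu : u ∈ 𝓓) (hv : v ∈ 𝓓) : u - v ∈ 𝓓 := by
  have := h.add_mem hu (h.smul_mem (-1) hv)
  rwa [neg_one_smul, ← sub_eq_add_neg] at this

theorem grad_add (h : GradClass 𝓓) {u v : G0 → ℝ} (hu : u ∈ 𝓓) (hv : v ∈ 𝓓) :
    grad (u + v) = grad u + grad v := ((h.reg u hu).add (h.reg v hv)).grad_eq

theorem grad_sub (h : GradClass 𝓓) {u v : G0 → ℝ} (hu : u ∈ 𝓓) (hv : v ∈ 𝓓) :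
    grad (u - v) = grad u - grad v := ((h.reg u hu).sub (h.reg v hv)).grad_eq

theorem grad_smul (h : GradClass 𝓓) (c : ℝ) {u : G0 → ℝ} (hu : u ∈ 𝓓) :
    grad (c • u) = c • grad u := ((h.reg u hu).smul c).grad_eq

/-- The graph of the gradient on a class of functions, as a subspace. -/
def graph (h : GradClass 𝓓) (Q : Measure G0) : Submodule ℝ (Lp ℝ 2 Q × Lp H 2 Q) where
  carrier := gradGraph Q 𝓓
  add_mem' := by
    rintro p q ⟨u, hu, hp1, hp2⟩ ⟨v, hv, hq1, hq2⟩
    refine ⟨u + v, h.add_mem hu hv, (Lp.coeFn_add _ _).trans (hp1.add hq1), ?_⟩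
    rw [h.grad_add hu hv]
    exact (Lp.coeFn_add _ _).trans (hp2.add hq2)
  zero_mem' := by
    refine ⟨0, h.zero_mem, Lp.coeFn_zero _ _ _, ?_⟩
    have := h.grad_smul 0 h.zero_mem
    rw [zero_smul, zero_smul] at this
    rw [this]
    exact Lp.coeFn_zero _ _ _
  smul_mem' := by
    rintro c p ⟨u, hu, hp1, hp2⟩
    refine ⟨c • u, h.smul_mem c hu, (Lp.coeFn_smul _ _).trans (hp1.const_smul c), ?_⟩
    rw [h.grad_smul c hu]
    exact (Lp.coeFn_smul _ _).trans (hp2.const_smul c)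

theorem coe_graph (h : GradClass 𝓓) (Q : Measure G0) :
    (h.graph Q : Set (Lp ℝ 2 Q × Lp H 2 Q)) = gradGraph Q 𝓓 := rfl

theorem span_gradGraph (h : GradClass 𝓓) (Q : Measure G0) :
    Submodule.span ℝ (gradGraph Q 𝓓) = h.graph Q := by
  rw [← h.coe_graph, Submodule.span_eq]

end GradClass

/-! ### Bounded pointwise approximation -/

/-- `(u, V)` is the limit, boundedly and almost everywhere, of a sequence of functions in `𝓓` with
their gradients. -/
def Approx (Q : Measure G0) (𝓓 : Set (G0 → ℝ)) (u : G0 → ℝ) (V : G0 → H) : Prop :=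
  ∃ w : ℕ → G0 → ℝ, (∀ n, w n ∈ 𝓓) ∧ (∃ C, ∀ n g, ‖w n g‖ ≤ C ∧ ‖grad (w n) g‖ ≤ C) ∧
    ∀ᵐ g ∂Q, Tendsto (fun n => w n g) atTop (𝓝 (u g)) ∧
      Tendsto (fun n => grad (w n) g) atTop (𝓝 (V g))

theorem Approx.of_mem {Q : Measure G0} {𝓓 : Set (G0 → ℝ)} (h𝓓 : GradClass 𝓓) {u : G0 → ℝ}
    (hu : u ∈ 𝓓) : Approx Q 𝓓 u (grad u) := by
  obtain ⟨C, -, hC⟩ := (h𝓓.reg u hu).bdd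
  exact ⟨fun _ => u, fun _ => hu, ⟨C, fun _ => hC⟩,
    Eventually.of_forall fun g => ⟨tendsto_const_nhds, tendsto_const_nhds⟩⟩

theorem Approx.comp {Q : Measure G0} {𝓓 : Set (G0 → ℝ)} (h𝓓 : GradClass 𝓓) {ι : Type} [Fintype ι]
    [DecidableEq ι] {U : (ι → ℝ) → ℝ} (hU : ContDiff ℝ 1 U) {u : ι → G0 → ℝ} {V : ι → G0 → H}
    (h : ∀ i, Approx Q 𝓓 (u i) (V i)) :
    Approx Q 𝓓 (fun g => U (fun i => u i g))
      (fun g => chainGrad U (fun i => u i g) (fun i => V i g)) := by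
  choose w hw hC hlim using h
  obtain ⟨C, -, hC⟩ := exists_common_bound
    (p := fun i C => ∀ n g, ‖w i n g‖ ≤ C ∧ ‖grad (w i n) g‖ ≤ C)
    (fun i C D hCD h n g => ⟨(h n g).1.trans hCD, (h n g).2.trans hCD⟩) hC
  obtain ⟨K, hK0, hK⟩ := exists_chain_bound hU C
  have hg : ∀ n, grad (fun g => U (fun i => w i n g)) =
      fun g => chainGrad U (fun i => w i n g) (fun i => grad (w i n) g) := fun n =>
    (Reg.comp hU fun i => h𝓓.reg _ (hw i n)).grad_eq
  refine ⟨fun n g => U (fun i => w i n g), fun n => h𝓓.comp hU fun i => hw i n,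
    ⟨K, fun n g => ?_⟩, ?_⟩
  · rw [hg]
    exact hK _ _ (fun i => (hC i n g).1) (fun i => (hC i n g).2)
  · filter_upwards [ae_all_iff.2 hlim] with g h1
    have t1 : Tendsto (fun n i => w i n g) atTop (𝓝 fun i => u i g) :=
      tendsto_pi_nhds.2 fun i => (h1 i).1
    have t2 : Tendsto (fun n i => grad (w i n) g) atTop (𝓝 fun i => V i g) :=
      tendsto_pi_nhds.2 fun i => (h1 i).2
    refine ⟨(hU.continuous.tendsto _).comp t1, ?_⟩
    have t3 := (continuous_chainGrad hU).tendsto ((fun i => u i g), (fun i => V i g))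
    have t4 := t3.comp (t1.prodMk_nhds t2)
    simp only [hg]
    exact t4

/-- Bounded convergence almost everywhere implies convergence in `L²`. -/
theorem Lp_tendsto_of_bounded {X E : Type*} [MeasurableSpace X] {μ : Measure X}
    [IsFiniteMeasure μ] [NormedAddCommGroup E] {F : ℕ → Lp E 2 μ} {f : Lp E 2 μ} (C : ℝ)
    (hFC : ∀ n, ∀ᵐ x ∂μ, ‖F n x‖ ≤ C)
    (h : ∀ᵐ x ∂μ, Tendsto (fun n => F n x) atTop (𝓝 (f x))) : Tendsto F atTop (𝓝 f) := by
  rw [Lp.tendsto_Lp_iff_tendsto_eLpNorm']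
  refine tendsto_eLpNorm_two_of_bounded C (Eventually.of_forall fun n => (Lp.aestronglyMeasurable _))
    (Lp.aestronglyMeasurable _) (Eventually.of_forall hFC) ?_ h
  filter_upwards [h, ae_all_iff.2 hFC] with x h1 h2
  exact le_of_tendsto' h1.norm h2

theorem GradClass.mem_gradGraph {𝓓 : Set (G0 → ℝ)} (h𝓓 : GradClass 𝓓) (Q : Measure G0)
    [IsFiniteMeasure Q] {u : G0 → ℝ} (hu : u ∈ 𝓓) :
    (((h𝓓.reg u hu).memLp Q).toLp u, ((h𝓓.reg u hu).memLp_grad Q).toLp (grad u)) ∈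
      gradGraph Q 𝓓 :=
  ⟨u, hu, ((h𝓓.reg u hu).memLp Q).coeFn_toLp, ((h𝓓.reg u hu).memLp_grad Q).coeFn_toLp⟩

theorem Approx.mem_closure {Q : Measure G0} [IsFiniteMeasure Q] {𝓓 : Set (G0 → ℝ)}
    (h𝓓 : GradClass 𝓓) {u : G0 → ℝ} {V : G0 → H} (h : Approx Q 𝓓 u V) {p : Lp ℝ 2 Q × Lp H 2 Q}
    (h1 : p.1 =ᵐ[Q] u) (h2 : p.2 =ᵐ[Q] V) : p ∈ closure (gradGraph Q 𝓓) := by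
  obtain ⟨w, hw, ⟨C, hC⟩, hlim⟩ := h
  refine mem_closure_of_tendsto (f := fun n => (((h𝓓.reg _ (hw n)).memLp Q).toLp (w n),
    ((h𝓓.reg _ (hw n)).memLp_grad Q).toLp (grad (w n)))) (b := atTop) ?_
    (Eventually.of_forall fun n => h𝓓.mem_gradGraph Q (hw n))
  have e1 : ∀ᵐ g ∂Q, ∀ n, ((h𝓓.reg _ (hw n)).memLp Q).toLp (w n) g = w n g :=
    ae_all_iff.2 fun n => MemLp.coeFn_toLp _
  have e2 : ∀ᵐ g ∂Q, ∀ n, ((h𝓓.reg _ (hw n)).memLp_grad Q).toLp (grad (w n)) g = grad (w n) g :=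
    ae_all_iff.2 fun n => MemLp.coeFn_toLp _
  refine Prod.tendsto_iff _ _ |>.2 ⟨?_, ?_⟩
  · refine Lp_tendsto_of_bounded C (fun n => ?_) ?_
    · filter_upwards [e1] with g h3
      rw [h3]; exact (hC n g).1
    · filter_upwards [e1, h1, hlim] with g h3 h4 h5
      simp only [h3, h4]; exact h5.1
  · refine Lp_tendsto_of_bounded C (fun n => ?_) ?_
    · filter_upwards [e2] with g h3
      rw [h3]; exact (hC n g).2
    · filter_upwards [e2, h2, hlim] with g h3 h4 h5
      simp only [h3, h4]; exact h5.2

/-- The increment from `h` to `g` is an integral of gradients over the segment. The point `s = 0` is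
left out because the base point `h` used below is not strictly increasing, and gradients need not
converge there. -/
theorem Reg.tendsto_of_grad {u : G0 → ℝ} {V : G0 → H} (hu : Reg u V) {w : ℕ → G0 → ℝ}
    {W : ℕ → G0 → H} (hw : ∀ n, Reg (w n) (W n)) {C : ℝ} (hC : ∀ n g, ‖W n g‖ ≤ C) {h g : G0}
    (hlim : ∀ s : I, 0 < s →
      Tendsto (fun n => W n (h.lerp g s)) atTop (𝓝 (V (h.lerp g s))))
    (h0 : Tendsto (fun n => w n h) atTop (𝓝 (u h))) : Tendsto (fun n => w n g) atTop (𝓝 (u g)) := by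
  have key : Tendsto (fun n => w n g - w n h) atTop (𝓝 (u g - u h)) := by
    simp only [fun n => (hw n).integral_lerp h g, hu.integral_lerp h g]
    have hcl : Continuous fun s : ℝ => h.lerp g (projIcc 0 1 zero_le_one s) :=
      (h.continuous_lerp g).comp continuous_projIcc
    refine intervalIntegral.tendsto_integral_filter_of_dominated_convergence
      (fun _ => C * ‖g.toL2 - h.toL2‖) (Eventually.of_forall fun n => ?_)
      (Eventually.of_forall fun n => Eventually.of_forall fun s _ => ?_)
      intervalIntegrable_const (Eventually.of_forall fun s hs => ?_)
    · have := (hw n).cont_grad.comp hcl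
      exact (this.inner continuous_const).aestronglyMeasurable
    · exact (norm_inner_le_norm _ _).trans (mul_le_mul_of_nonneg_right (hC _ _) (norm_nonneg _))
    · refine Tendsto.inner (hlim _ ?_) tendsto_const_nhds
      rw [uIoc_of_le zero_le_one] at hs
      rw [projIcc_of_mem _ ⟨hs.1.le, hs.2⟩]
      exact hs.1
  have := key.add h0
  simpa using this

/-- `G0.jump 1` represents `0` in `L²` and serves as the base point of segments: all functionals
have an explicit value there. -/
theorem jump_one_ae : ∀ᵐ t : I, (G0.jump 1 t : ℝ) = 0 := by
  have : ∀ᵐ t : I, t ≠ 1 := by simp [ae_iff]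
  filter_upwards [this] with t ht
  have : ¬ (1 : I) ≤ t := fun h => ht (le_antisymm t.2.2 h)
  simp [G0.jump, this]

theorem linFun_jump_one (f : H) : linFun f (G0.jump 1) = 0 := by
  refine integral_eq_zero_of_ae ?_
  filter_upwards [jump_one_ae] with t ht
  rw [ht, mul_zero]; rfl

theorem potFun_jump_one (α : ℝ → ℝ) : potFun α (G0.jump 1) = α 0 := by
  have : potFun α (G0.jump 1) = ∫ _t : I, α 0 := by
    refine integral_congr_ae ?_
    filter_upwards [jump_one_ae] with t ht
    rw [ht]
  rw [this]; simp

theorem reg_const (c : ℝ) : Reg (fun _ => c) (fun _ => 0) where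
  hasGradAt g f γ _ := by simp
  cont := continuous_const
  cont_grad := continuous_const
  bdd := ⟨|c|, abs_nonneg c, fun _ => ⟨le_rfl, by simp⟩⟩

theorem Reg.sum {ι : Type*} (s : Finset ι) {u : ι → G0 → ℝ} {V : ι → G0 → H}
    (h : ∀ i ∈ s, Reg (u i) (V i)) : Reg (∑ i ∈ s, u i) (∑ i ∈ s, V i) := by
  classical
  induction s using Finset.induction_on with
  | empty => exact reg_const 0
  | insert a s ha ih =>
    rw [Finset.sum_insert ha, Finset.sum_insert ha]
    exact (h a (Finset.mem_insert_self _ _)).add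
      (ih fun i hi => h i (Finset.mem_insert_of_mem hi))

/-! ### Approximation of potentials by cylinder functions -/

/-- The intervals of the uniform partition. -/
def cell (N : ℕ) (i : Fin (N + 1)) : Set I := Ico (grid N i.castSucc) (grid N i.succ)

theorem volume_cell (N : ℕ) (i : Fin (N + 1)) : volume.real (cell N i) = 1 / (N + 1) := by
  rw [cell, Measure.real, unitInterval.volume_Ico, ENNReal.toReal_ofReal]
  · simp only [grid, Fin.val_succ, Fin.val_castSucc]
    push_cast
    field_simp
    ring
  · exact sub_nonneg.2 ((grid_strictMono N) (Fin.castSucc_lt_succ (i := i))).le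

theorem mem_cell_iff {N : ℕ} {i : Fin (N + 1)} {t : I} :
    t ∈ cell N i ↔ ⌊((N : ℝ) + 1) * t⌋₊ = i := by
  have hN0 : (0 : ℝ) < (N : ℝ) + 1 := by positivity
  rw [cell, mem_Ico, Nat.floor_eq_iff (mul_nonneg hN0.le t.2.1), ← Subtype.coe_le_coe,
    ← Subtype.coe_lt_coe]
  simp only [grid, Fin.val_succ, Fin.val_castSucc]
  rw [div_le_iff₀ hN0, lt_div_iff₀ hN0, mul_comm (t : ℝ)]
  push_cast
  rfl

theorem exists_mem_cell (N : ℕ) {t : I} (ht : t < 1) : ∃ i, t ∈ cell N i := by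
  have hN0 : (0 : ℝ) < (N : ℝ) + 1 := by positivity
  have ht' : (t : ℝ) < 1 := ht
  refine ⟨⟨⌊((N : ℝ) + 1) * t⌋₊, ?_⟩, mem_cell_iff.2 rfl⟩
  rw [Nat.floor_lt (mul_nonneg hN0.le t.2.1)]
  push_cast
  exact mul_lt_of_lt_one_right hN0 ht'

theorem abs_sub_lt_of_mem_cell {N : ℕ} {i : Fin (N + 1)} {s t : I} (hs : s ∈ cell N i)
    (ht : t ∈ cell N i) : dist s t < 1 / (N + 1) := by
  have h : (grid N i.succ : ℝ) = (grid N i.castSucc : ℝ) + 1 / (N + 1) := by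
    simp only [grid, Fin.val_succ, Fin.val_castSucc]
    push_cast
    ring
  have h1 : (grid N i.castSucc : ℝ) ≤ s := hs.1
  have h2 : (s : ℝ) < grid N i.succ := hs.2
  have h3 : (grid N i.castSucc : ℝ) ≤ t := ht.1
  have h4 : (t : ℝ) < grid N i.succ := ht.2
  rw [Subtype.dist_eq, Real.dist_eq, abs_lt]
  constructor <;> linarith

/-- The indicator function of a cell, as an element of `L²`. -/
def cellH (N : ℕ) (i : Fin (N + 1)) : H := toH ((cell N i).indicator fun _ => 1)

theorem cellH_ae (N : ℕ) (i : Fin (N + 1)) :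
    cellH N i =ᵐ[volume] (cell N i).indicator fun _ => 1 :=
  toH_ae (memLp_of_bounded (C := 1)
    (stronglyMeasurable_const.indicator measurableSet_Ico).aestronglyMeasurable fun t => by
      by_cases h : t ∈ cell N i <;> simp [h])

/-- The average of `g` over a cell. -/
def cellAvg (N : ℕ) (i : Fin (N + 1)) (g : G0) : ℝ := linFun (((N : ℝ) + 1) • cellH N i) g

theorem cellAvg_eq (N : ℕ) (i : Fin (N + 1)) (g : G0) :
    cellAvg N i g = ((N : ℝ) + 1) * ∫ t in cell N i, (g t : ℝ) := by
  have hm : MeasurableSet (cell N i) := measurableSet_Ico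
  rw [← integral_const_mul, ← integral_indicator hm, cellAvg, linFun]
  refine integral_congr_ae ?_
  filter_upwards [Lp.coeFn_smul ((N : ℝ) + 1) (cellH N i), cellH_ae N i] with t h1 h2
  rw [h1, Pi.smul_apply, h2]
  by_cases h : t ∈ cell N i
  · rw [indicator_of_mem h, indicator_of_mem (by exact h)]; simp
  · rw [indicator_of_notMem h, indicator_of_notMem (by exact h)]; simp

theorem abs_cellAvg_sub_le {N : ℕ} {i : Fin (N + 1)} {g : G0} {c ε : ℝ}
    (h : ∀ s ∈ cell N i, ‖(g s : ℝ) - c‖ ≤ ε) : |cellAvg N i g - c| ≤ ε := by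
  have hN0 : (0 : ℝ) < (N : ℝ) + 1 := by positivity
  have hi : IntegrableOn (fun t : I => (g t : ℝ)) (cell N i) :=
    (g.memLp.integrable (by norm_num)).integrableOn
  have e : cellAvg N i g - c = ((N : ℝ) + 1) * ∫ t in cell N i, ((g t : ℝ) - c) := by
    rw [cellAvg_eq, integral_sub hi (integrable_const _), setIntegral_const, volume_cell,
      smul_eq_mul]
    field_simp
  have h1 := norm_setIntegral_le_of_norm_le_const (μ := volume) (measure_lt_top _ (cell N i)) h
  rw [volume_cell, Real.norm_eq_abs] at h1
  rw [e, abs_mul, abs_of_pos hN0]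
  calc _ ≤ ((N : ℝ) + 1) * (ε * (1 / (N + 1))) := by gcongr
    _ = ε := by field_simp

theorem sum_indicator_cell {N : ℕ} {t : I} {i : Fin (N + 1)} (hi : t ∈ cell N i)
    (c : Fin (N + 1) → ℝ) : ∑ j, c j * (cell N j).indicator (fun _ => (1 : ℝ)) t = c i := by
  rw [Finset.sum_eq_single i]
  · simp [hi]
  · intro j _ hj
    rw [indicator_of_notMem, mul_zero]
    intro h
    exact hj (Fin.ext ((mem_cell_iff.1 h).symm.trans (mem_cell_iff.1 hi)))
  · simp

/-- The function `∑ α(average of g over a cell) / (N + 1)` has the gradient `α'(average)` on each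
cell, as the weight cancels the normalisation of the average. At continuity points of `g` the
averages converge to `g t`, so the gradients converge to `α' ∘ g` at every `g`. The values follow by
integration from the base point, where all approximants equal `α 0`. -/
theorem approx_potFun (Q : Measure G0) {α : ℝ → ℝ} (hα : ContDiff ℝ 1 α) {C : ℝ}
    (hC : ∀ x, ‖deriv α x‖ ≤ C) : Approx Q C1 (potFun α) (G0.compH (deriv α)) := by
  have hC0 : 0 ≤ C := (norm_nonneg _).trans (hC 0)
  have hd : Continuous (deriv α) := hα.continuous_deriv_one
  let w : ℕ → G0 → ℝ := fun N g => ∑ i : Fin (N + 1), (1 / ((N : ℝ) + 1)) * α (cellAvg N i g)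
  let F : ℕ → G0 → I → ℝ := fun N g t =>
    ∑ i : Fin (N + 1), deriv α (cellAvg N i g) * (cell N i).indicator (fun _ => 1) t
  let W : ℕ → G0 → H := fun N g => ∑ i : Fin (N + 1), (1 / ((N : ℝ) + 1)) •
    (deriv α (cellAvg N i g) • (((N : ℝ) + 1) • cellH N i))
  have hF1 : ∀ N g t, t < 1 → ∃ i, t ∈ cell N i ∧ F N g t = deriv α (cellAvg N i g) := by
    intro N g t ht
    obtain ⟨i, hi⟩ := exists_mem_cell N ht
    exact ⟨i, hi, sum_indicator_cell hi _⟩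
  have hFm : ∀ N g, AEStronglyMeasurable (F N g) volume := fun N g =>
    (Finset.measurable_fun_sum _ fun i _ => measurable_const.mul
      (measurable_const.indicator measurableSet_Ico)).aestronglyMeasurable
  have hFC : ∀ N g t, ‖F N g t‖ ≤ C := by
    intro N g t
    -- The half-open cells do not contain `t = 1`, where every term of the sum vanishes.
    rcases eq_or_lt_of_le (show t ≤ 1 from t.2.2) with rfl | ht
    · have : F N g 1 = 0 := Finset.sum_eq_zero fun i _ => by
        rw [indicator_of_notMem, mul_zero]
        intro h
        exact absurd (le_one' : grid N i.succ ≤ 1) (not_le.2 h.2)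
      rw [this, norm_zero]; exact hC0
    · obtain ⟨i, -, h⟩ := hF1 N g t ht
      rw [h]; exact hC _
  have hW : ∀ N g, W N g = toH (F N g) := by
    intro N g
    refine (toH_eq (memLp_of_bounded (hFm N g) (hFC N g)) ?_).symm
    have h1 : ∀ᵐ t : I, ∀ i, ((1 / ((N : ℝ) + 1)) •
        (deriv α (cellAvg N i g) • (((N : ℝ) + 1) • cellH N i)) : H) t =
        deriv α (cellAvg N i g) * (cell N i).indicator (fun _ => 1) t := by
      refine ae_all_iff.2 fun i => ?_
      rw [smul_smul, smul_smul]
      filter_upwards [Lp.coeFn_smul (1 / ((N : ℝ) + 1) * deriv α (cellAvg N i g) * ((N : ℝ) + 1))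
        (cellH N i), cellH_ae N i] with t h1 h2
      rw [h1, Pi.smul_apply, h2, smul_eq_mul]
      field_simp
    filter_upwards [Lp.coeFn_finsetSum Finset.univ (fun i : Fin (N + 1) => (1 / ((N : ℝ) + 1)) •
      (deriv α (cellAvg N i g) • (((N : ℝ) + 1) • cellH N i))), h1] with t h2 h3
    rw [h2, Finset.sum_apply]
    exact Finset.sum_congr rfl fun i _ => h3 i
  have hreg : ∀ N, Reg (w N) (W N) := by
    intro N
    refine (Reg.sum Finset.univ fun i _ => ((reg_linFun (((N : ℝ) + 1) • cellH N i)).comp_one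
      hα).smul (1 / ((N : ℝ) + 1))).congr ?_ ?_
    · funext g; simp [w, cellAvg, Finset.sum_apply]
    · funext g; simp [W, cellAvg, Finset.sum_apply]
  have hWC : ∀ N g, ‖W N g‖ ≤ C := fun N g => by
    rw [hW]; exact norm_toH_le hC0 (hFC N g)
  have hWlim : ∀ g, Tendsto (fun N => W N g) atTop (𝓝 (g.compH (deriv α))) := by
    intro g
    simp only [hW, G0.compH]
    refine tendsto_toH (hFm · g) (g.aestronglyMeasurable_comp hd) (hFC · g) (fun t => hC _) ?_
    have hc : ({t : I | ¬ContinuousAt g.toFun t} ∪ {1}).Countable :=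
      g.mono.countable_not_continuousAt.union (countable_singleton 1)
    filter_upwards [hc.ae_notMem volume] with t ht
    simp only [mem_union, mem_ofPred_eq, mem_singleton_iff, not_or, not_not] at ht
    have ht1 : t < 1 := lt_of_le_of_ne t.2.2 ht.2
    choose i hi hFi using fun N => hF1 N g t ht1
    simp only [hFi]
    refine (hd.tendsto _).comp ?_
    rw [Metric.tendsto_atTop]
    intro ε hε
    have hgc : ContinuousAt (fun s => (g s : ℝ)) t := continuous_subtype_val.continuousAt.comp ht.1
    obtain ⟨δ, hδ, hgδ⟩ := Metric.continuousAt_iff.1 hgc (ε / 2) (by positivity)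
    obtain ⟨M, hM⟩ := exists_nat_one_div_lt hδ
    refine ⟨M, fun N hN => ?_⟩
    rw [Real.dist_eq]
    refine lt_of_le_of_lt (abs_cellAvg_sub_le (ε := ε / 2) fun s hs => ?_) (by linarith)
    refine (hgδ ?_).le
    refine (abs_sub_lt_of_mem_cell hs (hi N)).trans_le (le_trans ?_ hM.le)
    exact one_div_le_one_div_of_le (by positivity) (by
      have : (M : ℝ) ≤ N := by exact_mod_cast hN
      linarith)
  have hwlim : ∀ g, Tendsto (fun N => w N g) atTop (𝓝 (potFun α g)) := by
    intro g
    refine (reg_potFun hα hC).tendsto_of_grad hreg hWC (h := G0.jump 1) (fun s _ => hWlim _) ?_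
    have : ∀ N, w N (G0.jump 1) = α 0 := fun N => by
      simp only [w, cellAvg, linFun_jump_one, Finset.sum_const, Finset.card_univ, Fintype.card_fin,
        nsmul_eq_mul]
      push_cast
      field_simp
    simp only [this, potFun_jump_one]
    exact tendsto_const_nhds
  have hα1 : ∃ K, ∀ x ∈ Icc (0 : ℝ) 1, ‖α x‖ ≤ K := by
    obtain ⟨K, -, hK⟩ := exists_bound_Icc hα.continuous
    exact ⟨K, hK⟩
  obtain ⟨K, hK⟩ := hα1
  refine ⟨w, fun N => ?_, ⟨max (K + C) C, fun N g => ⟨?_, ?_⟩⟩,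
    Eventually.of_forall fun g => ⟨hwlim g, ?_⟩⟩
  · refine ⟨N + 1, fun y => ∑ i, (1 / ((N : ℝ) + 1)) * α (y i),
      fun i => ((N : ℝ) + 1) • cellH N i, ?_, rfl⟩
    exact ContDiff.sum fun i _ => contDiff_const.mul (hα.comp (contDiff_apply ℝ ℝ i))
  · have h1 := (hreg N).abs_sub_le (hWC N) (G0.jump 1) g
    have h2 : w N (G0.jump 1) = α 0 := by
      simp only [w, cellAvg, linFun_jump_one, Finset.sum_const, Finset.card_univ, Fintype.card_fin,
        nsmul_eq_mul]
      push_cast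
      field_simp
    have h3 : ‖g.toL2 - (G0.jump 1).toL2‖ ≤ 1 := by
      have : (G0.jump 1).toL2 = 0 := by
        refine Lp.ext ?_
        filter_upwards [(G0.jump 1).toL2_ae, jump_one_ae, Lp.coeFn_zero ℝ 2 (volume : Measure I)]
          with t e1 e2 e3
        rw [e1, e2, e3]; rfl
      rw [this, sub_zero]; exact g.norm_toL2_le
    rw [h2] at h1
    have h4 := hK 0 (by simp)
    have h5 := norm_le_insert' (w N g) (α 0)
    refine le_max_of_le_left ?_
    have h6 := mul_le_of_le_one_right hC0 h3
    linarith
  · rw [(hreg N).grad_eq]; exact (hWC N g).trans (le_max_right _ _)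
  · simp only [fun N => (hreg N).grad_eq]; exact hWlim g

section

/-! ### A smooth partition of unity on the line -/

/-- Half the square of the positive part. -/
def posSq (y : ℝ) : ℝ := max y 0 ^ 2 / 2

theorem hasDerivAt_posSq (y : ℝ) : HasDerivAt posSq (max y 0) y := by
  have key : ∀ z ≠ (0 : ℝ), HasDerivAt posSq (max z 0) z := by
    intro z hz
    rcases lt_or_gt_of_ne hz with h | h
    · rw [max_eq_right h.le]
      refine (hasDerivAt_const z (0 : ℝ)).congr_of_eventuallyEq ?_
      filter_upwards [Iio_mem_nhds h] with x hx
      simp [posSq, max_eq_right (mem_Iio.1 hx).le]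
    · rw [max_eq_left h.le]
      have h1 : HasDerivAt (fun x : ℝ => x ^ 2 / 2) z z := by
        have := ((hasDerivAt_id z).pow 2).div_const 2
        simpa using this
      refine h1.congr_of_eventuallyEq ?_
      filter_upwards [Ioi_mem_nhds h] with x hx
      simp [posSq, max_eq_left (mem_Ioi.1 hx).le]
  rcases eq_or_ne y 0 with rfl | hy
  · refine hasDerivAt_of_hasDerivAt_of_ne (g := fun z => max z 0) key ?_ ?_
    · unfold posSq; fun_prop
    · fun_prop
  · exact key y hy

/-- The piecewise linear function with values `0` on `]-∞,0]` and `1` on `[1,∞[`. -/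
def ramp (y : ℝ) : ℝ := max y 0 - max (y - 1) 0

/-- The hat function on `[0,2]`. -/
def hat (y : ℝ) : ℝ := ramp y - ramp (y - 1)

/-- The primitive of the hat function. -/
def hatPrim (y : ℝ) : ℝ := posSq y - posSq (y - 1) - (posSq (y - 1) - posSq (y - 1 - 1))

theorem ramp_of_nonpos {y : ℝ} (h : y ≤ 0) : ramp y = 0 := by
  rw [ramp, max_eq_right h, max_eq_right (by linarith), sub_zero]

theorem ramp_of_one_le {y : ℝ} (h : 1 ≤ y) : ramp y = 1 := by
  rw [ramp, max_eq_left (by linarith), max_eq_left (by linarith)]; ring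

theorem ramp_of_mem {y : ℝ} (h : y ∈ Icc (0 : ℝ) 1) : ramp y = y := by
  rw [ramp, max_eq_left h.1, max_eq_right (by linarith [h.2]), sub_zero]

theorem ramp_mem (y : ℝ) : 0 ≤ ramp y ∧ ramp y ≤ 1 := by
  rcases le_total y 0 with h | h
  · simp [ramp_of_nonpos h]
  rcases le_total 1 y with h' | h'
  · simp [ramp_of_one_le h']
  · rw [ramp_of_mem ⟨h, h'⟩]; exact ⟨h, h'⟩

theorem hat_nonneg (y : ℝ) : 0 ≤ hat y := by
  rw [hat, sub_nonneg]
  rcases le_total (y - 1) 0 with h | h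
  · rw [ramp_of_nonpos h]; exact (ramp_mem y).1
  · rw [ramp_of_one_le (by linarith : 1 ≤ y)]; exact (ramp_mem _).2

theorem mem_Ioo_of_hat_ne_zero {y : ℝ} (h : hat y ≠ 0) : 0 < y ∧ y < 2 := by
  constructor
  · by_contra hy
    push Not at hy
    exact h (by rw [hat, ramp_of_nonpos hy, ramp_of_nonpos (by linarith), sub_zero])
  · by_contra hy
    push Not at hy
    exact h (by rw [hat, ramp_of_one_le (by linarith), ramp_of_one_le (by linarith), sub_self])

theorem continuous_hat : Continuous hat := by
  unfold hat ramp; fun_prop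

theorem hasDerivAt_hatPrim (y : ℝ) : HasDerivAt hatPrim (hat y) y := by
  have h1 : HasDerivAt (fun y => posSq (y - 1)) (max (y - 1) 0) y :=
    (hasDerivAt_posSq (y - 1)).comp_sub_const y 1
  have h2 : HasDerivAt (fun y => posSq (y - 1 - 1)) (max (y - 1 - 1) 0) y := by
    have := (hasDerivAt_posSq (y - (1 + 1))).comp_sub_const y (1 + 1)
    simpa only [sub_sub] using this
  exact ((hasDerivAt_posSq y).sub h1).sub (h1.sub h2)

theorem hatPrim_of_nonpos {y : ℝ} (h : y ≤ 0) : hatPrim y = 0 := by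
  have h1 : ∀ z ≤ (0 : ℝ), posSq z = 0 := fun z hz => by rw [posSq, max_eq_right hz]; simp
  rw [hatPrim, h1 y h, h1 _ (by linarith), h1 _ (by linarith)]; simp

theorem hatPrim_of_two_le {y : ℝ} (h : 2 ≤ y) : hatPrim y = 1 := by
  have h1 : ∀ z, 0 ≤ z → posSq z = z ^ 2 / 2 := fun z hz => by rw [posSq, max_eq_left hz]
  rw [hatPrim, h1 y (by linarith), h1 _ (by linarith), h1 _ (by linarith)]; ring

theorem monotone_hatPrim : Monotone hatPrim :=
  monotone_of_deriv_nonneg (fun y => (hasDerivAt_hatPrim y).differentiableAt)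
    fun y => by rw [(hasDerivAt_hatPrim y).deriv]; exact hat_nonneg y

theorem hatPrim_mem (y : ℝ) : 0 ≤ hatPrim y ∧ hatPrim y ≤ 1 := by
  constructor
  · rw [← hatPrim_of_nonpos (min_le_right y 0)]; exact monotone_hatPrim (min_le_left _ _)
  · rw [← hatPrim_of_two_le (le_max_right y 2)]; exact monotone_hatPrim (le_max_left _ _)

/-- The sum telescopes; it equals `1` for `1 ≤ x ≤ n`, so the shifted hats form a partition of unity
there. -/
theorem sum_hat (n : ℕ) (x : ℝ) : ∑ k ∈ Finset.range n, hat (x - k) = ramp x - ramp (x - n) := by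
  have := Finset.sum_range_sub' (fun k : ℕ => ramp (x - k)) n
  simp only [Nat.cast_zero, sub_zero] at this
  rw [← this]
  refine Finset.sum_congr rfl fun k _ => ?_
  rw [hat]
  push_cast
  ring_nf

theorem sum_hat_le (n : ℕ) (x : ℝ) : ∑ k ∈ Finset.range n, hat (x - k) ≤ 1 := by
  rw [sum_hat]
  linarith [(ramp_mem x).2, (ramp_mem (x - n)).1]

/-- The functions `x ↦ hatPrim (n x - k)`. -/
def scaledPrim (n k : ℕ) (x : ℝ) : ℝ := hatPrim (n * x - k)

theorem hasDerivAt_scaledPrim (n k : ℕ) (x : ℝ) :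
    HasDerivAt (scaledPrim n k) (n * hat (n * x - k)) x := by
  have h1 : HasDerivAt (fun x : ℝ => (n : ℝ) * x - k) n x := by
    simpa using ((hasDerivAt_id x).const_mul (n : ℝ)).sub_const (k : ℝ)
  have := (hasDerivAt_hatPrim (n * x - k)).comp x h1
  rwa [mul_comm] at this

theorem deriv_scaledPrim (n k : ℕ) : deriv (scaledPrim n k) = fun x => n * hat (n * x - k) :=
  funext fun x => (hasDerivAt_scaledPrim n k x).deriv

theorem contDiff_scaledPrim (n k : ℕ) : ContDiff ℝ 1 (scaledPrim n k) := by
  rw [contDiff_one_iff_deriv, deriv_scaledPrim]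
  refine ⟨fun x => (hasDerivAt_scaledPrim n k x).differentiableAt, ?_⟩
  have := continuous_hat
  fun_prop

theorem norm_deriv_scaledPrim_le (n k : ℕ) (x : ℝ) : ‖deriv (scaledPrim n k) x‖ ≤ n := by
  rw [deriv_scaledPrim]
  simp only
  rw [norm_mul, Real.norm_of_nonneg n.cast_nonneg, Real.norm_of_nonneg (hat_nonneg _)]
  refine mul_le_of_le_one_right n.cast_nonneg ?_
  rw [hat]
  linarith [(ramp_mem (n * x - k)).2, (ramp_mem (n * x - k - 1)).1]

theorem integrable_scaledPrim (n k : ℕ) (g : G0) :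
    Integrable (fun t : I => scaledPrim n k (g t)) volume :=
  (g.memLp_comp (contDiff_scaledPrim n k).continuous).integrable (by norm_num)

/-- As `scaledPrim n k` rises from `0` to `1` between the levels `k/n` and `(k+2)/n`, the number `1
- potFun (scaledPrim n k) g` is a smoothed time at which `g` crosses these levels. This lemma bounds
it by `t'` from above, the next one from below. -/
theorem le_potFun_scaledPrim {n k : ℕ} {g : G0} {t t' : I} (h1 : 0 < (n : ℝ) * g t - k)
    (h2 : 2 ≤ n * ((g t' : ℝ) - g t)) : 1 - (t' : ℝ) ≤ potFun (scaledPrim n k) g := by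
  have hi : Integrable ((Ici t').indicator fun _ : I => (1 : ℝ)) volume :=
    (integrable_const _).indicator measurableSet_Ici
  have h3 : ∫ t : I, (Ici t').indicator (fun _ => (1 : ℝ)) t = 1 - t' := by
    rw [integral_indicator measurableSet_Ici, setIntegral_const, Measure.real,
      unitInterval.volume_Ici, ENNReal.toReal_ofReal (sub_nonneg.2 t'.2.2), smul_eq_mul, mul_one]
  rw [← h3]
  refine integral_mono hi (integrable_scaledPrim n k g) fun r => ?_
  by_cases hr : t' ≤ r
  · rw [indicator_of_mem (mem_Ici.2 hr)]
    refine (hatPrim_of_two_le ?_).ge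
    have h4 : (g t' : ℝ) ≤ g r := g.mono hr
    have h5 : (n : ℝ) * g t' ≤ n * g r := mul_le_mul_of_nonneg_left h4 n.cast_nonneg
    linarith
  · rw [indicator_of_notMem (by simpa using hr)]
    exact (hatPrim_mem _).1

theorem potFun_scaledPrim_le {n k : ℕ} {g : G0} {t t' : I} (h1 : (n : ℝ) * g t - k < 2)
    (h2 : 2 ≤ n * ((g t : ℝ) - g t')) : potFun (scaledPrim n k) g ≤ 1 - (t' : ℝ) := by
  have hi : Integrable ((Ici t').indicator fun _ : I => (1 : ℝ)) volume :=
    (integrable_const _).indicator measurableSet_Ici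
  have h3 : ∫ t : I, (Ici t').indicator (fun _ => (1 : ℝ)) t = 1 - t' := by
    rw [integral_indicator measurableSet_Ici, setIntegral_const, Measure.real,
      unitInterval.volume_Ici, ENNReal.toReal_ofReal (sub_nonneg.2 t'.2.2), smul_eq_mul, mul_one]
  rw [← h3]
  refine integral_mono (integrable_scaledPrim n k g) hi fun r => ?_
  by_cases hr : t' ≤ r
  · rw [indicator_of_mem (mem_Ici.2 hr)]
    exact (hatPrim_mem _).2
  · rw [indicator_of_notMem (by simpa using hr)]
    refine (hatPrim_of_nonpos ?_).le
    have h4 : (g r : ℝ) ≤ g t' := g.mono (not_le.1 hr).le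
    have h5 : (n : ℝ) * g r ≤ n * g t' := mul_le_mul_of_nonneg_left h4 n.cast_nonneg
    linarith

/-! ### Approximation of linear functionals by potentials -/

/-- The gradients approximating `f`. -/
def approxFun (f : ℝ → ℝ) (n : ℕ) (g : G0) (x : ℝ) : ℝ :=
  ∑ k ∈ Finset.range n, f (1 - potFun (scaledPrim n k) g) * hat (n * x - k)

theorem continuous_approxFun (f : ℝ → ℝ) (n : ℕ) (g : G0) : Continuous (approxFun f n g) := by
  have := continuous_hat
  unfold approxFun
  fun_prop

theorem norm_approxFun_le {f : ℝ → ℝ} {C : ℝ} (hC : ∀ x, ‖f x‖ ≤ C) (n : ℕ) (g : G0) (x : ℝ) :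
    ‖approxFun f n g x‖ ≤ C := by
  have hC0 : 0 ≤ C := (norm_nonneg _).trans (hC 0)
  refine (norm_sum_le _ _).trans ?_
  calc ∑ k ∈ Finset.range n, ‖f (1 - potFun (scaledPrim n k) g) * hat (n * x - k)‖
      ≤ ∑ k ∈ Finset.range n, C * hat (n * x - k) := by
        refine Finset.sum_le_sum fun k _ => ?_
        rw [norm_mul, Real.norm_of_nonneg (hat_nonneg _)]
        exact mul_le_mul_of_nonneg_right (hC _) (hat_nonneg _)
    _ ≤ C := by
        rw [← Finset.mul_sum]
        exact mul_le_of_le_one_right hC0 (sum_hat_le _ _)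

/-- Only indices with `0 < n g(t) - k < 2` contribute. Fix `a < t < b` close to `t`. Strict
monotonicity gives `g a < g t < g b`, and once these gaps exceed `2/n`, the smoothed crossing times
of all contributing levels lie in `[a,b]`, where `f` is close to `f t`. The hats sum to `1` at `n
g(t)` as soon as `n g(t) ≥ 1`. -/
theorem tendsto_approxFun {f : ℝ → ℝ} (hf : Continuous f) {g : G0}
    (hg : StrictMonoOn g.toFun (Iio 1)) {t : I} (h0 : 0 < t) (h1 : t < 1) :
    Tendsto (fun n => approxFun f n g (g t)) atTop (𝓝 (f t)) := by
  rw [Metric.tendsto_atTop]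
  intro ε hε
  obtain ⟨δ, hδ, hfδ⟩ := Metric.continuousAt_iff.1 (hf.continuousAt (x := (t : ℝ))) (ε / 2)
    (by positivity)
  have h0' : (0 : ℝ) < t := h0
  have h1' : (t : ℝ) < 1 := h1
  obtain ⟨a, ha, hta⟩ : ∃ a : I, a < t ∧ (t : ℝ) - a < δ := by
    refine ⟨⟨t - min ((t : ℝ) / 2) (δ / 2), ?_, ?_⟩, ?_, ?_⟩
    · linarith [min_le_left ((t : ℝ) / 2) (δ / 2)]
    · have : 0 < min ((t : ℝ) / 2) (δ / 2) := by positivity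
      linarith
    · have : 0 < min ((t : ℝ) / 2) (δ / 2) := by positivity
      exact Subtype.coe_lt_coe.1 (by simp only; linarith)
    · simp only
      linarith [min_le_right ((t : ℝ) / 2) (δ / 2)]
  obtain ⟨b, hb, hb1, hbt⟩ : ∃ b : I, t < b ∧ b < 1 ∧ (b : ℝ) - t < δ := by
    have hm : 0 < min ((1 - (t : ℝ)) / 2) (δ / 2) := lt_min (by linarith) (by positivity)
    have hm1 := min_le_left ((1 - (t : ℝ)) / 2) (δ / 2)
    have hm2 := min_le_right ((1 - (t : ℝ)) / 2) (δ / 2)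
    refine ⟨⟨t + min ((1 - (t : ℝ)) / 2) (δ / 2), ?_, ?_⟩, ?_, ?_, ?_⟩
    · linarith
    · linarith
    · exact Subtype.coe_lt_coe.1 (by simpa using hm)
    · exact Subtype.coe_lt_coe.1 (by simp only [Icc.coe_one]; linarith)
    · simp only
      linarith
  have hga : (g a : ℝ) < g t := hg (ha.trans h1) h1 ha
  have hgb : (g t : ℝ) < g b := hg h1 hb1 hb
  have hg0 : (0 : ℝ) < g t := (g a).2.1.trans_lt hga
  have l1 : ∀ᶠ n : ℕ in atTop, 2 ≤ n * ((g t : ℝ) - g a) :=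
    (tendsto_natCast_atTop_atTop.atTop_mul_const (sub_pos.2 hga)).eventually_ge_atTop 2
  have l2 : ∀ᶠ n : ℕ in atTop, 2 ≤ n * ((g b : ℝ) - g t) :=
    (tendsto_natCast_atTop_atTop.atTop_mul_const (sub_pos.2 hgb)).eventually_ge_atTop 2
  have l3 : ∀ᶠ n : ℕ in atTop, 1 ≤ n * (g t : ℝ) :=
    (tendsto_natCast_atTop_atTop.atTop_mul_const hg0).eventually_ge_atTop 1
  obtain ⟨M, hM⟩ := eventually_atTop.1 (l1.and (l2.and l3))
  refine ⟨M, fun n hn => ?_⟩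
  obtain ⟨e1, e2, e3⟩ := hM n hn
  have hsum : ∑ k ∈ Finset.range n, hat (n * g t - k) = 1 := by
    rw [sum_hat, ramp_of_one_le e3, ramp_of_nonpos, sub_zero]
    have := mul_le_of_le_one_right (n.cast_nonneg (α := ℝ)) (g t).2.2
    linarith
  have e4 : approxFun f n g (g t) - f t = ∑ k ∈ Finset.range n,
      (f (1 - potFun (scaledPrim n k) g) - f t) * hat (n * g t - k) := by
    simp only [approxFun, sub_mul, Finset.sum_sub_distrib]
    rw [← Finset.mul_sum, hsum, mul_one]
  rw [dist_eq_norm, e4]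
  refine lt_of_le_of_lt (norm_sum_le _ _) ?_
  calc _ ≤ ∑ k ∈ Finset.range n, ε / 2 * hat (n * g t - k) := by
        refine Finset.sum_le_sum fun k _ => ?_
        rw [norm_mul, Real.norm_of_nonneg (hat_nonneg _)]
        by_cases hk : hat (n * g t - k) = 0
        · rw [hk, mul_zero, mul_zero]
        · obtain ⟨p1, p2⟩ := mem_Ioo_of_hat_ne_zero hk
          refine mul_le_mul_of_nonneg_right ?_ (hat_nonneg _)
          refine (hfδ ?_).le
          have q1 := le_potFun_scaledPrim p1 e2
          have q2 := potFun_scaledPrim_le p2 e1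
          rw [Real.dist_eq, abs_lt]
          constructor <;> linarith
    _ = ε / 2 := by rw [← Finset.mul_sum, hsum, mul_one]
    _ < ε := by linarith

theorem compH_smul (c : ℝ) {a : ℝ → ℝ} (ha : Continuous a) (g : G0) :
    c • g.compH a = g.compH (fun x => c * a x) := by
  refine (toH_eq (g.memLp_comp (by fun_prop : Continuous fun x => c * a x)) ?_).symm
  filter_upwards [Lp.coeFn_smul c (g.compH a), g.compH_ae ha] with t h1 h2
  rw [h1, Pi.smul_apply, h2, smul_eq_mul]

theorem compH_sum {ι : Type*} (s : Finset ι) {a : ι → ℝ → ℝ} (ha : ∀ i, Continuous (a i)) (g : G0) :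
    ∑ i ∈ s, g.compH (a i) = g.compH (fun x => ∑ i ∈ s, a i x) := by
  refine (toH_eq (g.memLp_comp (by fun_prop : Continuous fun x => ∑ i ∈ s, a i x)) ?_).symm
  have h1 : ∀ᵐ t : I, ∀ i ∈ s, g.compH (a i) t = a i (g t) :=
    (ae_ball_iff (Finset.countable_toSet s)).2 fun i _ => g.compH_ae (ha i)
  filter_upwards [Lp.coeFn_finsetSum s fun i => g.compH (a i), h1] with t h2 h3
  rw [h2, Finset.sum_apply]
  exact Finset.sum_congr rfl fun i hi => h3 i hi

theorem strictMonoOn_lerp {g : G0} (hg : StrictMonoOn g.toFun (Iio 1)) {s : I} (hs : 0 < s) :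
    StrictMonoOn ((G0.jump 1).lerp g s).toFun (Iio 1) := by
  intro a ha b hb hab
  have h1 : (g a : ℝ) < g b := hg ha hb hab
  have hs' : (0 : ℝ) < s := hs
  have h2 : ∀ c ∈ Iio (1 : I), (G0.jump 1 c : ℝ) = 0 := fun c hc => by
    have : ¬ (1 : I) ≤ c := not_le.2 hc
    simp [G0.jump, this]
  refine Subtype.coe_lt_coe.1 ?_
  change ((G0.jump 1).lerp g s a : ℝ) < (G0.jump 1).lerp g s b
  rw [G0.lerp_apply, G0.lerp_apply, h2 a ha, h2 b hb]
  nlinarith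

theorem toL2_jump_one : (G0.jump 1).toL2 = 0 := by
  refine Lp.ext ?_
  filter_upwards [(G0.jump 1).toL2_ae, jump_one_ae, Lp.coeFn_zero ℝ 2 (volume : Measure I)]
    with t e1 e2 e3
  rw [e1, e2, e3]; rfl

/-- With `η' y = f (1 - y)`, the function `∑ η(potFun (scaledPrim (n+1) k)) / (n+1)` has the
gradient `approxFun f (n+1) g ∘ g`, because the derivative of `scaledPrim (n+1) k` carries the
factor `n + 1`. This gradient tends to `f` at every `g` strictly increasing on `[0,1[`. The property
holds almost everywhere and is inherited by the points `s > 0` of the segment from the base point to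
`g`, so the values converge too. The shift to `n + 1` avoids a division by zero. -/
theorem approx_linFun {Q : Measure G0} (hQ : ∀ᵐ g ∂Q, StrictMono g.toFun) {f : ℝ → ℝ}
    (hf : Continuous f) {C : ℝ} (hC : ∀ x, ‖f x‖ ≤ C) :
    Approx Q Z1 (linFun (toH fun t => f t)) (fun _ => toH fun t => f t) := by
  have hC0 : 0 ≤ C := (norm_nonneg _).trans (hC 0)
  let η : ℝ → ℝ := fun y => ∫ z in (0 : ℝ)..y, f (1 - z)
  have hη : ∀ y, HasDerivAt η (f (1 - y)) y := fun y => by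
    have hc : Continuous fun z => f (1 - z) := by fun_prop
    exact intervalIntegral.integral_hasDerivAt_right (hc.intervalIntegrable _ _)
      (hc.stronglyMeasurableAtFilter _ _) hc.continuousAt
  have hη' : deriv η = fun y => f (1 - y) := funext fun y => (hη y).deriv
  have hηC : ContDiff ℝ 1 η := by
    rw [contDiff_one_iff_deriv, hη']
    exact ⟨fun y => (hη y).differentiableAt, by fun_prop⟩
  have hη0 : η 0 = 0 := by simp [η]
  let w : ℕ → G0 → ℝ := fun n g =>
    ∑ k ∈ Finset.range (n + 1), (1 / ((n : ℝ) + 1)) * η (potFun (scaledPrim (n + 1) k) g)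
  let W : ℕ → G0 → H := fun n g => g.compH (approxFun f (n + 1) g)
  have hreg : ∀ n, Reg (w n) (W n) := by
    intro n
    refine (Reg.sum (Finset.range (n + 1)) fun k _ => ((reg_potFun (contDiff_scaledPrim (n + 1) k)
      (norm_deriv_scaledPrim_le (n + 1) k)).comp_one hηC).smul (1 / ((n : ℝ) + 1))).congr ?_ ?_
    · funext g; simp [w, Finset.sum_apply]
    · funext g
      have hh := continuous_hat
      rw [Finset.sum_apply]
      have e : ∀ k, ((1 / ((n : ℝ) + 1)) • fun g => deriv η (potFun (scaledPrim (n + 1) k) g) •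
          G0.compH (deriv (scaledPrim (n + 1) k)) g) g = g.compH (fun x =>
            f (1 - potFun (scaledPrim (n + 1) k) g) * hat ((n + 1 : ℕ) * x - k)) := fun k => by
        rw [Pi.smul_apply, hη', compH_smul _ (contDiff_scaledPrim _ _).continuous_deriv_one,
          deriv_scaledPrim, compH_smul _ (by fun_prop)]
        congr 1
        funext x
        push_cast
        field_simp
      simp only [e]
      rw [compH_sum _ (fun k => by fun_prop)]
      rfl
  have hWC : ∀ n g, ‖W n g‖ ≤ C := fun n g => norm_toH_le hC0 fun t => norm_approxFun_le hC _ _ _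
  have hWlim : ∀ g : G0, StrictMonoOn g.toFun (Iio 1) →
      Tendsto (fun n => W n g) atTop (𝓝 (toH fun t => f t)) := by
    intro g hg
    refine tendsto_toH (fun n => g.aestronglyMeasurable_comp (continuous_approxFun _ _ _))
      (hf.comp continuous_subtype_val).aestronglyMeasurable
      (fun n t => norm_approxFun_le hC _ _ _) (fun t => hC _) ?_
    have h01 : ∀ᵐ t : I, t ∉ ({0, 1} : Set I) := ((countable_singleton 1).insert 0).ae_notMem _
    filter_upwards [h01] with t ht
    simp only [mem_insert_iff, mem_singleton_iff, not_or] at ht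
    exact (tendsto_approxFun hf hg (lt_of_le_of_ne t.2.1 fun h => ht.1 h.symm)
      (lt_of_le_of_ne t.2.2 ht.2)).comp (tendsto_add_atTop_nat 1)
  have hw0 : ∀ n, w n (G0.jump 1) = 0 := fun n => by
    refine Finset.sum_eq_zero fun k _ => ?_
    rw [potFun_jump_one, scaledPrim, hatPrim_of_nonpos, hη0, mul_zero]
    simp
  refine ⟨w, fun n => ?_, ⟨C, fun n g => ⟨?_, ?_⟩⟩, ?_⟩
  · refine ⟨n + 1, fun y => ∑ k, (1 / ((n : ℝ) + 1)) * η (y k),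
      fun k => scaledPrim (n + 1) k, ?_, fun k => (contDiff_scaledPrim _ _).contDiffOn, ?_⟩
    · exact ContDiff.sum fun i _ => contDiff_const.mul (hηC.comp (contDiff_apply ℝ ℝ i))
    · funext g
      simp only [w, zylFun]
      rw [Finset.sum_range]
      rfl
  · have h1 := (hreg n).abs_sub_le (hWC n) (G0.jump 1) g
    rw [hw0, sub_zero, toL2_jump_one, sub_zero] at h1
    exact h1.trans (mul_le_of_le_one_right hC0 g.norm_toL2_le)
  · rw [(hreg n).grad_eq]; exact hWC n g
  · filter_upwards [hQ] with g hg
    simp only [fun n => (hreg n).grad_eq]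
    refine ⟨(reg_linFun _).tendsto_of_grad hreg hWC (h := G0.jump 1)
      (fun s hs => hWlim _ (strictMonoOn_lerp (hg.strictMonoOn _) hs)) ?_, hWlim g (hg.strictMonoOn _)⟩
    simp only [hw0, linFun_jump_one]
    exact tendsto_const_nhds

/-! ### The two classes of functions have the same closure -/

variable {Q : Measure G0}

theorem gradGraph_Z1_subset [IsFiniteMeasure Q] :
    gradGraph Q Z1 ⊆ closure (gradGraph Q C1) := by
  rintro p ⟨u, ⟨m, U, α, hU, hα, rfl⟩, h1, h2⟩
  obtain ⟨a, ha, hb, h3, -, -, h6⟩ := exists_reg_zylFun hU hα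
  choose C hC using hb
  rw [h3] at h1 h2
  rw [h6.grad_eq] at h2
  exact (Approx.comp gradClass_C1 hU fun i => approx_potFun Q (ha i) (hC i)).mem_closure
    gradClass_C1 h1 h2

theorem exists_seq_continuous (f : H) : ∃ F : ℕ → ℝ → ℝ, (∀ n, Continuous (F n)) ∧
    (∀ n, ∃ C, ∀ x, ‖F n x‖ ≤ C) ∧ Tendsto (fun n => toH fun t => F n t) atTop (𝓝 f) := by
  have hd := ContinuousMap.toLp_denseRange ℝ (volume : Measure I) (p := 2) ℝ ENNReal.ofNat_ne_top
  obtain ⟨x, hx, hlim⟩ := mem_closure_iff_seq_limit.1 (hd f)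
  choose φ hφ using hx
  refine ⟨fun n => IccExtend zero_le_one (φ n), fun n => (φ n).continuous.Icc_extend',
    fun n => ⟨‖φ n‖, fun x => (φ n).norm_coe_le_norm _⟩, ?_⟩
  convert hlim using 2 with n
  rw [← hφ n]
  have hm : MemLp (fun t : I => IccExtend zero_le_one (φ n) (t : ℝ)) 2 volume :=
    memLp_of_bounded (C := ‖φ n‖) ((φ n).continuous.Icc_extend'.comp
      continuous_subtype_val).aestronglyMeasurable fun t => (φ n).norm_coe_le_norm _
  refine toH_eq hm ?_
  filter_upwards [ContinuousMap.coeFn_toLp (p := 2) (𝕜 := ℝ) (volume : Measure I) (φ n)] with t ht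
  rw [ht, IccExtend_val]

/-- `approx_linFun` requires continuous coefficients. General ones are `L²`-limits of continuous
functions, and the corresponding cylinder functions converge together with their gradients,
uniformly bounded. -/
theorem gradGraph_C1_subset [IsFiniteMeasure Q] (hQ : ∀ᵐ g ∂Q, StrictMono g.toFun) :
    gradGraph Q C1 ⊆ closure (gradGraph Q Z1) := by
  rintro p ⟨u, ⟨m, U, f, hU, rfl⟩, h1, h2⟩
  rw [(reg_cylFun hU f).grad_eq] at h2
  choose F hF hFb hFlim using fun i => exists_seq_continuous (f i)
  choose C hC using hFb
  let fn : ℕ → Fin m → H := fun n i => toH fun t => F i n t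
  have hr : ∀ n, Reg (cylFun U (fn n)) _ := fun n => reg_cylFun hU (fn n)
  let P : ℕ → Lp ℝ 2 Q × Lp H 2 Q := fun n =>
    (((hr n).memLp Q).toLp _, ((hr n).memLp_grad Q).toLp _)
  have hP : ∀ n, P n ∈ closure (gradGraph Q Z1) := fun n =>
    (Approx.comp gradClass_Z1 hU fun i => approx_linFun hQ (hF i n) (hC i n)).mem_closure
      gradClass_Z1 ((hr n).memLp Q).coeFn_toLp ((hr n).memLp_grad Q).coeFn_toLp
  refine isClosed_closure.mem_of_tendsto (b := atTop) (f := P) ?_ (Eventually.of_forall hP)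
  obtain ⟨D, -, hD⟩ := exists_common_bound (p := fun i D => ∀ n, ‖fn n i‖ ≤ D)
    (fun i C D hCD h n => (h n).trans hCD) (fun i => by
      obtain ⟨D, hD⟩ := (hFlim i).norm.bddAbove_range
      exact ⟨D, fun n => hD ⟨n, rfl⟩⟩)
  obtain ⟨K, hK0, hK⟩ := exists_chain_bound hU D
  have hb : ∀ n g, ‖cylFun U (fn n) g‖ ≤ K ∧
      ‖chainGrad U (fun i => linFun (fn n i) g) (fn n)‖ ≤ K := fun n g =>
    hK _ _ (fun i => (norm_linFun_le _ _).trans (hD i n)) (fun i => hD i n)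
  have hfn : Tendsto fn atTop (𝓝 f) := tendsto_pi_nhds.2 fun i => hFlim i
  have hlin : ∀ g, Tendsto (fun n i => linFun (fn n i) g) atTop (𝓝 fun i => linFun (f i) g) :=
    fun g => tendsto_pi_nhds.2 fun i => by
      simp only [linFun_eq]
      exact (hFlim i).inner tendsto_const_nhds
  have e1 : ∀ᵐ g ∂Q, ∀ n, (P n).1 g = cylFun U (fn n) g :=
    ae_all_iff.2 fun n => ((hr n).memLp Q).coeFn_toLp
  have e2 : ∀ᵐ g ∂Q, ∀ n, (P n).2 g = chainGrad U (fun i => linFun (fn n i) g) (fn n) :=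
    ae_all_iff.2 fun n => ((hr n).memLp_grad Q).coeFn_toLp
  refine Prod.tendsto_iff _ _ |>.2 ⟨?_, ?_⟩
  · refine Lp_tendsto_of_bounded K (fun n => ?_) ?_
    · filter_upwards [e1] with g h3
      rw [h3]; exact (hb n g).1
    · filter_upwards [e1, h1] with g h3 h4
      simp only [h3, h4]
      exact (hU.continuous.tendsto _).comp (hlin g)
  · refine Lp_tendsto_of_bounded K (fun n => ?_) ?_
    · filter_upwards [e2] with g h3
      rw [h3]; exact (hb n g).2
    · filter_upwards [e2, h2] with g h3 h4
      simp only [h3, h4]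
      have t3 := (continuous_chainGrad hU).tendsto ((fun i => linFun (f i) g), f)
      have t4 := t3.comp ((hlin g).prodMk_nhds hfn)
      exact t4

end

/-! ### The closed operator -/

namespace GradClass

variable {𝓓 : Set (G0 → ℝ)} {β : ℝ} {Q : Measure G0}

theorem coe_topologicalClosure_graph (h : GradClass 𝓓) (Q : Measure G0) :
    ((h.graph Q).topologicalClosure : Set (Lp ℝ 2 Q × Lp H 2 Q)) = closure (gradGraph Q 𝓓) := rfl

/-- Closability in graph form: the closure of the graph is single-valued. All properties of the
closed operator and the closed form come from this. -/
theorem snd_eq_zero (h : GradClass 𝓓) (hβ : 0 < β) (hQ : IsDirichletProcess β Q)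
    {p : Lp ℝ 2 Q × Lp H 2 Q} (hp : p ∈ closure (gradGraph Q 𝓓)) (h0 : p.1 = 0) : p.2 = 0 := by
  obtain ⟨q, hq, hlim⟩ := mem_closure_iff_seq_limit.1 hp
  choose u hu h1 h2 using hq
  have l1 := (continuous_fst.tendsto p).comp hlim
  have l2 := (continuous_snd.tendsto p).comp hlim
  refine hQ.closable hβ (fun n => h.reg _ (hu n)) ?_ h2 l2
  have l3 := (Lp.tendsto_Lp_iff_tendsto_eLpNorm' _ _).1 l1
  refine l3.congr fun n => eLpNorm_congr_ae ?_
  filter_upwards [h1 n, Lp.coeFn_zero ℝ 2 Q] with g e1 e2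
  rw [Pi.sub_apply, h0, e2, Function.comp_apply, e1]
  simp

theorem unique (h : GradClass 𝓓) (hβ : 0 < β) (hQ : IsDirichletProcess β Q)
    {w : Lp ℝ 2 Q} {B B' : Lp H 2 Q} (hB : (w, B) ∈ closure (gradGraph Q 𝓓))
    (hB' : (w, B') ∈ closure (gradGraph Q 𝓓)) : B = B' := by
  rw [← h.coe_topologicalClosure_graph] at hB hB'
  have h1 := (h.graph Q).topologicalClosure.sub_mem hB hB'
  exact sub_eq_zero.1 (h.snd_eq_zero hβ hQ h1 (by simp))

/-- `toLinearPMap` reproduces a given subspace as its graph only if the fibre over `0` is trivial.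
That the fibre is trivial says precisely that `𝔻` is well defined on classes. -/
theorem graph_gradOp (h : GradClass 𝓓) (hβ : 0 < β) (hQ : IsDirichletProcess β Q) :
    (gradOp Q 𝓓).graph = h.graph Q := by
  rw [gradOp, h.span_gradGraph]
  exact Submodule.toLinearPMap_graph_eq _ fun p hp h0 =>
    h.snd_eq_zero hβ hQ (subset_closure hp) h0

theorem isClosable_gradOp (h : GradClass 𝓓) (hβ : 0 < β) (hQ : IsDirichletProcess β Q) :
    (gradOp Q 𝓓).IsClosable :=
  ⟨(h.graph Q).topologicalClosure.toLinearPMap, by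
    rw [h.graph_gradOp hβ hQ]
    exact (Submodule.toLinearPMap_graph_eq _ fun p hp h0 => h.snd_eq_zero hβ hQ hp h0).symm⟩

theorem graph_closure_gradOp (h : GradClass 𝓓) (hβ : 0 < β) (hQ : IsDirichletProcess β Q) :
    ((gradOp Q 𝓓).closure.graph : Set (Lp ℝ 2 Q × Lp H 2 Q)) = closure (gradGraph Q 𝓓) := by
  rw [← (h.isClosable_gradOp hβ hQ).graph_closure_eq_closure_graph, h.graph_gradOp hβ hQ]
  rfl

/-! ### The closed form -/

/-- The class in `L²` of the gradient of `u`. -/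
def gradLp (h : GradClass 𝓓) (Q : Measure G0) [IsFiniteMeasure Q] {u : G0 → ℝ} (hu : u ∈ 𝓓) :
    Lp H 2 Q := ((h.reg u hu).memLp_grad Q).toLp (grad u)

theorem gradLp_ae (h : GradClass 𝓓) [IsFiniteMeasure Q] {u : G0 → ℝ} (hu : u ∈ 𝓓) :
    h.gradLp Q hu =ᵐ[Q] grad u := ((h.reg u hu).memLp_grad Q).coeFn_toLp

/-- The form is the inner product pulled back along the gradient, so `𝔼`-Cauchy sequences are those
with Cauchy gradients, and form and operator have the same closure. -/
theorem energy_eq (h : GradClass 𝓓) [IsFiniteMeasure Q] {u v : G0 → ℝ} (hu : u ∈ 𝓓) (hv : v ∈ 𝓓) :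
    energy Q u v = inner ℝ (h.gradLp Q hu) (h.gradLp Q hv) := by
  rw [L2.inner_def]
  refine integral_congr_ae ?_
  filter_upwards [h.gradLp_ae hu, h.gradLp_ae hv] with g h1 h2
  rw [h1, h2]

theorem gradLp_sub (h : GradClass 𝓓) [IsFiniteMeasure Q] {u v : G0 → ℝ} (hu : u ∈ 𝓓)
    (hv : v ∈ 𝓓) : h.gradLp Q (h.sub_mem hu hv) = h.gradLp Q hu - h.gradLp Q hv := by
  refine Lp.ext ?_
  filter_upwards [h.gradLp_ae (Q := Q) (h.sub_mem hu hv), h.gradLp_ae (Q := Q) hu,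
    h.gradLp_ae (Q := Q) hv, Lp.coeFn_sub (h.gradLp Q hu) (h.gradLp Q hv)] with g h1 h2 h3 h4
  rw [h1, h4, Pi.sub_apply, h2, h3, h.grad_sub hu hv, Pi.sub_apply]

theorem energy_sub_self (h : GradClass 𝓓) [IsFiniteMeasure Q] {u v : G0 → ℝ} (hu : u ∈ 𝓓)
    (hv : v ∈ 𝓓) : energy Q (u - v) (u - v) = ‖h.gradLp Q hu - h.gradLp Q hv‖ ^ 2 := by
  rw [h.energy_eq (h.sub_mem hu hv) (h.sub_mem hu hv), real_inner_self_eq_norm_sq, h.gradLp_sub]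

theorem energyCauchy_iff (h : GradClass 𝓓) [IsFiniteMeasure Q] {u : ℕ → G0 → ℝ}
    (hu : ∀ n, u n ∈ 𝓓) : EnergyCauchy Q u ↔ CauchySeq fun n => h.gradLp Q (hu n) := by
  rw [Metric.cauchySeq_iff]
  simp only [EnergyCauchy, h.energy_sub_self (hu _) (hu _), dist_eq_norm]
  constructor
  · intro H ε hε
    obtain ⟨N, hN⟩ := H (ε ^ 2) (by positivity)
    exact ⟨N, fun m hm n hn => lt_of_pow_lt_pow_left₀ 2 hε.le (hN m hm n hn)⟩
  · intro H ε hε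
    obtain ⟨N, hN⟩ := H (√ε) (by positivity)
    refine ⟨N, fun m hm n hn => ?_⟩
    rw [← Real.sq_sqrt hε.le]
    exact pow_lt_pow_left₀ (hN m hm n hn) (norm_nonneg _) two_ne_zero

theorem exists_tendsto_gradLp (h : GradClass 𝓓) [IsFiniteMeasure Q] {u : ℕ → G0 → ℝ}
    {w : Lp ℝ 2 Q} (hu : FormApprox Q 𝓓 u w) : ∃ B, (w, B) ∈ closure (gradGraph Q 𝓓) ∧
      Tendsto (fun n => h.gradLp Q (hu.1 n)) atTop (𝓝 B) := by
  obtain ⟨B, hB⟩ := cauchySeq_tendsto_of_complete ((h.energyCauchy_iff hu.1).1 hu.2.1)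
  refine ⟨B, ?_, hB⟩
  refine mem_closure_of_tendsto (b := atTop) (f := fun n =>
    (((h.reg _ (hu.1 n)).memLp Q).toLp (u n), h.gradLp Q (hu.1 n))) ?_
    (Eventually.of_forall fun n => h.mem_gradGraph Q (hu.1 n))
  refine Tendsto.prodMk_nhds ?_ hB
  rw [Lp.tendsto_Lp_iff_tendsto_eLpNorm']
  refine hu.2.2.congr fun n => eLpNorm_congr_ae ?_
  exact (((h.reg _ (hu.1 n)).memLp Q).coeFn_toLp.symm).sub EventuallyEq.rfl

theorem exists_formApprox (h : GradClass 𝓓) [IsFiniteMeasure Q] {w : Lp ℝ 2 Q} {B : Lp H 2 Q}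
    (hB : (w, B) ∈ closure (gradGraph Q 𝓓)) : ∃ u, FormApprox Q 𝓓 u w := by
  obtain ⟨q, hq, hlim⟩ := mem_closure_iff_seq_limit.1 hB
  choose u hu h1 h2 using hq
  have l1 := (continuous_fst.tendsto _).comp hlim
  have l2 := (continuous_snd.tendsto _).comp hlim
  refine ⟨u, hu, (h.energyCauchy_iff hu).2 ?_, ?_⟩
  · have : (fun n => h.gradLp Q (hu n)) = fun n => (q n).2 := funext fun n =>
      Lp.ext ((h.gradLp_ae (hu n)).trans (h2 n).symm)
    rw [this]
    exact l2.cauchySeq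
  · have l3 := (Lp.tendsto_Lp_iff_tendsto_eLpNorm' _ _).1 l1
    exact l3.congr fun n => eLpNorm_congr_ae ((h1 n).sub EventuallyEq.rfl)

theorem mem_closureDom_iff (h : GradClass 𝓓) [IsFiniteMeasure Q] {w : Lp ℝ 2 Q} :
    w ∈ closureDom Q 𝓓 ↔ ∃ B, (w, B) ∈ closure (gradGraph Q 𝓓) :=
  ⟨fun ⟨_, hu⟩ => (h.exists_tendsto_gradLp hu).imp fun _ hB => hB.1,
    fun ⟨_, hB⟩ => h.exists_formApprox hB⟩

theorem formClosable (h : GradClass 𝓓) (hβ : 0 < β) (hQ : IsDirichletProcess β Q) :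
    FormClosable Q 𝓓 := by
  have := hQ.isProbabilityMeasure
  intro u hu hc h0
  have hF : FormApprox Q 𝓓 u 0 := by
    refine ⟨hu, hc, h0.congr fun n => eLpNorm_congr_ae ?_⟩
    filter_upwards [Lp.coeFn_zero ℝ 2 Q] with g hg
    rw [Pi.sub_apply, hg]; simp
  obtain ⟨B, hB, hlim⟩ := h.exists_tendsto_gradLp hF
  have hB0 : B = 0 := h.snd_eq_zero hβ hQ hB rfl
  have := hlim.inner (𝕜 := ℝ) hlim
  rw [hB0, inner_zero_left] at this
  exact this.congr fun n => (h.energy_eq (hu n) (hu n)).symm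

/-- The gradients of any approximating sequences converge to `B` and `B'`, since the closed graph is
single-valued. Hence the limit selected in the definition does not depend on the choice. -/
theorem closureForm_eq (h : GradClass 𝓓) (hβ : 0 < β) (hQ : IsDirichletProcess β Q)
    {w z : Lp ℝ 2 Q} {B B' : Lp H 2 Q} (hB : (w, B) ∈ closure (gradGraph Q 𝓓))
    (hB' : (z, B') ∈ closure (gradGraph Q 𝓓)) : closureForm Q 𝓓 w z = inner ℝ B B' := by
  have := hQ.isProbabilityMeasure
  have key : ∀ {u v : ℕ → G0 → ℝ}, FormApprox Q 𝓓 u w → FormApprox Q 𝓓 v z →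
      Tendsto (fun n => energy Q (u n) (v n)) atTop (𝓝 (inner ℝ B B')) := by
    intro u v hu hv
    obtain ⟨B₁, h1, l1⟩ := h.exists_tendsto_gradLp hu
    obtain ⟨B₂, h2, l2⟩ := h.exists_tendsto_gradLp hv
    rw [h.unique hβ hQ hB h1, h.unique hβ hQ hB' h2]
    exact (l1.inner l2).congr fun n => (h.energy_eq (hu.1 n) (hv.1 n)).symm
  obtain ⟨u, hu⟩ := h.exists_formApprox hB
  obtain ⟨v, hv⟩ := h.exists_formApprox hB'
  have hex : ∃ c : ℝ, ∃ u v, FormApprox Q 𝓓 u w ∧ FormApprox Q 𝓓 v z ∧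
      Tendsto (fun n => energy Q (u n) (v n)) atTop (𝓝 c) := ⟨_, u, v, hu, hv, key hu hv⟩
  rw [closureForm, dif_pos hex]
  obtain ⟨u', v', hu', hv', hl⟩ := hex.choose_spec
  exact tendsto_nhds_unique hl (key hu' hv')

/-! ### Locality -/

/-- The chain rule for the closed gradient. The error `φ'(uₙ) Duₙ - φ'(w) B` splits into `φ'(uₙ)
(Duₙ - B)`, small in norm as `φ'` is bounded, and `(φ'(uₙ) - φ'(w)) B`, which is dominated by `2K
‖B‖` and tends to `0` almost everywhere along a subsequence. -/
theorem comp_mem_closure (h : GradClass 𝓓) [IsFiniteMeasure Q] {w : Lp ℝ 2 Q} {B : Lp H 2 Q}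
    (hB : (w, B) ∈ closure (gradGraph Q 𝓓)) {φ : ℝ → ℝ} (hφ : ContDiff ℝ 1 φ) {K : ℝ}
    (hK : ∀ x, ‖deriv φ x‖ ≤ K) {p : Lp ℝ 2 Q × Lp H 2 Q} (h1 : p.1 =ᵐ[Q] fun g => φ (w g))
    (h2 : p.2 =ᵐ[Q] fun g => deriv φ (w g) • B g) : p ∈ closure (gradGraph Q 𝓓) := by
  obtain ⟨q', hq', hlim'⟩ := mem_closure_iff_seq_limit.1 hB
  obtain ⟨ns, hns, hae⟩ := exists_subseq_ae_tendsto ((continuous_fst.tendsto _).comp hlim')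
  set q := fun n => q' (ns n) with hq_def
  have hq : ∀ n, q n ∈ gradGraph Q 𝓓 := fun n => hq' _
  have hlim : Tendsto q atTop (𝓝 (w, B)) := hlim'.comp hns.tendsto_atTop
  choose u hu e1 e2 using hq
  have l1 := (Lp.tendsto_Lp_iff_tendsto_eLpNorm' _ _).1 ((continuous_fst.tendsto _).comp hlim)
  have l2 := (Lp.tendsto_Lp_iff_tendsto_eLpNorm' _ _).1 ((continuous_snd.tendsto _).comp hlim)
  simp only [Function.comp_apply] at l1 l2
  have hd : Continuous (deriv φ) := hφ.continuous_deriv_one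
  have hK0 : 0 ≤ K := (norm_nonneg _).trans (hK 0)
  have hr : ∀ n, Reg (fun g => φ (u n g)) (fun g => deriv φ (u n g) • grad (u n) g) := fun n =>
    (h.reg _ (hu n)).comp_one hφ
  have hmem : ∀ n, (fun g => φ (u n g)) ∈ 𝓓 := fun n => h.comp_one hφ (hu n)
  have hmul : Tendsto (fun n => ENNReal.ofReal K * eLpNorm (⇑(q n).1 - ⇑w) 2 Q) atTop (𝓝 0) := by
    simpa using ENNReal.Tendsto.const_mul l1 (Or.inr ENNReal.ofReal_ne_top)
  have hmul2 : Tendsto (fun n => ENNReal.ofReal K * eLpNorm (⇑(q n).2 - ⇑B) 2 Q) atTop (𝓝 0) := by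
    simpa using ENNReal.Tendsto.const_mul l2 (Or.inr ENNReal.ofReal_ne_top)
  have hBd : Tendsto (fun n => eLpNorm (fun g => (deriv φ ((q n).1 g) - deriv φ (w g)) • B g) 2 Q)
      atTop (𝓝 0) := by
    refine tendsto_eLpNorm_two_of_dominated (b := fun g => (K + K) * ‖B g‖)
      ((Lp.memLp B).norm.const_mul (K + K)) (Eventually.of_forall fun n => ?_)
      (Eventually.of_forall fun n => Eventually.of_forall fun g => ?_) ?_
    · exact ((hd.comp_aestronglyMeasurable (Lp.aestronglyMeasurable _)).sub
        (hd.comp_aestronglyMeasurable (Lp.aestronglyMeasurable _))).smul (Lp.aestronglyMeasurable _)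
    · rw [norm_smul]
      exact mul_le_mul_of_nonneg_right (norm_sub_le_of_le (hK _) (hK _)) (norm_nonneg _)
    · filter_upwards [hae] with g hg
      have h3 : Tendsto (fun n => deriv φ ((q n).1 g) - deriv φ (w g)) atTop (𝓝 0) := by
        have h4 := ((hd.tendsto _).comp hg).sub_const (deriv φ (w g))
        rw [sub_self] at h4
        exact h4
      simpa using h3.smul_const (B g)
  refine mem_closure_of_tendsto (b := atTop) (f := fun n =>
    (((h.reg _ (hmem n)).memLp Q).toLp _, h.gradLp Q (hmem n))) ?_
    (Eventually.of_forall fun n => h.mem_gradGraph Q (hmem n))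
  refine Prod.tendsto_iff _ _ |>.2 ⟨?_, ?_⟩
  · rw [Lp.tendsto_Lp_iff_tendsto_eLpNorm']
    refine tendsto_of_tendsto_of_tendsto_of_le_of_le tendsto_const_nhds hmul
      (fun n => zero_le) (fun n => ?_)
    refine eLpNorm_le_mul_eLpNorm_of_ae_le_mul ?_ 2
    filter_upwards [((h.reg _ (hmem n)).memLp Q).coeFn_toLp, h1, e1 n] with g f1 f2 f3
    rw [Pi.sub_apply, Pi.sub_apply, f1, f2, f3]
    exact (convex_univ (𝕜 := ℝ) (E := ℝ)).norm_image_sub_le_of_norm_deriv_le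
      (fun x _ => (hφ.differentiable one_ne_zero) x) (fun x _ => hK x) (mem_univ _) (mem_univ _)
  · rw [Lp.tendsto_Lp_iff_tendsto_eLpNorm']
    have hsum := hmul2.add hBd
    rw [add_zero] at hsum
    refine tendsto_of_tendsto_of_tendsto_of_le_of_le tendsto_const_nhds hsum
      (fun n => zero_le) (fun n => ?_)
    have m1 : AEStronglyMeasurable (fun g => deriv φ ((q n).1 g) • ((q n).2 g - B g)) Q :=
      (hd.comp_aestronglyMeasurable (Lp.aestronglyMeasurable _)).smul
        ((Lp.aestronglyMeasurable _).sub (Lp.aestronglyMeasurable _))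
    have m2 : AEStronglyMeasurable (fun g => (deriv φ ((q n).1 g) - deriv φ (w g)) • B g) Q :=
      ((hd.comp_aestronglyMeasurable (Lp.aestronglyMeasurable _)).sub
        (hd.comp_aestronglyMeasurable (Lp.aestronglyMeasurable _))).smul (Lp.aestronglyMeasurable _)
    have hle : eLpNorm (fun g => deriv φ ((q n).1 g) • ((q n).2 g - B g)) 2 Q ≤
        ENNReal.ofReal K * eLpNorm (⇑(q n).2 - ⇑B) 2 Q := by
      refine eLpNorm_le_mul_eLpNorm_of_ae_le_mul (Eventually.of_forall fun g => ?_) 2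
      rw [norm_smul]
      exact mul_le_mul_of_nonneg_right (hK _) (norm_nonneg _)
    refine le_trans (le_of_eq ?_) ((eLpNorm_add_le m1 m2 (by norm_num)).trans
      (add_le_add hle le_rfl))
    refine eLpNorm_congr_ae ?_
    filter_upwards [h.gradLp_ae (Q := Q) (hmem n), h2, e1 n, e2 n] with g f1 f2 f3 f4
    rw [Pi.sub_apply, f1, f2, (hr n).grad_eq, Pi.add_apply, f3, f4]
    module

/-- The gradient of a function vanishes a.e. on its level sets. -/
theorem ae_eq_zero_of_eq_const (h : GradClass 𝓓) (hβ : 0 < β) (hQ : IsDirichletProcess β Q)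
    {w : Lp ℝ 2 Q} {B : Lp H 2 Q} (hB : (w, B) ∈ closure (gradGraph Q 𝓓)) (c : ℝ) :
    ∀ᵐ g ∂Q, w g = c → B g = 0 := by
  have := hQ.isProbabilityMeasure
  -- These functions tend to `0` uniformly, while their derivatives stay in `[0,1]` and tend to the
  -- indicator function of `{c}`. By the chain rule `(0, 1_{w = c} B)` lies in the closed graph, and
  -- closability makes its second component vanish.
  let φ : ℕ → ℝ → ℝ := fun n y => (1 / ((n : ℝ) + 1)) * Real.arctan (((n : ℝ) + 1) * (y - c))
  have hφd : ∀ n y, HasDerivAt (φ n) (1 / (1 + (((n : ℝ) + 1) * (y - c)) ^ 2)) y := by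
    intro n y
    have h1 : HasDerivAt (fun y => ((n : ℝ) + 1) * (y - c)) ((n : ℝ) + 1) y := by
      simpa using ((hasDerivAt_id y).sub_const c).const_mul ((n : ℝ) + 1)
    have h2 := (h1.arctan).const_mul (1 / ((n : ℝ) + 1))
    convert! h2 using 1
    field_simp
  have hφ' : ∀ n, deriv (φ n) = fun y => 1 / (1 + (((n : ℝ) + 1) * (y - c)) ^ 2) := fun n =>
    funext fun y => (hφd n y).deriv
  have hφC : ∀ n, ContDiff ℝ 1 (φ n) := fun n => by
    have := Real.contDiff_arctan (n := 1)
    unfold φ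
    fun_prop
  have hK : ∀ n x, ‖deriv (φ n) x‖ ≤ 1 := fun n x => by
    have h0 : 0 ≤ (((n : ℝ) + 1) * (x - c)) ^ 2 := sq_nonneg _
    rw [hφ', Real.norm_of_nonneg (by positivity)]
    simp only
    rw [div_le_one (by positivity)]
    linarith
  have hφb : ∀ n x, ‖φ n x‖ ≤ 2 * (1 / ((n : ℝ) + 1)) := fun n x => by
    have h0 : (0 : ℝ) ≤ 1 / ((n : ℝ) + 1) := by positivity
    rw [norm_mul, Real.norm_of_nonneg h0, mul_comm]
    refine mul_le_mul_of_nonneg_right ?_ h0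
    rw [Real.norm_eq_abs, abs_le]
    have := Real.pi_le_four
    constructor
    · linarith [Real.neg_pi_div_two_lt_arctan (((n : ℝ) + 1) * (x - c))]
    · linarith [Real.arctan_lt_pi_div_two (((n : ℝ) + 1) * (x - c))]
  have hm1 : ∀ n, MemLp (fun g => φ n (w g)) 2 Q := fun n =>
    memLp_of_bounded ((hφC n).continuous.comp_aestronglyMeasurable (Lp.aestronglyMeasurable _))
      fun g => hφb n _
  have hm2a : ∀ n, AEStronglyMeasurable (fun g => deriv (φ n) (w g) • B g) Q := fun n =>
    ((hφC n).continuous_deriv_one.comp_aestronglyMeasurable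
      (Lp.aestronglyMeasurable _)).smul (Lp.aestronglyMeasurable _)
  have hm2 : ∀ n, MemLp (fun g => deriv (φ n) (w g) • B g) 2 Q := fun n =>
    (Lp.memLp B).mono (hm2a n) (Eventually.of_forall fun g => by
      rw [norm_smul]; exact mul_le_of_le_one_left (norm_nonneg _) (hK n _))
  let D : G0 → H := fun g => if w g = c then B g else 0
  have hlim : ∀ g, Tendsto (fun n => deriv (φ n) (w g) • B g) atTop (𝓝 (D g)) := by
    intro g
    by_cases hg : w g = c
    · simp only [D, if_pos hg, hφ', hg, sub_self, mul_zero]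
      simp
    · simp only [D, if_neg hg]
      have hpos : 0 < (w g - c) ^ 2 := by
        have : w g - c ≠ 0 := sub_ne_zero.2 hg
        positivity
      have h1 : Tendsto (fun n : ℕ => 1 / (1 + (((n : ℝ) + 1) * (w g - c)) ^ 2)) atTop (𝓝 0) := by
        simp only [one_div]
        refine tendsto_inv_atTop_zero.comp (tendsto_atTop_add_const_left _ _ ?_)
        simp only [mul_pow]
        refine Tendsto.atTop_mul_const hpos ((tendsto_pow_atTop two_ne_zero).comp ?_)
        exact tendsto_atTop_add_const_right _ _ tendsto_natCast_atTop_atTop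
      simp only [hφ']
      simpa using h1.smul_const (B g)
  have hDm : AEStronglyMeasurable D Q :=
    aestronglyMeasurable_of_tendsto_ae atTop hm2a (Eventually.of_forall hlim)
  have hDb : ∀ g, ‖D g‖ ≤ ‖B g‖ := fun g => by
    simp only [D]
    split_ifs
    · exact le_rfl
    · simp
  have hD : MemLp D 2 Q := (Lp.memLp B).mono hDm (Eventually.of_forall hDb)
  have hmem : ((0 : Lp ℝ 2 Q), hD.toLp D) ∈ closure (gradGraph Q 𝓓) := by
    refine isClosed_closure.mem_of_tendsto (b := atTop)
      (f := fun n => ((hm1 n).toLp _, (hm2 n).toLp _)) ?_ (Eventually.of_forall fun n =>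
        h.comp_mem_closure hB (hφC n) (hK n) (hm1 n).coeFn_toLp (hm2 n).coeFn_toLp)
    refine Prod.tendsto_iff _ _ |>.2 ⟨?_, ?_⟩
    · refine Lp_tendsto_of_bounded 2 (fun n => ?_) ?_
      · filter_upwards [(hm1 n).coeFn_toLp] with g hg
        rw [hg]
        refine (hφb n _).trans ?_
        have : 1 / ((n : ℝ) + 1) ≤ 1 := by
          rw [div_le_one (by positivity)]
          linarith [n.cast_nonneg (α := ℝ)]
        linarith
      · filter_upwards [ae_all_iff.2 fun n => (hm1 n).coeFn_toLp, Lp.coeFn_zero ℝ 2 Q] with g hg h0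
        simp only [hg, h0, Pi.zero_apply]
        refine squeeze_zero_norm (fun n => hφb n _) ?_
        simpa using (tendsto_one_div_add_atTop_nhds_zero_nat (𝕜 := ℝ)).const_mul 2
    · simp only
      rw [Lp.tendsto_Lp_iff_tendsto_eLpNorm'']
      refine tendsto_eLpNorm_two_of_dominated (b := fun g => ‖B g‖ + ‖B g‖)
        ((Lp.memLp B).norm.add (Lp.memLp B).norm) (Eventually.of_forall fun n => (hm2a n).sub hDm)
        (Eventually.of_forall fun n => Eventually.of_forall fun g => ?_)
        (Eventually.of_forall fun g => ?_)
      · refine norm_sub_le_of_le ?_ (hDb g)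
        rw [norm_smul]
        exact mul_le_of_le_one_left (norm_nonneg _) (hK n _)
      · have := (hlim g).sub_const (D g)
        rwa [sub_self] at this
  have hzero := h.snd_eq_zero hβ hQ hmem rfl
  simp only at hzero
  filter_upwards [hD.coeFn_toLp, Lp.coeFn_zero H 2 Q] with g h1 h2 h3
  rw [hzero, h2] at h1
  simp only [D, if_pos h3] at h1
  simpa using h1.symm

end GradClass

section

variable {β : ℝ} {Q : Measure G0}

namespace IsDirichletProcess

/-! ### Identification of the two closures -/

theorem closure_gradGraph_C1 (hQ : IsDirichletProcess β Q) :
    closure (gradGraph Q C1) = closure (gradGraph Q Z1) := by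
  have := hQ.isProbabilityMeasure
  exact (closure_minimal (gradGraph_C1_subset hQ.ae_strictMono) isClosed_closure).antisymm
    (closure_minimal gradGraph_Z1_subset isClosed_closure)

theorem closure_gradOp_C1 (hβ : 0 < β) (hQ : IsDirichletProcess β Q) :
    (gradOp Q C1).closure = gradBar Q := by
  refine LinearPMap.eq_of_eq_graph (SetLike.coe_injective ?_)
  rw [gradClass_C1.graph_closure_gradOp hβ hQ, gradBar, gradClass_Z1.graph_closure_gradOp hβ hQ,
    hQ.closure_gradGraph_C1]

theorem mem_domE_iff (hQ : IsDirichletProcess β Q) {w : Lp ℝ 2 Q} :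
    w ∈ domE Q ↔ ∃ B, (w, B) ∈ closure (gradGraph Q Z1) := by
  have := hQ.isProbabilityMeasure
  exact gradClass_Z1.mem_closureDom_iff

theorem closureDom_C1 (hQ : IsDirichletProcess β Q) : closureDom Q C1 = domE Q := by
  have := hQ.isProbabilityMeasure
  ext w
  rw [hQ.mem_domE_iff, gradClass_C1.mem_closureDom_iff, hQ.closure_gradGraph_C1]

theorem domain_gradBar (hβ : 0 < β) (hQ : IsDirichletProcess β Q) :
    ((gradBar Q).domain : Set (Lp ℝ 2 Q)) = domE Q := by
  ext w
  rw [hQ.mem_domE_iff, SetLike.mem_coe, LinearPMap.mem_domain_iff,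
    ← gradClass_Z1.graph_closure_gradOp hβ hQ]
  rfl

theorem carre_eq (hβ : 0 < β) (hQ : IsDirichletProcess β Q) {w z : Lp ℝ 2 Q} {B B' : Lp H 2 Q}
    (hB : (w, B) ∈ closure (gradGraph Q Z1)) (hB' : (z, B') ∈ closure (gradGraph Q Z1)) (g : G0) :
    carre Q w z g = inner ℝ (B g) (B' g) := by
  have key : ∀ {w : Lp ℝ 2 Q} {B : Lp H 2 Q}, (w, B) ∈ closure (gradGraph Q Z1) →
      ∃ h : w ∈ (gradBar Q).domain, gradBar Q ⟨w, h⟩ = B := by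
    intro w B h
    rw [← gradClass_Z1.graph_closure_gradOp hβ hQ, SetLike.mem_coe, LinearPMap.mem_graph_iff] at h
    obtain ⟨y, h1, h2⟩ := h
    subst h1
    exact ⟨y.2, h2⟩
  obtain ⟨h1, e1⟩ := key hB
  obtain ⟨h2, e2⟩ := key hB'
  rw [carre, dif_pos ⟨h1, h2⟩, e1, e2]

theorem formE_eq (hβ : 0 < β) (hQ : IsDirichletProcess β Q) {w z : Lp ℝ 2 Q} {B B' : Lp H 2 Q}
    (hB : (w, B) ∈ closure (gradGraph Q Z1)) (hB' : (z, B') ∈ closure (gradGraph Q Z1)) :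
    formE Q w z = inner ℝ B B' := gradClass_Z1.closureForm_eq hβ hQ hB hB'

theorem closureForm_C1 (hβ : 0 < β) (hQ : IsDirichletProcess β Q) {w z : Lp ℝ 2 Q}
    (hw : w ∈ domE Q) (hz : z ∈ domE Q) : closureForm Q C1 w z = formE Q w z := by
  obtain ⟨B, hB⟩ := hQ.mem_domE_iff.1 hw
  obtain ⟨B', hB'⟩ := hQ.mem_domE_iff.1 hz
  rw [hQ.formE_eq hβ hB hB']
  rw [← hQ.closure_gradGraph_C1] at hB hB'
  exact gradClass_C1.closureForm_eq hβ hQ hB hB'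

/-! ### Cylinder functions -/

theorem mem_closure_of_mem (hQ : IsDirichletProcess β Q) {u : G0 → ℝ}
    (hu : u ∈ Z1 ∪ C1) : ∃ (h1 : MemLp u 2 Q) (h2 : MemLp (grad u) 2 Q),
      (h1.toLp u, h2.toLp (grad u)) ∈ closure (gradGraph Q Z1) := by
  have := hQ.isProbabilityMeasure
  rcases hu with hu | hu
  · exact ⟨_, _, subset_closure (gradClass_Z1.mem_gradGraph Q hu)⟩
  · rw [← hQ.closure_gradGraph_C1]
    exact ⟨_, _, subset_closure (gradClass_C1.mem_gradGraph Q hu)⟩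

theorem carre_form_of_mem (hβ : 0 < β) (hQ : IsDirichletProcess β Q) {u w : G0 → ℝ}
    (hu : u ∈ Z1 ∪ C1) (hw : w ∈ Z1 ∪ C1) :
    MemLp (grad u) 2 Q ∧ ∃ (hu : MemLp u 2 Q) (hw : MemLp w 2 Q),
      hu.toLp u ∈ domE Q ∧ hw.toLp w ∈ domE Q ∧
      carre Q (hu.toLp u) (hw.toLp w) =ᵐ[Q] (fun g => inner ℝ (grad u g) (grad w g)) ∧
      formE Q (hu.toLp u) (hw.toLp w) = ∫ g, inner ℝ (grad u g) (grad w g) ∂Q := by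
  obtain ⟨h1, h2, h3⟩ := hQ.mem_closure_of_mem hu
  obtain ⟨k1, k2, k3⟩ := hQ.mem_closure_of_mem hw
  have hae : (fun g => inner ℝ (h2.toLp (grad u) g) (k2.toLp (grad w) g)) =ᵐ[Q]
      fun g => (inner ℝ (grad u g) (grad w g) : ℝ) := by
    filter_upwards [h2.coeFn_toLp, k2.coeFn_toLp] with g e1 e2
    rw [e1, e2]
  refine ⟨h2, h1, k1, hQ.mem_domE_iff.2 ⟨_, h3⟩, hQ.mem_domE_iff.2 ⟨_, k3⟩, ?_, ?_⟩
  · rw [funext (hQ.carre_eq hβ h3 k3)]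
    exact hae
  · rw [hQ.formE_eq hβ h3 k3, L2.inner_def]
    exact integral_congr_ae hae

/-! ### Strong locality -/

/-- Almost everywhere on `{u = 0}` the gradient of `u` vanishes; almost every other point lies in
the support of `u`, where `v = c` and the gradient of `v` vanishes. -/
theorem stronglyLocal (hβ : 0 < β) (hQ : IsDirichletProcess β Q) :
    StronglyLocal Q (domE Q) (formE Q) := by
  rintro u hu v hv - - ⟨O, c, -, hsub, hvc⟩
  obtain ⟨B, hB⟩ := hQ.mem_domE_iff.1 hu
  obtain ⟨B', hB'⟩ := hQ.mem_domE_iff.1 hv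
  have hm : AEMeasurable (fun g => ‖u g‖ₑ) Q := (Lp.aestronglyMeasurable u).enorm
  -- The complement of the support is a null set because `𝒢₀` is second countable.
  have hnull : (Q.withDensity fun g => ‖u g‖ₑ) (Q.withDensity fun g => ‖u g‖ₑ).supportᶜ = 0 :=
    Measure.measure_compl_support
  have hsupp : ∀ᵐ g ∂Q, u g ≠ 0 → g ∈ (Q.withDensity fun g => ‖u g‖ₑ).support := by
    have h1 : ∀ᵐ g ∂(Q.withDensity fun g => ‖u g‖ₑ),
      g ∈ (Q.withDensity fun g => ‖u g‖ₑ).support := hnull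
    filter_upwards [(ae_withDensity_iff' hm).1 h1] with g hg h0
    exact hg (by simpa using h0)
  rw [hQ.formE_eq hβ hB hB', L2.inner_def]
  refine integral_eq_zero_of_ae ?_
  filter_upwards [hsupp, hvc, gradClass_Z1.ae_eq_zero_of_eq_const hβ hQ hB 0,
    gradClass_Z1.ae_eq_zero_of_eq_const hβ hQ hB' c] with g e1 e2 e3 e4
  by_cases h0 : u g = 0
  · rw [e3 h0, inner_zero_left]; rfl
  · rw [e4 (e2 (hsub (e1 h0))), inner_zero_right]; rfl

end IsDirichletProcess

/-! ### Distance functions -/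

theorem G0.norm_sub_sq (f : G0) {a : ℝ → ℝ}
    (h : ∀ x ∈ Icc (0 : ℝ) 1, a x = x ^ 2) (g : G0) :
    potFun a g - 2 * linFun f.toL2 g + ‖f.toL2‖ ^ 2 = ‖f.toL2 - g.toL2‖ ^ 2 := by
  have h1 : potFun a g = ‖g.toL2‖ ^ 2 := by
    rw [← real_inner_self_eq_norm_sq, inner_H]
    refine integral_congr_ae ?_
    filter_upwards [g.toL2_ae] with t ht
    rw [ht, h _ (g t).2, sq]
  rw [h1, linFun_eq, norm_sub_sq_real]
  ring

/-- Expanding the square writes `‖f - g‖²` through one potential, with `α x = x²`, and one linear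
functional; for `δ > 0` the root is a `C¹` function of these. -/
theorem approx_sqrt_add_norm_sq (Q : Measure G0) (f : G0) {δ : ℝ} (hδ : 0 < δ) :
    Approx Q C1 (fun g => √(δ + ‖f.toL2 - g.toL2‖ ^ 2))
      (fun g => (√(δ + ‖f.toL2 - g.toL2‖ ^ 2))⁻¹ • (g.toL2 - f.toL2)) := by
  obtain ⟨a, ha, ha1, ha2, C, hC⟩ :=
    exists_contDiff_extension (α := fun x => x ^ 2) (by fun_prop)
  -- Since `‖f - g‖² ≤ 4`, the variable `s = ‖f - g‖² / 4` ranges in `[0,1]`, as the extension lemma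
  -- requires.
  obtain ⟨b, hb, hb1, hb2, -⟩ :=
    exists_contDiff_extension (α := fun s => √(δ + 4 * s)) (fun x hx => by
      refine ((contDiffAt_const.add (contDiffAt_const.mul contDiffAt_id)).sqrt ?_).contDiffWithinAt
      have := hx.1
      simp only [id]
      positivity)
  have hgrad : ∀ g : G0, g.compH (deriv a) = (2 : ℝ) • g.toL2 := by
    intro g
    refine Lp.ext ?_
    filter_upwards [G0.compH_ae ha.continuous_deriv_one g, Lp.coeFn_smul (2 : ℝ) g.toL2, g.toL2_ae]
      with t h1 h2 h3
    rw [h1, h2, Pi.smul_apply, h3, ha2 _ (g t).2]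
    have := ((hasDerivAt_pow 2 (g t : ℝ)).hasDerivWithinAt (s := Icc 0 1)).derivWithin
      (uniqueDiffOn_Icc_zero_one _ (g t).2)
    rw [this]; simp
  let U : (Bool → ℝ) → ℝ := fun y => b ((y true - 2 * y false + ‖f.toL2‖ ^ 2) / 4)
  have hU : ContDiff ℝ 1 U := hb.comp (by fun_prop)
  have hA := Approx.comp (Q := Q) gradClass_C1 hU (u := fun i => if i then potFun a else linFun f.toL2)
    (V := fun i => if i then G0.compH (deriv a) else fun _ => f.toL2) (fun i => by
      cases i
      · have hmem : linFun f.toL2 ∈ C1 := ⟨1, fun y => y 0, fun _ => f.toL2, by fun_prop, rfl⟩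
        have := Approx.of_mem (Q := Q) gradClass_C1 hmem
        rwa [(reg_linFun f.toL2).grad_eq] at this
      · exact approx_potFun Q ha hC)
  have hs : ∀ g : G0, ‖f.toL2 - g.toL2‖ ^ 2 / 4 ∈ Icc (0 : ℝ) 1 := by
    intro g
    have h1 := norm_sub_le_of_le f.norm_toL2_le g.norm_toL2_le
    have h2 := norm_nonneg (f.toL2 - g.toL2)
    constructor
    · positivity
    · nlinarith
  convert! hA using 1
  · funext g
    simp only [U, if_true, Bool.false_eq_true, if_false, G0.norm_sub_sq f ha1]
    rw [hb1 _ (hs g)]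
    congr 2; ring
  · funext g
    have hderiv : deriv b (‖f.toL2 - g.toL2‖ ^ 2 / 4) =
        2 * (√(δ + ‖f.toL2 - g.toL2‖ ^ 2))⁻¹ := by
      have h0 : δ + 4 * (‖f.toL2 - g.toL2‖ ^ 2 / 4) ≠ 0 := by positivity
      have h1 : HasDerivAt (fun s => √(δ + 4 * s)) _ (‖f.toL2 - g.toL2‖ ^ 2 / 4) :=
        (((hasDerivAt_id _).const_mul 4).const_add δ).sqrt h0
      rw [hb2 _ (hs g), (h1.hasDerivWithinAt (s := Icc 0 1)).derivWithin
        (uniqueDiffOn_Icc_zero_one _ (hs g))]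
      rw [show δ + 4 * (‖f.toL2 - g.toL2‖ ^ 2 / 4) = δ + ‖f.toL2 - g.toL2‖ ^ 2 by ring]
      ring
    set y : Bool → ℝ := fun i => (if i then potFun a else linFun f.toL2) g with hy
    have hy' : (y true - 2 * y false + ‖f.toL2‖ ^ 2) / 4 = ‖f.toL2 - g.toL2‖ ^ 2 / 4 := by
      simp only [hy, if_true, Bool.false_eq_true, if_false, G0.norm_sub_sq f ha1]
    have hL : HasFDerivAt U (deriv b (‖f.toL2 - g.toL2‖ ^ 2 / 4) • ((1 / 4 : ℝ) •
        (ContinuousLinearMap.proj true - (2 : ℝ) • ContinuousLinearMap.proj false) :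
          (Bool → ℝ) →L[ℝ] ℝ)) y := by
      have h1 : HasFDerivAt (fun y : Bool → ℝ => (y true - 2 * y false + ‖f.toL2‖ ^ 2) / 4)
          ((1 / 4 : ℝ) • (ContinuousLinearMap.proj true -
            (2 : ℝ) • ContinuousLinearMap.proj false) : (Bool → ℝ) →L[ℝ] ℝ) y := by
        have h2 := ((((ContinuousLinearMap.proj true : (Bool → ℝ) →L[ℝ] ℝ).hasFDerivAt (x := y)).sub
          ((ContinuousLinearMap.proj false : (Bool → ℝ) →L[ℝ] ℝ).hasFDerivAt.const_smul
            (2 : ℝ))).add_const (‖f.toL2‖ ^ 2)).const_smul (1 / 4 : ℝ)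
        refine h2.congr_of_eventuallyEq (Eventually.of_forall fun z => ?_)
        simp
        ring
      have h3 : HasDerivAt b (deriv b (‖f.toL2 - g.toL2‖ ^ 2 / 4))
          ((y true - 2 * y false + ‖f.toL2‖ ^ 2) / 4) := by
        rw [hy']
        exact (hb.differentiable one_ne_zero _).hasDerivAt
      exact h3.comp_hasFDerivAt y h1
    rw [chainGrad, hL.fderiv, Fintype.sum_bool, hderiv]
    simp [hgrad]
    module

theorem norm_inv_sqrt_smul_le {E : Type*} [NormedAddCommGroup E] [NormedSpace ℝ E] {δ : ℝ}
    (hδ : 0 ≤ δ) (v : E) : ‖(√(δ + ‖v‖ ^ 2))⁻¹ • v‖ ≤ 1 := by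
  rw [norm_smul, norm_inv, Real.norm_of_nonneg (Real.sqrt_nonneg _)]
  refine inv_mul_le_one_of_le₀ ?_ (Real.sqrt_nonneg _)
  exact Real.le_sqrt_of_sq_le (by linarith)

namespace IsDirichletProcess

/-- As `δ → 0` the regularised distances converge, and their gradients converge pointwise with norm
at most `1`; at `g = f` all of these gradients are `0`. The limit gradient therefore also has norm
at most `1`. -/
theorem carre_dist_le (hβ : 0 < β) (hQ : IsDirichletProcess β Q) (f : G0) :
    ∃ hf : MemLp (fun g : G0 => ‖f.toL2 - g.toL2‖) 2 Q,
      hf.toLp _ ∈ domE Q ∧ ∀ᵐ g ∂Q, carre Q (hf.toLp _) (hf.toLp _) g ≤ 1 := by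
  have := hQ.isProbabilityMeasure
  have hc : Continuous fun g : G0 => f.toL2 - g.toL2 := continuous_const.sub G0.continuous_toL2
  let δ : ℕ → ℝ := fun n => 1 / ((n : ℝ) + 1)
  have hδ : ∀ n, 0 < δ n := fun n => by positivity
  have hδ1 : ∀ n, δ n ≤ 1 := fun n => by
    simp only [δ]
    rw [div_le_one (by positivity)]
    linarith [n.cast_nonneg (α := ℝ)]
  have hδ0 : Tendsto δ atTop (𝓝 0) := tendsto_one_div_add_atTop_nhds_zero_nat
  let r : ℕ → G0 → ℝ := fun n g => √(δ n + ‖f.toL2 - g.toL2‖ ^ 2)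
  let V : ℕ → G0 → H := fun n g => (r n g)⁻¹ • (g.toL2 - f.toL2)
  let V' : G0 → H := fun g => (‖f.toL2 - g.toL2‖)⁻¹ • (g.toL2 - f.toL2)
  have hrc : ∀ n, Continuous (r n) := fun n => by unfold r; fun_prop
  have hr0 : ∀ n g, r n g ≠ 0 := fun n g => (Real.sqrt_pos.2 (by have := hδ n; positivity)).ne'
  have hn2 : ∀ g : G0, ‖f.toL2 - g.toL2‖ ≤ 2 := fun g => by
    have := norm_sub_le_of_le f.norm_toL2_le g.norm_toL2_le
    linarith
  have hr3 : ∀ n g, ‖r n g‖ ≤ 3 := fun n g => by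
    rw [Real.norm_of_nonneg (Real.sqrt_nonneg _), Real.sqrt_le_left (by norm_num)]
    nlinarith [hδ1 n, hn2 g, norm_nonneg (f.toL2 - g.toL2)]
  have hV1 : ∀ n g, ‖V n g‖ ≤ 1 := fun n g => by
    have := norm_inv_sqrt_smul_le (hδ n).le (g.toL2 - f.toL2)
    rwa [norm_sub_rev] at this
  have hrlim : ∀ g, Tendsto (fun n => r n g) atTop (𝓝 ‖f.toL2 - g.toL2‖) := by
    intro g
    have h1 := (hδ0.add_const (‖f.toL2 - g.toL2‖ ^ 2)).sqrt
    rwa [zero_add, Real.sqrt_sq (norm_nonneg _)] at h1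
  have hVlim : ∀ g, Tendsto (fun n => V n g) atTop (𝓝 (V' g)) := by
    intro g
    by_cases h0 : g.toL2 - f.toL2 = 0
    · simp [V, V', h0]
    · have h1 : ‖f.toL2 - g.toL2‖ ≠ 0 := by rwa [norm_sub_rev, norm_ne_zero_iff]
      exact ((hrlim g).inv₀ h1).smul_const _
  have hVm : ∀ n, AEStronglyMeasurable (V n) Q := fun n =>
    (((hrc n).inv₀ (hr0 n)).smul (G0.continuous_toL2.sub continuous_const)).aestronglyMeasurable
  have hV'm : AEStronglyMeasurable V' Q :=
    aestronglyMeasurable_of_tendsto_ae atTop hVm (Eventually.of_forall hVlim)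
  have hV'1 : ∀ g, ‖V' g‖ ≤ 1 := fun g => le_of_tendsto' (hVlim g).norm fun n => hV1 n g
  have hf : MemLp (fun g : G0 => ‖f.toL2 - g.toL2‖) 2 Q :=
    memLp_of_bounded hc.norm.aestronglyMeasurable fun g => by rw [norm_norm]; exact hn2 g
  have hr : ∀ n, MemLp (r n) 2 Q := fun n =>
    memLp_of_bounded (hrc n).aestronglyMeasurable (hr3 n)
  have hVp : ∀ n, MemLp (V n) 2 Q := fun n => memLp_of_bounded (hVm n) (hV1 n)
  have hV'p : MemLp V' 2 Q := memLp_of_bounded hV'm hV'1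
  have hmem : (hf.toLp _, hV'p.toLp V') ∈ closure (gradGraph Q Z1) := by
    rw [← hQ.closure_gradGraph_C1]
    refine isClosed_closure.mem_of_tendsto (b := atTop)
      (f := fun n => ((hr n).toLp _, (hVp n).toLp _)) ?_ (Eventually.of_forall fun n =>
        (approx_sqrt_add_norm_sq Q f (hδ n)).mem_closure gradClass_C1 (hr n).coeFn_toLp
          (hVp n).coeFn_toLp)
    refine Tendsto.prodMk_nhds (Lp_tendsto_of_bounded 3 (fun n => ?_) ?_)
      (Lp_tendsto_of_bounded 1 (fun n => ?_) ?_)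
    · filter_upwards [(hr n).coeFn_toLp] with g h1
      rw [h1]; exact hr3 n g
    · filter_upwards [ae_all_iff.2 fun n => (hr n).coeFn_toLp, hf.coeFn_toLp] with g h1 h2
      simp only [h1, h2]; exact hrlim g
    · filter_upwards [(hVp n).coeFn_toLp] with g h1
      rw [h1]; exact hV1 n g
    · filter_upwards [ae_all_iff.2 fun n => (hVp n).coeFn_toLp, hV'p.coeFn_toLp] with g h1 h2
      simp only [h1, h2]; exact hVlim g
  refine ⟨hf, hQ.mem_domE_iff.2 ⟨_, hmem⟩, ?_⟩
  filter_upwards [hV'p.coeFn_toLp] with g h1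
  rw [hQ.carre_eq hβ hmem hmem, h1, real_inner_self_eq_norm_sq]
  exact pow_le_one₀ (norm_nonneg _) (hV'1 g)

end IsDirichletProcess

end

end

end Wasserstein


theorem mainTheorem11 (β : ℝ) (hβ : 0 < β) (Q : Measure G0) (hQ : IsDirichletProcess β Q) :
    -- the gradients of cylinder functions exist and are given by the explicit formulas
    ((∀ (m : ℕ) (U : (Fin m → ℝ) → ℝ) (α : Fin m → ℝ → ℝ), ContDiff ℝ 1 U →
        (∀ i, ContDiffOn ℝ 1 (α i) (Icc 0 1)) → ∀ g : G0,
          HasGradAt (zylFun U α) (grad (zylFun U α) g) g ∧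
          grad (zylFun U α) g =ᵐ[volume] fun s : I =>
            ∑ i, fderiv ℝ U (fun j => ∫ r : I, α j (g r)) (Pi.single i 1) *
              derivWithin (α i) (Icc 0 1) (g s)) ∧
      (∀ (m : ℕ) (U : (Fin m → ℝ) → ℝ) (f : Fin m → H), ContDiff ℝ 1 U → ∀ g : G0,
          HasGradAt (cylFun U f) (grad (cylFun U f) g) g ∧
          grad (cylFun U f) g =
            ∑ i, fderiv ℝ U (fun j => ∫ r : I, f j r * (g r : ℝ)) (Pi.single i 1) • f i)) ∧
    -- the closed form and the closed operator obtained from the first class of cylinder functions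
    (FormClosable Q Z1 ∧
      ((gradOp Q Z1).graph : Set (Lp ℝ 2 Q × Lp H 2 Q)) = gradGraph Q Z1 ∧
      (gradOp Q Z1).IsClosable ∧
      ((gradBar Q).domain : Set (Lp ℝ 2 Q)) = domE Q) ∧
    -- (i) for the form
    (FormClosable Q C1 ∧ closureDom Q C1 = domE Q ∧
      ∀ w ∈ domE Q, ∀ z ∈ domE Q, closureForm Q C1 w z = formE Q w z) ∧
    -- (i) for the gradient
    (((gradOp Q C1).graph : Set (Lp ℝ 2 Q × Lp H 2 Q)) = gradGraph Q C1 ∧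
      (gradOp Q C1).IsClosable ∧ (gradOp Q C1).closure = gradBar Q) ∧
    -- (ii)
    (∀ u ∈ Z1 ∪ C1, ∀ w ∈ Z1 ∪ C1,
      MemLp (grad u) 2 Q ∧ ∃ (hu : MemLp u 2 Q) (hw : MemLp w 2 Q),
        hu.toLp u ∈ domE Q ∧ hw.toLp w ∈ domE Q ∧
        carre Q (hu.toLp u) (hw.toLp w) =ᵐ[Q] (fun g => inner ℝ (grad u g) (grad w g)) ∧
        formE Q (hu.toLp u) (hw.toLp w) = ∫ g, inner ℝ (grad u g) (grad w g) ∂Q) ∧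
    -- (iii)
    (∀ f : G0, ∃ hf : MemLp (fun g : G0 => ‖f.toL2 - g.toL2‖) 2 Q,
      hf.toLp _ ∈ domE Q ∧ ∀ᵐ g ∂Q, carre Q (hf.toLp _) (hf.toLp _) g ≤ 1) ∧
    -- (iv)
    StronglyLocal Q (domE Q) (formE Q) := by
  exact ⟨⟨fun m U α hU hα g => hasGradAt_zylFun hU hα g, fun m U f hU g => hasGradAt_cylFun hU f g⟩,
    ⟨gradClass_Z1.formClosable hβ hQ, by rw [gradClass_Z1.graph_gradOp hβ hQ]; rfl,
      gradClass_Z1.isClosable_gradOp hβ hQ, hQ.domain_gradBar hβ⟩,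
    ⟨gradClass_C1.formClosable hβ hQ, hQ.closureDom_C1,
      fun _ hw _ hz => hQ.closureForm_C1 hβ hw hz⟩,
    ⟨by rw [gradClass_C1.graph_gradOp hβ hQ]; rfl, gradClass_C1.isClosable_gradOp hβ hQ,
      hQ.closure_gradOp_C1 hβ⟩,
    fun _ hu _ hw => hQ.carre_form_of_mem hβ hu hw, fun f => hQ.carre_dist_le hβ f,
    hQ.stronglyLocal hβ⟩
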